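/- Let $G\subset \mathrm{GL}(N,\mathbb{C})$ be a connected closed complex semisimple Lie group with Lie algebra $\mathfrak g$ (every connected complex semisimple Lie group is of this form up to isomorphism), and let $U\subset G$ be a connected compact real form, with Lie algebra $\mathfrak u$, so that $\mathfrak g=\mathfrak u\oplus\sqrt{-1}\,\mathfrak u$. Fix a Cartan subalgebra $\mathfrak t$ of $\mathfrak u$, with complexification $\mathfrak h=\mathfrak t\oplus\sqrt{-1}\,\mathfrak t$, a system $\Sigma$ of simple roots of $(\mathfrak g,\mathfrak h)$ and a subset $\Theta\subset\Sigma$. Let $\langle\Theta\rangle$ be the set of roots generated by $\Theta$, let $\mathfrak p_\Theta$ be the sum of $\mathfrak h$ and of the root spaces $\mathfrak g_\alpha$ for all $\alpha$ that are positive or in $\langle\Theta\rangle$, let $P_\Theta$ be the normalizer of $\mathfrak p_\Theta$ in $G$, $U_\Theta=U\cap P_\Theta$, and let $\mathbb F_\Theta=U/U_\Theta\ (=G/P_\Theta)$ be the flag manifold. A triple $(K,L,\sigma)$ is a symmetric space if $K$ is a connected Lie group, $L$ a closed subgroup and $\sigma$ an involutive automorphism of $K$ ($\sigma^2=1$) with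 $(K^\sigma)_0\subset L\subset K^\sigma$, where $K^\sigma$ is the fixed-point group and $(K^\sigma)_0$ its identity component. A triple $(\mathfrak l,\mathfrak k,\sigma)$ is a symmetric Lie algebra if $\sigma$ is an involutive automorphism of the Lie algebra $\mathfrak l$ and $\mathfrak k$ is the subalgebra of all its fixed elements. Suppose that $\mathbb F_\Theta$ is a symmetric flag space, i.e. that $(U,U_\Theta,\tau)$ is a symmetric space for some involutive automorphism $\tau$ of $U$. Then there is an element $H_\Theta\in\mathfrak t$ with $\Theta=\{\alpha\in\Sigma:\alpha(H_\Theta)=0\}$ such that, for $\sigma:=C_{\exp H_\Theta}$, the conjugation by $\exp H_\Theta$ on $U$ and on $G$, and for $Z_\Theta:=Z_G(H_\Theta)=\{g\in G:\mathrm{Ad}(g)H_\Theta=H_\Theta\}$: 1. $U_\Theta=Z_U(H_\Theta)$ and $(U,U_\Theta,\sigma)$ is a symmetric space. If $U_\Theta$ is the full fixed-point group of $\tau$, then $U_\Theta=\{u\in U: C_{\exp H_\Theta}(u)=u\}$ and $Z_\Theta=\{g\in G: C_{\exp H_\Theta}(g)=g\}$. 2. $(G,Z_\Theta,\sigma)$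 is a symmetric space, and $G/Z_\Theta$ (the adjoint orbit of $H_\Theta$) is the cotangent bundle of $\mathbb F_\Theta$: for the smooth structures of $U/U_\Theta$ and $G/Z_\Theta$ as homogeneous manifolds there is a diffeomorphism $\Phi:T^*\mathbb F_\Theta\to G/Z_\Theta$ that is $U$-equivariant, maps the cotangent space at $uU_\Theta$ into the fibre of $G/Z_\Theta\to G/P_\Theta$ over $uP_\Theta$ for every $u\in U$, and such that, under $gZ_\Theta\mapsto \mathrm{Ad}(g)H_\Theta$, its restriction to that cotangent space has the form $\xi\mapsto \mathrm{Ad}(u)H_\Theta+\ell_u(\xi)$ with $\ell_u$ a real linear map. 3. With $\sigma$ also denoting $\mathrm{Ad}(\exp H_\Theta)$ on $\mathfrak u$ and on $\mathfrak g$, both $(\mathfrak u,\mathfrak u_\Theta,\sigma)$ and $(\mathfrak g,\mathfrak z_{\mathfrak g}(H_\Theta),\sigma)$ are symmetric Lie algebras, where $\mathfrak u_\Theta$ is the Lie algebra of $U_\Theta$ and $\mathfrak z_{\mathfrak g}(H_\Theta)$ is the centralizer of $H_\Theta$ in $\mathfrak g$. -/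

import Mathlib

open scoped Manifold ContDiff

/- The Lie bracket of matrices is the commutator. -/
attribute [local instance] LieRing.ofAssociativeRing

namespace SymFlag

/-- Complex `N × N` matrices. -/
abbrev Mat (N : ℕ) : Type := Matrix (Fin N) (Fin N) ℂ

/-- The group `GL(N, ℂ)`, with its usual topology. -/
abbrev GLN (N : ℕ) : Type := Matrix.GeneralLinearGroup (Fin N) ℂ

noncomputable section

/-! ### Symmetric spaces and symmetric Lie algebras -/

/-- `(K, L, σ)` is a symmetric space: `K` is a connected (Lie) group, `L` a closed subgroup, `σ` an
involutive automorphism of `K`, and `L` lies between the fixed-point group of `σ` and the identity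
component of that group. (Continuous automorphisms of Lie groups are automatically smooth.) -/
structure IsSymmetricSpace {K : Type*} [Group K] [TopologicalSpace K]
    (L : Subgroup K) (σ : K ≃* K) : Prop where
  connected : ConnectedSpace K
  closed : IsClosed (L : Set K)
  continuous : Continuous σ
  involutive : ∀ a, σ (σ a) = a
  component_le : connectedComponentIn {a : K | σ a = a} 1 ⊆ (L : Set K)
  le_fixed : ∀ a ∈ L, σ a = a

/-- `(𝔩, 𝔨, σ)` is a symmetric Lie algebra: `σ` is an involutive automorphism of `𝔩` and the
subalgebra `𝔨` consists of all the elements fixed by `σ`. -/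
structure IsSymmetricLieAlgebra {R L : Type*} [CommRing R] [LieRing L] [LieAlgebra R L]
    (k : LieSubalgebra R L) (σ : L ≃ₗ⁅R⁆ L) : Prop where
  involutive : ∀ X, σ (σ X) = X
  fixed : ∀ X, X ∈ k ↔ σ X = X

/-- The centralizer `𝔷(H)` of an element `H` of a Lie algebra. -/
def lieCentralizer (R : Type*) {L : Type*} [CommRing R] [LieRing L] [LieAlgebra R L] (H : L) :
    LieSubalgebra R L where
  carrier := {X | ⁅H, X⁆ = 0}
  add_mem' := by
    intro X Y hX hY
    simp only [Set.mem_ofPred_eq] at hX hY ⊢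
    rw [lie_add, hX, hY, add_zero]
  zero_mem' := by simp
  smul_mem' := by
    intro c X hX
    simp only [Set.mem_ofPred_eq] at hX ⊢
    rw [lie_smul, hX, smul_zero]
  lie_mem' := by
    intro X Y hX hY
    simp only [Set.mem_ofPred_eq] at hX hY ⊢
    change ⁅H, X⁆ = 0 at hX
    change ⁅H, Y⁆ = 0 at hY
    rw [leibniz_lie, hX, hY, zero_lie, lie_zero, add_zero]

/-! ### Matrix Lie groups -/

/-- The exponential map `𝔤𝔩(N, ℂ) → GL(N, ℂ)`. -/
def expGL {N : ℕ} (X : Mat N) : GLN N where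
  val := NormedSpace.exp X
  inv := NormedSpace.exp (-X)
  val_inv := by
    rw [← Matrix.exp_add_of_commute X (-X) (Commute.neg_right (Commute.refl X)), add_neg_cancel,
      NormedSpace.exp_zero]
  inv_val := by
    rw [← Matrix.exp_add_of_commute (-X) X (Commute.neg_left (Commute.refl X)), neg_add_cancel,
      NormedSpace.exp_zero]

/-- The adjoint action of `GL(N, ℂ)` on matrices, `Ad(a) X = a X a⁻¹`. -/
def Ad {N : ℕ} (a : GLN N) (X : Mat N) : Mat N := a.val * X * (a⁻¹).val

theorem Ad_one {N : ℕ} (X : Mat N) : Ad 1 X = X := by simp [Ad]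

theorem Ad_mul {N : ℕ} (a b : GLN N) (X : Mat N) : Ad (a * b) X = Ad a (Ad b X) := by
  simp only [Ad, Units.val_mul, mul_inv_rev, mul_assoc]

/-- `k` is the Lie algebra of the (closed) subgroup `K` of `GL(N, ℂ)`. -/
def IsLieAlgebraOf {N : ℕ} (K : Subgroup (GLN N)) (k : Submodule ℝ (Mat N)) : Prop :=
  ∀ X : Mat N, X ∈ k ↔ ∀ t : ℝ, expGL (t • X) ∈ K

theorem IsLieAlgebraOf.exp_mem {N : ℕ} {K : Subgroup (GLN N)} {k : Submodule ℝ (Mat N)}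
    (hk : IsLieAlgebraOf K k) {X : Mat N} (hX : X ∈ k) : expGL X ∈ K := by
  simpa using (hk X).1 hX 1

/-- `G` is a connected closed complex subgroup of `GL(N, ℂ)` with (complex) Lie algebra `g`. -/
structure IsConnectedComplexGroup {N : ℕ} (G : Subgroup (GLN N)) (g : LieSubalgebra ℂ (Mat N)) :
    Prop where
  closed : IsClosed (G : Set (GLN N))
  connected : IsConnected (G : Set (GLN N))
  lie : IsLieAlgebraOf G (g.toSubmodule.restrictScalars ℝ)

/-- `U`, with Lie algebra `u`, is a connected compact real form of `G`, whose Lie algebra is `g`: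
`U` is a compact connected subgroup of `G` and `g = u ⊕ i u`. -/
structure IsCompactRealForm {N : ℕ} (G : Subgroup (GLN N)) (g : LieSubalgebra ℂ (Mat N))
    (U : Subgroup (GLN N)) (u : LieSubalgebra ℝ (Mat N)) : Prop where
  le : U ≤ G
  compact : IsCompact (U : Set (GLN N))
  connected : IsConnected (U : Set (GLN N))
  lie : IsLieAlgebraOf U u.toSubmodule
  span : ∀ X : Mat N, X ∈ g ↔ ∃ A ∈ u, ∃ B ∈ u, X = A + Complex.I • B
  independent : ∀ A ∈ u, Complex.I • A ∈ u → A = 0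

/-- The Cartan subalgebra `h` of `g` is the complexification of the subalgebra `t` of `u`. -/
def IsComplexificationOf {N : ℕ} {g : LieSubalgebra ℂ (Mat N)} (h : LieSubalgebra ℂ g)
    {u : LieSubalgebra ℝ (Mat N)} (t : LieSubalgebra ℝ u) : Prop :=
  ∀ X : g, X ∈ h ↔
    ∃ A ∈ t, ∃ B ∈ t, (X : Mat N) = (A : Mat N) + Complex.I • (B : Mat N)

/-- The subgroup of all the `a` with `Ad(a) p = p`. -/
def adStabilizer {N : ℕ} (p : Set (Mat N)) : Subgroup (GLN N) where
  carrier := {a | ∀ X, Ad a X ∈ p ↔ X ∈ p}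
  mul_mem' := by
    intro a b ha hb X
    rw [Ad_mul, ha, hb]
  one_mem' := by
    intro X
    rw [Ad_one]
  inv_mem' := by
    intro a ha X
    rw [← ha, ← Ad_mul, mul_inv_cancel, Ad_one]

/-- The centralizer `Z_K(H) = {a ∈ K : Ad(a) H = H}`, as a subgroup of `K`. -/
def centralizerIn {N : ℕ} (K : Subgroup (GLN N)) (H : Mat N) : Subgroup K where
  carrier := {a | Ad (a : GLN N) H = H}
  mul_mem' := by
    intro a b ha hb
    simp only [Set.mem_ofPred_eq] at ha hb ⊢
    rw [Subgroup.coe_mul, Ad_mul, hb, ha]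
  one_mem' := by simp [Ad_one]
  inv_mem' := by
    intro a ha
    simp only [Set.mem_ofPred_eq] at ha ⊢
    conv_lhs => rw [← ha]
    rw [← Ad_mul, Subgroup.coe_inv, inv_mul_cancel, Ad_one]

/-! ### Parabolic subalgebras and subgroups -/

section Parabolic

variable {N : ℕ} {g : LieSubalgebra ℂ (Mat N)} [LieAlgebra.IsSemisimple ℂ g]
  {h : LieSubalgebra ℂ g} [h.IsCartanSubalgebra]

/-- The set `⟨Θ⟩` of the roots that are integral combinations of elements of `Θ`. -/
def generatedRoots (Θ : Finset h.root) : Set h.root :=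
  {α | (LieAlgebra.IsKilling.rootSystem h).root α ∈
    Submodule.span ℤ ((LieAlgebra.IsKilling.rootSystem h).root '' (Θ : Set h.root))}

/-- The standard parabolic subalgebra `𝔭_Θ`: the sum of the Cartan subalgebra and of the root spaces
of all the roots that are positive or belong to `⟨Θ⟩`. Here `b` is the system of simple roots. -/
def parabolic (b : (LieAlgebra.IsKilling.rootSystem h).Base) (Θ : Finset h.root) :
    Submodule ℂ g :=
  h.toSubmodule ⊔ ⨆ α : {α : h.root // b.IsPos α ∨ α ∈ generatedRoots Θ},
    (LieAlgebra.rootSpace h ((α : h.root) : LieModule.Weight ℂ h g)).toSubmodule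

/-- The parabolic subgroup `P_Θ`, the normalizer of `𝔭_Θ` in `G`. -/
def parabolicSubgroup (G : Subgroup (GLN N)) (b : (LieAlgebra.IsKilling.rootSystem h).Base)
    (Θ : Finset h.root) : Subgroup (GLN N) :=
  G ⊓ adStabilizer ((fun X : g => (X : Mat N)) '' (parabolic b Θ : Set g))

/-- The isotropy group `U_Θ = U ∩ P_Θ`, as a subgroup of `U`. -/
abbrev isotropy (G U : Subgroup (GLN N)) (b : (LieAlgebra.IsKilling.rootSystem h).Base)
    (Θ : Finset h.root) : Subgroup U :=
  (parabolicSubgroup G b Θ).subgroupOf U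

end Parabolic

/-! ### Homogeneous manifolds and cotangent bundles -/

/-- The map `X ↦ a exp(X) L` from the Lie algebra of `K` to `K / L`. -/
def expCoset {N : ℕ} {K : Subgroup (GLN N)} {k : Submodule ℝ (Mat N)} (hk : IsLieAlgebraOf K k)
    (L : Subgroup K) (a : K) (X : k) : K ⧸ L :=
  QuotientGroup.mk (a * ⟨expGL (X : Mat N), hk.exp_mem X.2⟩)

/-- The given atlas on `K / L` (with the quotient topology) is that of the homogeneous manifold
`K / L`: it is a smooth atlas for which the projection `K → K / L` is a smooth submersion. As the
maps `X ↦ a exp(X)` are smooth and restrict to local parametrizations of the Lie group `K` around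
each of its points `a`, this is said by means of them, in linear coordinates `s` on `k`. -/
structure IsHomogeneousManifold {N : ℕ} {K : Subgroup (GLN N)} {k : Submodule ℝ (Mat N)}
    (hk : IsLieAlgebraOf K k) (L : Subgroup K) (E : Type*) [NormedAddCommGroup E] [NormedSpace ℝ E]
    [ChartedSpace E (K ⧸ L)] : Prop where
  isManifold : IsManifold 𝓘(ℝ, E) ∞ (K ⧸ L)
  smooth : ∀ (r : ℕ) (X : Module.Basis (Fin r) ℝ k) (a : K),
    ContMDiff 𝓘(ℝ, EuclideanSpace ℝ (Fin r)) 𝓘(ℝ, E) ∞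
      (fun s : EuclideanSpace ℝ (Fin r) => expCoset hk L a (∑ i, s i • X i))
  submersion : ∀ (r : ℕ) (X : Module.Basis (Fin r) ℝ k) (a : K),
    Function.Surjective (mfderiv 𝓘(ℝ, EuclideanSpace ℝ (Fin r)) 𝓘(ℝ, E)
      (fun s : EuclideanSpace ℝ (Fin r) => expCoset hk L a (∑ i, s i • X i)) 0)

/-- The fibre `T*_x M` of the cotangent bundle of the real manifold `M` modelled on `E`. -/
abbrev CotangentSpace (E : Type*) [NormedAddCommGroup E] [NormedSpace ℝ E] {M : Type*}
    [TopologicalSpace M] [ChartedSpace E M] (x : M) : Type _ :=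
  TangentSpace 𝓘(ℝ, E) x →L[ℝ] Bundle.Trivial M ℝ x

/-- The cotangent bundle `T*M` of the real manifold `M` modelled on `E`. -/
abbrev CotangentBundle (E : Type*) [NormedAddCommGroup E] [NormedSpace ℝ E] (M : Type*)
    [TopologicalSpace M] [ChartedSpace E M] : Type _ :=
  Bundle.TotalSpace (E →L[ℝ] ℝ) (fun x : M => CotangentSpace E x)

/-- The lift to `T*M` of the action of a group on `M`: the element `a` sends the covector `ξ` at `x`
to the covector `ξ ∘ d(a⁻¹)` at `a x`. -/
def cotangentLift {E : Type*} [NormedAddCommGroup E] [NormedSpace ℝ E] {M : Type*}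
    [TopologicalSpace M] [ChartedSpace E M] {A : Type*} [Group A] [MulAction A M]
    (a : A) (ξ : CotangentBundle E M) : CotangentBundle E M :=
  ⟨a • ξ.proj,
    (show E →L[ℝ] ℝ from ξ.snd).comp
      (show E →L[ℝ] E from mfderiv 𝓘(ℝ, E) 𝓘(ℝ, E) (fun y : M => a⁻¹ • y) (a • ξ.proj))⟩

/-- `Φ` realizes the cotangent bundle of `F = U / (U ∩ P)` as `G / Z_G(H)`, that is as the adjoint
orbit of `H` under `G`: it is a diffeomorphism, it is equivariant under `U`, it maps the fibre of
`T*F` over `u (U ∩ P)` to the fibre of `G / Z_G(H) → G / P` over `u P`, and it is an affine map from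
that fibre to the adjoint orbit, with origin at `Ad(u) H`. -/
structure IsCotangentRealization {N : ℕ} {U G : Subgroup (GLN N)} (hUG : U ≤ G)
    (P : Subgroup (GLN N)) (H : Mat N)
    (E E' : Type*) [NormedAddCommGroup E] [NormedSpace ℝ E]
    [NormedAddCommGroup E'] [NormedSpace ℝ E']
    [ChartedSpace E (U ⧸ P.subgroupOf U)] [IsManifold 𝓘(ℝ, E) ∞ (U ⧸ P.subgroupOf U)]
    [ChartedSpace E' (G ⧸ centralizerIn G H)]
    (Φ : CotangentBundle E (U ⧸ P.subgroupOf U) ≃ G ⧸ centralizerIn G H) : Prop where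
  smooth : ContMDiff (𝓘(ℝ, E).prod 𝓘(ℝ, E →L[ℝ] ℝ)) 𝓘(ℝ, E') ∞ Φ
  smooth_symm : ContMDiff 𝓘(ℝ, E') (𝓘(ℝ, E).prod 𝓘(ℝ, E →L[ℝ] ℝ)) ∞ Φ.symm
  equivariant : ∀ (a : U) (ξ : CotangentBundle E (U ⧸ P.subgroupOf U)),
    Φ (cotangentLift a ξ) = Subgroup.inclusion hUG a • Φ ξ
  fibrewise : ∀ a : U,
    ∃ ℓ : CotangentSpace E (QuotientGroup.mk a : U ⧸ P.subgroupOf U) →ₗ[ℝ] Mat N,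
      ∀ (ξ : CotangentSpace E (QuotientGroup.mk a : U ⧸ P.subgroupOf U)) (c : G),
        Φ ⟨QuotientGroup.mk a, ξ⟩ = QuotientGroup.mk c →
          (a : GLN N)⁻¹ * (c : GLN N) ∈ P ∧
            Ad (c : GLN N) H = Ad (a : GLN N) H + ℓ ξ

end

end SymFlag

/-!
The involution `τ` is recovered from a single element `H`, and everything else is read off from the
eigenvalues of `ad H`.

*The characteristic element.* Let `H` be the element of the Cartan subalgebra at which the simple
roots are `0` on `Θ` and `π i` outside `Θ` (`exists_root_eq`). As the compact group `U` preserves a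
Hermitian form (`exists_unitary_conj`), its Lie algebra consists of skew elements for the
corresponding adjoint `hstar`; hence `H ∈ t`, and the trace form is negative definite on `u`. The
differential of `τ` (`exists_differential`) is `1` on the centralizer of `H` in `u` and `-1` on
`[H, u]` (`lie_eq_zero_iff_fixed`, `differential_eq_neg`), so `[[H, X], [H, Y]]` always commutes
with `H`: two root spaces of nonzero degrees whose sum is nonzero have bracket zero. By `sl₂`-theory
the highest degree is then one (`root_value_eq_zero_or`), that is, `ad H` has only the eigenvalues
`0` and `± π i` on `g`, and `τ` is the conjugation by `exp H` (`exists_isSymmetricFlag`). The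
structure `IsSymmetricFlag` records this situation, and the rest of the proof does not use roots.

*The parabolic subgroup.* In the grading `g = n⁻ + z + n⁺` by `ad H` the outer parts are abelian,
and `Ad(exp X)` is quadratic in `X ∈ n⁺` and in `X ∈ n⁻`. An element `p` of `P` moves `H` by an
element of `n⁺` only (`Ad_H_sub_mem`), whence the Levi decomposition `P = N⁺ Z` with `Z = Z_G(H)`
(`exists_eq_exp_mul`); since `u` meets `n⁺` in `0`, `U ∩ P = Z_U(H)` (`mem_P_iff_of_mem_U`). As
`g = u + p` and `U` is compact, `G = U P` (`exists_eq_mul`). The eigenvalues of `Ad(exp H)` are `1`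
on `z` and `-1` on `n⁺ + n⁻`, which gives the symmetric spaces (`isSymmetricSpace`) and the
symmetric Lie algebras. In `G = U N⁺ Z` the conjugation by `exp H` inverts `N⁺`, and this reduces
the statement about the full fixed-point group of `G` to that of `U` (`centralizer_of_fixed`).

*The cotangent bundle.* The charts of `G / P = U / (U ∩ P)` are the `U`-translates of the slice
`Y ↦ exp(Y) P` for `Y ∈ n⁻`, and those of `G / Z` are the `G`-translates of the slice
`(Y, X) ↦ exp(Y) exp(X) Z` for `X ∈ n⁺`. They are smooth because the coordinates solve linear
systems with smooth coefficients (`exists_coord`, `IsSlice`, `isSlice_flag`, `isSlice_orbit`). The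
trace form identifies `n⁺` with the dual of `n⁻`, the tangent space of the flag manifold
(`exists_dual`). The diffeomorphism sends the covector `ξ` at `b P`, with `b ∈ U`, to
`b exp(κ ξ) Z`, where `κ` is that identification (`cotangentMap`). Since `Ad(exp X) H = H - π i X`
for `X ∈ n⁺`, it is affine on the fibres and is bijective by `G = U N⁺ Z`. For `Y ∈ n⁻` there is a
unique `X₀(Y) ∈ n⁺` with `exp(Y) exp(X₀(Y)) Z` in the orbit of `U`, and it is smooth in `Y`
(`exists_radial`). In the charts, the diffeomorphism is `(Y, η) ↦ (Y, X₀(Y) + κ η)`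
(`cotangentMap_eq_param`), which is smooth with a smooth inverse.
-/

section

open Filter Topology

open scoped Matrix.Norms.L2Operator

namespace SymFlag

variable {N : ℕ}

/-! ### The exponential map and the adjoint action -/

theorem contDiff_exp {n : ℕ∞ω} : ContDiff ℝ n (NormedSpace.exp : Mat N → Mat N) :=
  (contDiff_omega_iff_analyticOnNhd.mpr fun x _ =>
    NormedSpace.exp_analytic (𝕂 := ℝ) x).of_le le_top

@[simp] theorem coe_expGL (X : Mat N) : ((expGL X : GLN N) : Mat N) = NormedSpace.exp X := rfl

@[simp] theorem expGL_zero : expGL (0 : Mat N) = 1 := Units.ext (by simp)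

theorem expGL_neg (X : Mat N) : expGL (-X) = (expGL X)⁻¹ := Units.ext rfl

theorem expGL_add {X Y : Mat N} (h : Commute X Y) : expGL (X + Y) = expGL X * expGL Y :=
  Units.ext (Matrix.exp_add_of_commute X Y h)

theorem expGL_nsmul (n : ℕ) (X : Mat N) : expGL (n • X) = expGL X ^ n := by
  induction n with
  | zero => simp
  | succ n ih =>
    rw [succ_nsmul, expGL_add ((Commute.refl X).smul_left n), ih, pow_succ]

theorem expGL_zsmul (n : ℤ) (X : Mat N) : expGL (n • X) = expGL X ^ n := by
  obtain ⟨m, rfl | rfl⟩ := n.eq_nat_or_neg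
  · simpa using expGL_nsmul m X
  · rw [neg_smul, expGL_neg, natCast_zsmul, expGL_nsmul, zpow_neg, zpow_natCast]

theorem expGL_add_smul (s r : ℝ) (X : Mat N) :
    expGL ((s + r) • X) = expGL (s • X) * expGL (r • X) := by
  rw [add_smul, expGL_add (((Commute.refl X).smul_left s).smul_right r)]

theorem continuous_expGL : Continuous (expGL : Mat N → GLN N) := by
  rw [Units.continuous_iff]
  refine ⟨(contDiff_exp (n := 0)).continuous, ?_⟩
  exact (contDiff_exp (n := 0)).continuous.comp continuous_neg

theorem expGL_Ad (a : GLN N) (X : Mat N) : expGL (Ad a X) = a * expGL X * a⁻¹ :=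
  Units.ext (Matrix.exp_units_conj a X)

theorem Ad_add (a : GLN N) (X Y : Mat N) : Ad a (X + Y) = Ad a X + Ad a Y := by
  simp only [Ad, mul_add, add_mul]

theorem Ad_sub (a : GLN N) (X Y : Mat N) : Ad a (X - Y) = Ad a X - Ad a Y := by
  simp only [Ad, mul_sub, sub_mul]

theorem Ad_smul (a : GLN N) (z : ℂ) (X : Mat N) : Ad a (z • X) = z • Ad a X := by
  simp only [Ad, mul_smul_comm, smul_mul_assoc]

theorem Ad_smul_real (a : GLN N) (s : ℝ) (X : Mat N) : Ad a (s • X) = s • Ad a X := by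
  simp only [Ad, mul_smul_comm, smul_mul_assoc]

@[simp] theorem Ad_zero (a : GLN N) : Ad a (0 : Mat N) = 0 := by simp [Ad]

theorem Ad_mul_Ad (a : GLN N) (X Y : Mat N) : Ad a X * Ad a Y = Ad a (X * Y) := by
  have : (a⁻¹).val * a.val = 1 := by rw [← Units.val_mul, inv_mul_cancel, Units.val_one]
  calc a.val * X * (a⁻¹).val * (a.val * Y * (a⁻¹).val)
      = a.val * X * ((a⁻¹).val * a.val) * Y * (a⁻¹).val := by noncomm_ring
    _ = _ := by rw [this]; simp only [Ad, mul_one, mul_assoc]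

theorem Ad_lie (a : GLN N) (X Y : Mat N) : Ad a ⁅X, Y⁆ = ⁅Ad a X, Ad a Y⁆ := by
  rw [Ring.lie_def, Ring.lie_def, Ad_mul_Ad, Ad_mul_Ad, Ad_sub]

theorem Ad_inv_Ad (a : GLN N) (X : Mat N) : Ad a⁻¹ (Ad a X) = X := by
  rw [← Ad_mul, inv_mul_cancel, Ad_one]

theorem Ad_Ad_inv (a : GLN N) (X : Mat N) : Ad a (Ad a⁻¹ X) = X := by
  rw [← Ad_mul, mul_inv_cancel, Ad_one]

theorem Ad_injective (a : GLN N) : Function.Injective (Ad a) :=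
  Function.LeftInverse.injective (Ad_inv_Ad a)

theorem trace_Ad (a : GLN N) (X : Mat N) : (Ad a X).trace = X.trace := by
  rw [Ad, Matrix.trace_mul_comm, ← mul_assoc, ← Units.val_mul]
  simp

theorem trace_Ad_mul_Ad (a : GLN N) (X Y : Mat N) :
    (Ad a X * Ad a Y).trace = (X * Y).trace := by
  rw [Ad_mul_Ad, trace_Ad]

theorem continuous_Ad : Continuous fun p : GLN N × Mat N => Ad p.1 p.2 := by
  unfold Ad
  exact ((Units.continuous_val.comp continuous_fst).mul continuous_snd).mul
    (Units.continuous_val.comp continuous_fst.inv)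

theorem hasDerivAt_Ad_exp (X Y : Mat N) (s : ℝ) :
    HasDerivAt (fun s : ℝ => Ad (expGL (s • X)) Y) (Ad (expGL (s • X)) ⁅X, Y⁆) s := by
  have h1 := hasDerivAt_exp_smul_const X s
  have h2 := hasDerivAt_exp_smul_const' (-X) s
  have h := (h1.mul_const Y).mul h2
  have e : ∀ r : ℝ, NormedSpace.exp (r • -X) = ((expGL (r • X))⁻¹).val := fun r => by
    rw [smul_neg]; rfl
  simp only [e] at h
  refine h.congr_deriv ?_
  simp only [Ad, Ring.lie_def, coe_expGL]
  noncomm_ring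

/-- A solution of the differential equation `f' = -[X, f]` is `s ↦ Ad(exp(-s X)) (f 0)`. -/
theorem Ad_expGL_eq_of_hasDerivAt {X : Mat N} {f : ℝ → Mat N} {f' : ℝ → Mat N}
    (hf : ∀ s, HasDerivAt f (f' s) s) (h : ∀ s, f' s = - ⁅X, f s⁆) :
    Ad (expGL X) (f 1) = f 0 := by
  have key : ∀ s, HasDerivAt (fun s : ℝ => Ad (expGL (s • X)) (f s)) 0 s := by
    intro s
    have h1 := hasDerivAt_exp_smul_const X s
    have h2 := hasDerivAt_exp_smul_const' (-X) s
    have h3 := (h1.mul (hf s)).mul h2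
    have e : ∀ r : ℝ, NormedSpace.exp (r • -X) = ((expGL (r • X))⁻¹).val := fun r => by
      rw [smul_neg]; rfl
    simp only [e] at h3
    refine h3.congr_deriv ?_
    rw [h s, Ring.lie_def]
    simp only [Pi.mul_apply]
    noncomm_ring
  have := is_const_of_deriv_eq_zero (fun s => (key s).differentiableAt)
    (fun s => (key s).deriv) 1 0
  simpa [Ad_one] using this

theorem Ad_expGL_of_lie_lie_lie {X Y : Mat N} (h : ⁅X, ⁅X, ⁅X, Y⁆⁆⁆ = 0) :
    Ad (expGL X) Y = Y + ⁅X, Y⁆ + (2⁻¹ : ℝ) • ⁅X, ⁅X, Y⁆⁆ := by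
  have key : Ad (expGL (-X)) (Y + (1 : ℝ) • ⁅X, Y⁆ + ((1 : ℝ) ^ 2 / 2) • ⁅X, ⁅X, Y⁆⁆) =
      Y + (0 : ℝ) • ⁅X, Y⁆ + ((0 : ℝ) ^ 2 / 2) • ⁅X, ⁅X, Y⁆⁆ := by
    refine Ad_expGL_eq_of_hasDerivAt
      (f := fun s : ℝ => Y + s • ⁅X, Y⁆ + (s ^ 2 / 2) • ⁅X, ⁅X, Y⁆⁆)
      (X := -X) (f' := fun s => ⁅X, Y⁆ + s • ⁅X, ⁅X, Y⁆⁆) (fun s => ?_) (fun s => ?_)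
    · have h1 := ((hasDerivAt_id s).smul_const ⁅X, Y⁆).const_add Y
      have h2 := (((hasDerivAt_pow 2 s).div_const 2).smul_const ⁅X, ⁅X, Y⁆⁆)
      refine (h1.add h2).congr_deriv ?_
      simp
    · rw [neg_lie, neg_neg, lie_add, lie_add, lie_smul, lie_smul, h, smul_zero, add_zero]
  rw [expGL_neg] at key
  have := congrArg (Ad (expGL X)) key
  rw [Ad_Ad_inv] at this
  simp only [one_smul, zero_smul, one_pow, one_div, add_zero, ne_eq, OfNat.ofNat_ne_zero,
    not_false_eq_true, zero_pow, zero_div] at this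
  exact this.symm

theorem Ad_expGL_of_lie_eq_smul {X Y : Mat N} {z : ℂ} (h : ⁅X, Y⁆ = z • Y) :
    Ad (expGL X) Y = Complex.exp z • Y := by
  have key : Ad (expGL X) (Complex.exp (-(((1 : ℝ) : ℂ) * z)) • Y) =
      Complex.exp (-(((0 : ℝ) : ℂ) * z)) • Y := by
    refine Ad_expGL_eq_of_hasDerivAt
      (f := fun s : ℝ => Complex.exp (-((s : ℂ) * z)) • Y)
      (f' := fun s : ℝ => -(Complex.exp (-((s : ℂ) * z)) • z • Y)) (fun s => ?_) (fun s => ?_)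
    · have h1 : HasDerivAt (fun s : ℝ => -((s : ℂ) * z)) (-z) s := by
        have h0 := ((Complex.ofRealCLM.hasDerivAt (x := s)).mul_const z).neg
        exact h0.congr_deriv (by simp)
      refine (h1.cexp.smul_const Y).congr_deriv ?_
      rw [mul_neg, neg_smul, mul_smul]
    · rw [lie_smul, h]
  rw [Ad_smul] at key
  simp only [Complex.ofReal_one, one_mul, Complex.ofReal_zero, zero_mul, neg_zero,
    Complex.exp_zero, one_smul] at key
  rw [← key, smul_smul, ← Complex.exp_add, add_neg_cancel, Complex.exp_zero, one_smul, key]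

theorem Ad_expGL_of_lie_eq_zero {X Y : Mat N} (h : ⁅X, Y⁆ = 0) : Ad (expGL X) Y = Y := by
  simpa using Ad_expGL_of_lie_eq_smul (z := 0) (by simpa using h)

theorem lie_eq_zero_of_Ad_expGL {X Y : Mat N} (h : ∀ s : ℝ, Ad (expGL (s • X)) Y = Y) :
    ⁅X, Y⁆ = 0 := by
  have h1 := hasDerivAt_Ad_exp X Y 0
  have h2 : HasDerivAt (fun s : ℝ => Ad (expGL (s • X)) Y) 0 0 := by
    simp only [h]; exact hasDerivAt_const _ _
  simpa [Ad_one] using h1.unique h2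

/-! ### The closed subgroup theorem -/

theorem eventually_injOn_exp :
    ∃ V ∈ 𝓝 (0 : Mat N), Set.InjOn (expGL : Mat N → GLN N) V := by
  have h : HasStrictFDerivAt (NormedSpace.exp : Mat N → Mat N)
      ((ContinuousLinearEquiv.refl ℝ (Mat N) : Mat N ≃L[ℝ] Mat N) : Mat N →L[ℝ] Mat N) 0 :=
    hasStrictFDerivAt_exp_zero (𝕂 := ℝ) (𝔸 := Mat N)
  refine ⟨_, (h.toOpenPartialHomeomorph _).open_source.mem_nhds
    h.mem_toOpenPartialHomeomorph_source, fun X hX Y hY e => ?_⟩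
  exact (h.toOpenPartialHomeomorph _).injOn hX hY (congrArg Units.val e)

/-- A complement `q` of the Lie algebra of a closed subgroup contains no small nonzero elements
whose exponentials are in the subgroup: a limit of the directions of such elements would be in the
Lie algebra. -/
theorem eventually_eq_zero_of_exp_mem {K : Subgroup (GLN N)} (hc : IsClosed (K : Set (GLN N)))
    {k : Submodule ℝ (Mat N)} (hk : IsLieAlgebraOf K k) {q : Submodule ℝ (Mat N)}
    (hq : Disjoint k q) : ∀ᶠ Q in 𝓝 (0 : Mat N), Q ∈ q → expGL Q ∈ K → Q = 0 := by
  by_contra hcon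
  rw [Filter.not_eventually] at hcon
  obtain ⟨Q, hQ0, hQ⟩ := Filter.exists_seq_forall_of_frequently hcon
  have hQq : ∀ n, Q n ∈ q := fun n => by have := hQ n; push Not at this; exact this.1
  have hQK : ∀ n, expGL (Q n) ∈ K := fun n => by have := hQ n; push Not at this; exact this.2.1
  have hQn : ∀ n, Q n ≠ 0 := fun n => by have := hQ n; push Not at this; exact this.2.2
  have : ProperSpace (Mat N) := FiniteDimensional.proper ℝ (Mat N)
  obtain ⟨Y, hY, φ, hφ, hlim⟩ := (isCompact_sphere (0 : Mat N) 1).tendsto_subseq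
    (x := fun n => (‖Q n‖⁻¹ : ℝ) • Q n) (fun n => by
      simp [norm_smul, inv_mul_cancel₀ (norm_ne_zero_iff.2 (hQn n))])
  have hYq : Y ∈ q := by
    have hcl : IsClosed (q : Set (Mat N)) := q.closed_of_finiteDimensional
    exact hcl.mem_of_tendsto hlim (Filter.Eventually.of_forall fun n => q.smul_mem _ (hQq _))
  have hn0 : Tendsto (fun n => ‖Q (φ n)‖) atTop (𝓝 0) := by
    simpa using (hQ0.comp hφ.tendsto_atTop).norm
  have hYk : Y ∈ k := by
    rw [hk]
    intro t
    -- `⌊t / ‖Q‖⌋ • Q` converges to `t • Y`, and its exponential is a power of `exp Q`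
    have hfl : Tendsto (fun n => (⌊t / ‖Q (φ n)‖⌋ : ℝ) * ‖Q (φ n)‖) atTop (𝓝 t) := by
      rw [tendsto_iff_norm_sub_tendsto_zero]
      refine squeeze_zero (fun _ => norm_nonneg _) (fun n => ?_) hn0
      have hpos : 0 < ‖Q (φ n)‖ := norm_pos_iff.2 (hQn _)
      have h1 := Int.floor_le (t / ‖Q (φ n)‖)
      have h2 := Int.lt_floor_add_one (t / ‖Q (φ n)‖)
      rw [le_div_iff₀ hpos] at h1
      rw [div_lt_iff₀ hpos] at h2
      rw [Real.norm_eq_abs, abs_le]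
      constructor <;> linarith
    have hlim2 : Tendsto (fun n => expGL ((⌊t / ‖Q (φ n)‖⌋ : ℤ) • Q (φ n))) atTop
        (𝓝 (expGL (t • Y))) := by
      refine (continuous_expGL.tendsto _).comp ?_
      refine (hfl.smul hlim).congr fun n => ?_
      have : ‖Q (φ n)‖ ≠ 0 := norm_ne_zero_iff.2 (hQn _)
      simp only [Function.comp_apply]
      rw [smul_smul, mul_assoc, mul_inv_cancel₀ this, mul_one, Int.cast_smul_eq_zsmul]
    exact hc.mem_of_tendsto hlim2 (Filter.Eventually.of_forall fun n => by
      rw [expGL_zsmul]; exact K.zpow_mem (hQK _) _)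
  have hY0 : Y = 0 := by
    have := hq.le_bot ⟨hYk, hYq⟩
    simpa using this
  rw [hY0] at hY
  simp at hY

/-- If `a + b` exhausts the Lie algebra of a closed subgroup `K`, then every element of `K` near `1`
is a product `exp X exp Y` with small `X ∈ a` and `Y ∈ b`. -/
theorem eventually_eq_exp_mul_exp {K : Subgroup (GLN N)} (hc : IsClosed (K : Set (GLN N)))
    {k : Submodule ℝ (Mat N)} (hk : IsLieAlgebraOf K k) {a b : Submodule ℝ (Mat N)}
    (ha : a ≤ k) (hb : b ≤ k) (hab : k ≤ a ⊔ b) {V : Set (Mat N)} (hV : V ∈ 𝓝 0) :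
    ∀ᶠ x in 𝓝 (1 : GLN N), x ∈ K →
      ∃ X ∈ a, ∃ Y ∈ b, X ∈ V ∧ Y ∈ V ∧ x = expGL X * expGL Y := by
  obtain ⟨q, hq⟩ := Submodule.exists_isCompl k
  let f : a × b × q → Mat N := fun p =>
    NormedSpace.exp (p.1 : Mat N) * NormedSpace.exp (p.2.1 : Mat N) *
      NormedSpace.exp (p.2.2 : Mat N)
  let f' : a × b × q →L[ℝ] Mat N :=
    (a.subtypeL.comp (ContinuousLinearMap.fst ℝ _ _) +
      b.subtypeL.comp ((ContinuousLinearMap.fst ℝ _ _).comp (ContinuousLinearMap.snd ℝ _ _))) +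
      q.subtypeL.comp ((ContinuousLinearMap.snd ℝ _ _).comp (ContinuousLinearMap.snd ℝ _ _))
  have hexp : HasStrictFDerivAt (NormedSpace.exp : Mat N → Mat N) (1 : Mat N →L[ℝ] Mat N) 0 :=
    hasStrictFDerivAt_exp_zero
  have hl : ∀ l : a × b × q →L[ℝ] Mat N,
      HasStrictFDerivAt (fun p => NormedSpace.exp (l p)) l 0 := fun l => by
    have h1 : HasStrictFDerivAt l l 0 := l.hasStrictFDerivAt
    have h2 : HasStrictFDerivAt (NormedSpace.exp : Mat N → Mat N) (1 : Mat N →L[ℝ] Mat N) (l 0) := by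
      rw [map_zero]; exact hexp
    exact h2.comp 0 h1
  have hf : HasStrictFDerivAt f f' 0 := by
    have h1 := hl (a.subtypeL.comp (ContinuousLinearMap.fst ℝ _ _))
    have h2 := hl (b.subtypeL.comp
      ((ContinuousLinearMap.fst ℝ _ _).comp (ContinuousLinearMap.snd ℝ _ _)))
    have h3 := hl (q.subtypeL.comp
      ((ContinuousLinearMap.snd ℝ _ _).comp (ContinuousLinearMap.snd ℝ _ _)))
    refine ((h1.mul' h2).mul' h3).congr_fderiv ?_
    refine ContinuousLinearMap.ext fun p => ?_
    simp [f', add_comm]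
  have hsurj : f'.range = ⊤ := by
    rw [LinearMap.range_eq_top]
    intro X
    have hX : X ∈ k ⊔ q := by rw [hq.sup_eq_top]; trivial
    obtain ⟨Z, hZ, Q, hQ, rfl⟩ := Submodule.mem_sup.1 hX
    obtain ⟨A, hA, B, hB, rfl⟩ := Submodule.mem_sup.1 (hab hZ)
    exact ⟨(⟨A, hA⟩, ⟨B, hB⟩, ⟨Q, hQ⟩), by simp [f']⟩
  have hbq : CompleteSpace (b × q) := CompleteSpace.prod
  have habq : CompleteSpace (a × b × q) := CompleteSpace.prod
  have hmap := hf.map_nhds_eq_of_surj hsurj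
  have hf0 : f 0 = 1 := by simp [f]
  rw [hf0] at hmap
  have hev : ∀ᶠ p in 𝓝 (0 : a × b × q), (p.1 : Mat N) ∈ V ∧ (p.2.1 : Mat N) ∈ V ∧
      ((p.2.2 : Mat N) ∈ q → expGL (p.2.2 : Mat N) ∈ K → (p.2.2 : Mat N) = 0) := by
    have t1 : Tendsto (fun p : a × b × q => (p.1 : Mat N)) (𝓝 0) (𝓝 0) :=
      (by fun_prop : Continuous fun p : a × b × q => (p.1 : Mat N)).tendsto' _ _ (by simp)
    have t2 : Tendsto (fun p : a × b × q => (p.2.1 : Mat N)) (𝓝 0) (𝓝 0) :=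
      (by fun_prop : Continuous fun p : a × b × q => (p.2.1 : Mat N)).tendsto' _ _ (by simp)
    have t3 : Tendsto (fun p : a × b × q => (p.2.2 : Mat N)) (𝓝 0) (𝓝 0) :=
      (by fun_prop : Continuous fun p : a × b × q => (p.2.2 : Mat N)).tendsto' _ _ (by simp)
    filter_upwards [t1.eventually hV, t2.eventually hV,
      t3.eventually (eventually_eq_zero_of_exp_mem hc hk hq.disjoint)] with p h1 h2 h3
    exact ⟨h1, h2, h3⟩
  have him : ∀ᶠ x in 𝓝 (1 : Mat N), ∃ p : a × b × q, ((p.1 : Mat N) ∈ V ∧ (p.2.1 : Mat N) ∈ V ∧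
      ((p.2.2 : Mat N) ∈ q → expGL (p.2.2 : Mat N) ∈ K → (p.2.2 : Mat N) = 0)) ∧ f p = x := by
    rw [← hmap]
    exact Filter.image_mem_map hev
  have hval : Tendsto (fun x : GLN N => (x : Mat N)) (𝓝 1) (𝓝 1) :=
    Units.continuous_val.tendsto' _ _ Units.val_one
  filter_upwards [hval.eventually him] with x hx hxK
  obtain ⟨p, ⟨h1, h2, h3⟩, hp⟩ := hx
  have hx' : x = expGL (p.1 : Mat N) * expGL (p.2.1 : Mat N) * expGL (p.2.2 : Mat N) :=
    Units.ext hp.symm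
  have hKa := hk.exp_mem (ha p.1.2)
  have hKb := hk.exp_mem (hb p.2.1.2)
  have hKq : expGL (p.2.2 : Mat N) ∈ K := by
    rw [hx'] at hxK
    exact (K.mul_mem_cancel_left (K.mul_mem hKa hKb)).1 hxK
  refine ⟨p.1, p.1.2, p.2.1, p.2.1.2, h1, h2, ?_⟩
  rw [hx', h3 p.2.2.2 hKq, expGL_zero, mul_one]

theorem eventually_eq_exp {K : Subgroup (GLN N)} (hc : IsClosed (K : Set (GLN N)))
    {k : Submodule ℝ (Mat N)} (hk : IsLieAlgebraOf K k) {V : Set (Mat N)} (hV : V ∈ 𝓝 0) :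
    ∀ᶠ x in 𝓝 (1 : GLN N), x ∈ K → ∃ X ∈ k, X ∈ V ∧ x = expGL X := by
  filter_upwards [eventually_eq_exp_mul_exp hc hk le_rfl bot_le (by simp) hV] with x hx hxK
  obtain ⟨X, hX, Y, hY, hXV, -, rfl⟩ := hx hxK
  rw [Submodule.mem_bot] at hY
  exact ⟨X, hX, hXV, by simp [hY]⟩

/-- The product of two subgroups whose Lie algebras span that of `K` is open in `K`. -/
theorem eventually_mem_mul {K A B : Subgroup (GLN N)} (hc : IsClosed (K : Set (GLN N)))
    {k : Submodule ℝ (Mat N)} (hk : IsLieAlgebraOf K k) {a b : Submodule ℝ (Mat N)}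
    (ha : a ≤ k) (hb : b ≤ k) (hab : k ≤ a ⊔ b) (hA : A ≤ K) (hB : B ≤ K)
    (haA : ∀ X ∈ a, expGL X ∈ A) (hbB : ∀ X ∈ b, expGL X ∈ B) {x : GLN N}
    (hx : ∃ α ∈ A, ∃ β ∈ B, x = α * β) :
    ∀ᶠ y in 𝓝 x, y ∈ K → ∃ α ∈ A, ∃ β ∈ B, y = α * β := by
  obtain ⟨α, hα, β, hβ, rfl⟩ := hx
  have ht : Tendsto (fun y => α⁻¹ * y * β⁻¹) (𝓝 (α * β)) (𝓝 1) :=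
    (by fun_prop : Continuous fun y => α⁻¹ * y * β⁻¹).tendsto' _ _ (by group)
  filter_upwards [ht.eventually
    (eventually_eq_exp_mul_exp hc hk ha hb hab Filter.univ_mem)] with y hy hyK
  obtain ⟨X, hX, Y, hY, -, -, h⟩ :=
    hy (K.mul_mem (K.mul_mem (K.inv_mem (hA hα)) hyK) (K.inv_mem (hB hβ)))
  refine ⟨α * expGL X, A.mul_mem hα (haA X hX), expGL Y * β, B.mul_mem (hbB Y hY) hβ, ?_⟩
  calc y = α * (α⁻¹ * y * β⁻¹) * β := by group
    _ = _ := by rw [h]; group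

/-- A connected closed subgroup is generated by the exponentials of its Lie algebra. -/
theorem le_of_exp_mem {K M : Subgroup (GLN N)} (hc : IsClosed (K : Set (GLN N)))
    (hconn : IsConnected (K : Set (GLN N)))
    {k : Submodule ℝ (Mat N)} (hk : IsLieAlgebraOf K k) (hM : ∀ X ∈ k, expGL X ∈ M) : K ≤ M := by
  have : ConnectedSpace K := isConnected_iff_connectedSpace.1 hconn
  have hopen : IsOpen ((M.subgroupOf K : Subgroup K) : Set K) := by
    refine Subgroup.isOpen_of_mem_nhds _ (g := 1) ?_
    have h := eventually_eq_exp hc hk Filter.univ_mem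
    have ht : Tendsto (fun x : K => (x : GLN N)) (𝓝 1) (𝓝 1) :=
      continuous_subtype_val.tendsto' _ _ (by simp)
    filter_upwards [ht.eventually h] with x hx
    obtain ⟨X, hX, -, e⟩ := hx x.2
    change (x : GLN N) ∈ M
    rw [e]; exact hM X hX
  have huniv := IsClopen.eq_univ (s := ((M.subgroupOf K : Subgroup K) : Set K))
    ⟨Subgroup.isClosed_of_isOpen _ hopen, hopen⟩ ⟨1, Subgroup.one_mem _⟩
  intro x hx
  have : (⟨x, hx⟩ : K) ∈ ((M.subgroupOf K : Subgroup K) : Set K) := by rw [huniv]; trivial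
  exact this

end SymFlag

namespace SymFlag

variable {N : ℕ}

/-! ### One-parameter subgroups and the differential of a continuous homomorphism -/

theorem expGL_smul_injective {X Y : Mat N} (h : ∀ s : ℝ, expGL (s • X) = expGL (s • Y)) :
    X = Y := by
  have h1 := hasDerivAt_exp_smul_const X (0 : ℝ)
  have h2 := hasDerivAt_exp_smul_const Y (0 : ℝ)
  have e : ∀ s : ℝ, NormedSpace.exp (s • X) = NormedSpace.exp (s • Y) := fun s =>
    congrArg Units.val (h s)
  simp only [e] at h1
  simpa using h1.unique h2

/-- Continuous one-parameter groups of matrices are smooth, since they equal a difference quotient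
of their primitive up to a constant factor, and so they are given by the exponential map. -/
theorem exists_eq_expGL_of_continuous {φ : ℝ → GLN N} (hφ : Continuous φ) (h0 : φ 0 = 1)
    (hadd : ∀ s t, φ (s + t) = φ s * φ t) : ∃ X : Mat N, ∀ t, φ t = expGL (t • X) := by
  let f : ℝ → Mat N := fun t => φ t
  have hf : Continuous f := Units.continuous_val.comp hφ
  have hf0 : f 0 = 1 := by simp [f, h0]
  have hfadd : ∀ s t, f (s + t) = f s * f t := fun s t => by simp [f, hadd]
  let J : ℝ → Mat N := fun t => ∫ s in (0 : ℝ)..t, f s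
  have hJ : ∀ t, HasDerivAt J (f t) t := fun t => hf.integral_hasStrictDerivAt 0 t |>.hasDerivAt
  -- `J a` is invertible for small `a`, because `J' 0 = 1`
  obtain ⟨a, C, hC⟩ : ∃ a : ℝ, ∃ C : GLN N, (C : Mat N) = J a := by
    have h1 := (hJ 0).tendsto_slope_zero
    have hJ0 : J 0 = 0 := by simp [J]
    simp only [zero_add, hJ0, sub_zero, hf0] at h1
    have hev : ∀ᶠ x in 𝓝 (1 : Mat N), IsUnit x := Units.nhds (1 : GLN N)
    obtain ⟨a, ha, ha0⟩ := ((h1.eventually hev).and self_mem_nhdsWithin).exists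
    have ha0 : a ≠ 0 := ha0
    obtain ⟨v, hv⟩ := ha
    refine ⟨a, Units.mk0 a ha0 • v, ?_⟩
    rw [Units.val_smul, hv, Units.smul_def, Units.val_mk0, smul_smul, mul_inv_cancel₀ ha0, one_smul]
  have hfJ : ∀ t, f t = (J (t + a) - J t) * (C⁻¹).val := by
    intro t
    have h1 : J (t + a) - J t = f t * J a := by
      simp only [J]
      rw [intervalIntegral.integral_interval_sub_left (hf.intervalIntegrable _ _)
        (hf.intervalIntegrable _ _)]
      have h2 := (ContinuousLinearMap.mul ℝ (Mat N) (f t)).intervalIntegral_comp_comm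
        (hf.intervalIntegrable (μ := MeasureTheory.volume) 0 a)
      simp only [ContinuousLinearMap.mul_apply'] at h2
      rw [← h2]
      have := intervalIntegral.integral_comp_add_left (a := 0) (b := a) f t
      rw [add_zero] at this
      rw [← this]
      simp only [hfadd]
    rw [h1, ← hC, mul_assoc, ← Units.val_mul, mul_inv_cancel, Units.val_one, mul_one]
  let X : Mat N := (f a - 1) * (C⁻¹).val
  have hder : ∀ t, HasDerivAt f (f t * X) t := by
    intro t
    have h1 : HasDerivAt (fun t => (J (t + a) - J t) * (C⁻¹).val)
        ((f (t + a) - f t) * (C⁻¹).val) t :=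
      (((hJ (t + a)).comp_add_const t a).sub (hJ t)).mul_const _
    rw [← funext hfJ] at h1
    refine h1.congr_deriv ?_
    simp only [X, hfadd, ← mul_assoc, mul_sub, mul_one]
  refine ⟨X, fun t => ?_⟩
  have key : ∀ s, HasDerivAt (fun s : ℝ => f s * NormedSpace.exp (s • -X)) 0 s := by
    intro s
    refine ((hder s).mul (hasDerivAt_exp_smul_const' (-X) s)).congr_deriv ?_
    noncomm_ring
  have hconst := is_const_of_deriv_eq_zero (fun s => (key s).differentiableAt)
    (fun s => (key s).deriv) t 0
  simp only [hf0, zero_smul, NormedSpace.exp_zero, mul_one] at hconst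
  have : φ t * (expGL (t • X))⁻¹ = 1 := Units.ext (by
    rw [Units.val_mul, Units.val_one, ← hconst, smul_neg]; rfl)
  exact mul_inv_eq_one.1 this

/-- The Lie product formula. -/
theorem tendsto_expGL_mul_expGL_pow (X Y : Mat N) :
    Tendsto (fun n : ℕ => (expGL ((n : ℝ)⁻¹ • X) * expGL ((n : ℝ)⁻¹ • Y)) ^ n) atTop
      (𝓝 (expGL (X + Y))) := by
  have hexp : HasStrictFDerivAt (NormedSpace.exp : Mat N → Mat N)
      ((ContinuousLinearEquiv.refl ℝ (Mat N) : Mat N ≃L[ℝ] Mat N) : Mat N →L[ℝ] Mat N) 0 :=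
    hasStrictFDerivAt_exp_zero (𝕂 := ℝ) (𝔸 := Mat N)
  let lg := hexp.localInverse _ _ _
  have hlg : HasFDerivAt lg (ContinuousLinearMap.id ℝ (Mat N)) 1 := by
    have := hexp.to_localInverse.hasFDerivAt
    rw [NormedSpace.exp_zero] at this
    exact this
  have hlg1 : lg 1 = 0 := by
    have := hexp.localInverse_apply_image
    rwa [NormedSpace.exp_zero] at this
  have hinv : ∀ᶠ y in 𝓝 (1 : Mat N), NormedSpace.exp (lg y) = y := by
    have := hexp.eventually_right_inverse
    rwa [NormedSpace.exp_zero] at this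
  let γ : ℝ → Mat N := fun s => NormedSpace.exp (s • X) * NormedSpace.exp (s • Y)
  have hγ : HasDerivAt γ (X + Y) 0 := by
    refine ((hasDerivAt_exp_smul_const X (0 : ℝ)).mul
      (hasDerivAt_exp_smul_const Y (0 : ℝ))).congr_deriv ?_
    simp
  have hγ0 : γ 0 = 1 := by simp [γ]
  have hl : HasDerivAt (lg ∘ γ) (X + Y) 0 := by
    rw [← hγ0] at hlg
    exact hlg.comp_hasDerivAt 0 hγ
  have hsl := hl.tendsto_slope_zero
  simp only [zero_add, Function.comp_apply, hγ0, hlg1, sub_zero] at hsl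
  have hn : Tendsto (fun n : ℕ => (n : ℝ)⁻¹) atTop (𝓝[≠] 0) := by
    refine tendsto_nhdsWithin_iff.2 ⟨tendsto_inv_atTop_nhds_zero_nat, ?_⟩
    filter_upwards [eventually_ne_atTop 0] with n hn
    exact inv_ne_zero (Nat.cast_ne_zero.2 hn)
  have hlim := (continuous_expGL.tendsto _).comp (hsl.comp hn)
  refine hlim.congr' ?_
  have hγt : Tendsto γ (𝓝[≠] 0) (𝓝 1) := by
    rw [← hγ0]
    exact hγ.continuousAt.tendsto.mono_left nhdsWithin_le_nhds
  filter_upwards [(hγt.comp hn).eventually hinv] with n h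
  simp only [Function.comp_apply, inv_inv, Nat.cast_smul_eq_nsmul] at h ⊢
  rw [expGL_nsmul]
  congr 1
  exact Units.ext h

theorem IsLieAlgebraOf.Ad_mem {K : Subgroup (GLN N)} {k : Submodule ℝ (Mat N)}
    (hk : IsLieAlgebraOf K k) {a : GLN N} (ha : a ∈ K) {X : Mat N} (hX : X ∈ k) : Ad a X ∈ k := by
  rw [hk]
  intro t
  rw [← Ad_smul_real, expGL_Ad]
  exact K.mul_mem (K.mul_mem ha ((hk X).1 hX t)) (K.inv_mem ha)

/-- The differential of a continuous endomorphism `τ` of a matrix Lie group. It is a linear map on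
the Lie algebra, here extended to all matrices in an arbitrary way. -/
theorem exists_differential {K : Subgroup (GLN N)} {k : Submodule ℝ (Mat N)}
    (hk : IsLieAlgebraOf K k) (τ : K →* K) (hτ : Continuous τ) :
    ∃ T : Mat N →ₗ[ℝ] Mat N, (∀ X ∈ k, T X ∈ k) ∧
      (∀ X (hX : X ∈ k), (τ ⟨expGL X, hk.exp_mem hX⟩ : GLN N) = expGL (T X)) ∧
      (∀ X ∈ k, ∀ Y ∈ k, T ⁅X, Y⁆ = ⁅T X, T Y⁆) := by
  have hex : ∀ X : k, ∃ Y : Mat N, ∀ t : ℝ,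
      (τ ⟨expGL (t • (X : Mat N)), (hk X).1 X.2 t⟩ : GLN N) = expGL (t • Y) := by
    intro X
    refine exists_eq_expGL_of_continuous
      (φ := fun t => (τ ⟨expGL (t • (X : Mat N)), (hk X).1 X.2 t⟩ : GLN N)) ?_ ?_ ?_
    · refine continuous_subtype_val.comp (hτ.comp ?_)
      exact (continuous_expGL.comp (by fun_prop)).subtype_mk _
    · have : (⟨expGL ((0 : ℝ) • (X : Mat N)), (hk X).1 X.2 0⟩ : K) = 1 := by
        ext1; simp
      rw [this]; simp
    · intro s t
      rw [← Subgroup.coe_mul, ← map_mul]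
      congr 2
      ext1
      exact expGL_add_smul s t _
  choose T₀ hT₀ using hex
  have hsmul : ∀ (c : ℝ) (X : k), T₀ (c • X) = c • T₀ X := by
    intro c X
    refine expGL_smul_injective fun s => ?_
    rw [← hT₀, smul_smul, ← hT₀]
    congr 2
    ext1
    simp [smul_smul]
  have hadd : ∀ X Y : k, T₀ (X + Y) = T₀ X + T₀ Y := by
    intro X Y
    refine expGL_smul_injective fun s => ?_
    rw [smul_add, ← hT₀]
    refine tendsto_nhds_unique ?_ (tendsto_expGL_mul_expGL_pow _ _)
    have h1 := tendsto_expGL_mul_expGL_pow (s • (X : Mat N)) (s • (Y : Mat N))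
    have hmem : ∀ n : ℕ, (expGL ((n : ℝ)⁻¹ • s • (X : Mat N)) *
        expGL ((n : ℝ)⁻¹ • s • (Y : Mat N))) ^ n ∈ K := fun n =>
      K.pow_mem (K.mul_mem (hk.exp_mem (k.smul_mem _ (k.smul_mem _ X.2)))
        (hk.exp_mem (k.smul_mem _ (k.smul_mem _ Y.2)))) n
    have h2 : Tendsto (fun n : ℕ => (⟨_, hmem n⟩ : K)) atTop
        (𝓝 ⟨expGL (s • ((X + Y : k) : Mat N)), (hk _).1 (X + Y).2 s⟩) := by
      rw [tendsto_subtype_rng]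
      simpa [smul_add] using h1
    refine ((continuous_subtype_val.comp hτ).tendsto _).comp h2 |>.congr fun n => ?_
    have e1 := hT₀ X ((n : ℝ)⁻¹ * s)
    have e2 := hT₀ Y ((n : ℝ)⁻¹ * s)
    simp only [mul_smul] at e1 e2
    simp only [Function.comp_apply]
    rw [← e1, ← e2, ← Subgroup.coe_mul, ← map_mul, ← Subgroup.coe_pow,
      ← map_pow]
    congr 2
  let T₁ : k →ₗ[ℝ] Mat N := ⟨⟨T₀, hadd⟩, hsmul⟩
  obtain ⟨T, hT⟩ := T₁.exists_extend
  have hTX : ∀ X : k, T X = T₀ X := fun X => congrArg (fun l : k →ₗ[ℝ] Mat N => l X) hT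
  have hmem : ∀ X ∈ k, T X ∈ k := by
    intro X hX
    rw [hk]
    intro t
    rw [hTX ⟨X, hX⟩, ← hT₀]
    exact Subtype.prop _
  have hexp : ∀ X (hX : X ∈ k), (τ ⟨expGL X, hk.exp_mem hX⟩ : GLN N) = expGL (T X) := by
    intro X hX
    have := hT₀ ⟨X, hX⟩ 1
    simp only [one_smul] at this
    rw [hTX ⟨X, hX⟩, ← this]
  refine ⟨T, hmem, hexp, fun X hX Y hY => ?_⟩
  have hAd : ∀ s : ℝ, T (Ad (expGL (s • X)) Y) = Ad (expGL (s • T X)) (T Y) := by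
    intro s
    have hsX := k.smul_mem s hX
    refine expGL_smul_injective fun r => ?_
    have hm := hk.Ad_mem (hk.exp_mem hsX) (k.smul_mem r hY)
    rw [← map_smul, ← Ad_smul_real, ← Ad_smul_real, expGL_Ad, ← map_smul, ← map_smul,
      ← hexp _ hsX, ← hexp _ (k.smul_mem r hY), ← hexp _ hm]
    rw [← Subgroup.coe_mul, ← map_mul, ← Subgroup.coe_inv, ← map_inv, ← Subgroup.coe_mul,
      ← map_mul]
    congr 2
    ext1
    exact expGL_Ad _ _
  have h1 := hasDerivAt_Ad_exp (T X) (T Y) 0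
  have h2 := (LinearMap.toContinuousLinearMap T).hasFDerivAt.comp_hasDerivAt 0
    (hasDerivAt_Ad_exp X Y 0)
  have e : (LinearMap.toContinuousLinearMap T ∘ fun s : ℝ => Ad (expGL (s • X)) Y) =
      fun s : ℝ => Ad (expGL (s • T X)) (T Y) := funext hAd
  rw [e] at h2
  simpa [Ad_one] using h2.unique h1

end SymFlag

namespace SymFlag

variable {N : ℕ}

/-! ### Unitary form of a compact group -/

open scoped ComplexOrder in
open MeasureTheory Matrix in
/-- A compact group of matrices preserves a positive definite Hermitian form, namely the average
over the group of the translates of the standard form. -/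
theorem exists_invariant_posDef {U : Subgroup (GLN N)} (hU : IsCompact (U : Set (GLN N))) :
    ∃ S : Mat N, S.PosDef ∧ ∀ a ∈ U, (a : Mat N)ᴴ * S * (a : Mat N) = S := by
  have : CompactSpace U := isCompact_iff_compactSpace.1 hU
  let _ : MeasurableSpace U := borel U
  have : BorelSpace U := ⟨rfl⟩
  let μ : Measure U := Measure.haar
  let f : U → Mat N := fun a => (((a⁻¹ : U) : GLN N) : Mat N)ᴴ * (((a⁻¹ : U) : GLN N) : Mat N)
  have hval : Continuous fun a : U => (((a⁻¹ : U) : GLN N) : Mat N) :=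
    Units.continuous_val.comp (continuous_subtype_val.comp continuous_inv)
  have hf : Continuous f := (hval.matrix_conjTranspose).mul hval
  have hint : Integrable f μ := hf.integrable_of_hasCompactSupport (HasCompactSupport.of_compactSpace f)
  let S : Mat N := ∫ a, f a ∂μ
  have hlin : ∀ l : Mat N →L[ℝ] Mat N, l S = ∫ a, l (f a) ∂μ := fun l =>
    (l.integral_comp_comm hint).symm
  have hinv : ∀ v : U, ((v : GLN N) : Mat N)ᴴ * S * ((v : GLN N) : Mat N) = S := by
    intro v
    let l : Mat N →ₗ[ℝ] Mat N :=
      { toFun := fun X => ((v : GLN N) : Mat N)ᴴ * X * ((v : GLN N) : Mat N)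
        map_add' := fun X Y => by simp only [mul_add, add_mul]
        map_smul' := fun c X => by simp }
    have h1 := hlin (LinearMap.toContinuousLinearMap l)
    change ((v : GLN N) : Mat N)ᴴ * S * ((v : GLN N) : Mat N) = _ at h1
    rw [h1]
    refine Eq.trans ?_ (integral_mul_left_eq_self (μ := μ) f v⁻¹)
    refine integral_congr_ae (Eventually.of_forall fun a => ?_)
    change ((v : GLN N) : Mat N)ᴴ * f a * ((v : GLN N) : Mat N) = f (v⁻¹ * a)
    simp only [f, _root_.mul_inv_rev, inv_inv, Subgroup.coe_mul, Units.val_mul, conjTranspose_mul,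
      mul_assoc]
  have hherm : S.IsHermitian := by
    let l : Mat N →ₗ[ℝ] Mat N :=
      { toFun := fun X => Xᴴ
        map_add' := fun X Y => conjTranspose_add X Y
        map_smul' := fun c X => by simp }
    have h1 := hlin (LinearMap.toContinuousLinearMap l)
    change Sᴴ = _ at h1
    rw [Matrix.IsHermitian, h1]
    refine integral_congr_ae (Eventually.of_forall fun a => ?_)
    change (f a)ᴴ = f a
    simp [f]
  refine ⟨S, Matrix.PosDef.of_dotProduct_mulVec_pos hherm fun x hx => ?_, fun a ha => hinv ⟨a, ha⟩⟩
  let l : Mat N →ₗ[ℝ] ℝ :=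
    { toFun := fun X => (star x ⬝ᵥ (X *ᵥ x)).re
      map_add' := fun X Y => by simp [add_mulVec, dotProduct_add]
      map_smul' := fun c X => by simp [smul_mulVec, dotProduct_smul] }
  have hl : l S = ∫ a, l (f a) ∂μ :=
    ((LinearMap.toContinuousLinearMap l).integral_comp_comm hint).symm
  have hlf : ∀ a, 0 < l (f a) := by
    intro a
    have hpd : (f a).PosDef := by
      refine Matrix.PosDef.conjTranspose_mul_self _ ?_
      have hu : IsUnit (((a⁻¹ : U) : GLN N) : Mat N) := Units.isUnit _
      exact Matrix.mulVec_injective_of_isUnit hu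
    exact (Complex.pos_iff.1 (hpd.dotProduct_mulVec_pos hx)).1
  have hpos : 0 < l S := by
    rw [hl]
    have hc : Continuous fun a => l (f a) := (LinearMap.toContinuousLinearMap l).continuous.comp hf
    exact hc.integral_pos_of_hasCompactSupport_nonneg_nonzero
      (HasCompactSupport.of_compactSpace _) (fun a => (hlf a).le) (hlf 1).ne'
  rw [Complex.pos_iff]
  refine ⟨hpos, ?_⟩
  have h1 : star (star x ⬝ᵥ (S *ᵥ x)) = star x ⬝ᵥ (S *ᵥ x) := by
    rw [← star_dotProduct_star, star_star, star_mulVec, hherm.eq, ← dotProduct_mulVec]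
  exact (Complex.conj_eq_iff_im.1 h1).symm

open scoped ComplexOrder in
open Matrix MatrixOrder in
/-- A compact group of matrices is conjugate to a group of unitary matrices. -/
theorem exists_unitary_conj {U : Subgroup (GLN N)} (hU : IsCompact (U : Set (GLN N))) :
    ∃ R : GLN N, ∀ a ∈ U, (Ad R (a : Mat N))ᴴ * Ad R (a : Mat N) = 1 := by
  obtain ⟨S, hS, hinv⟩ := exists_invariant_posDef hU
  obtain ⟨y, hy, hyS⟩ := CStarAlgebra.isStrictlyPositive_iff_eq_star_mul_self.mp
    (Matrix.isStrictlyPositive_iff_posDef.2 hS)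
  obtain ⟨R, rfl⟩ := hy
  refine ⟨R, fun a ha => ?_⟩
  have h := hinv a ha
  rw [hyS, star_eq_conjTranspose] at h
  have h1 : (R : Mat N) * (R⁻¹).val = 1 := by rw [← Units.val_mul, mul_inv_cancel, Units.val_one]
  have h2 : ((R⁻¹).val)ᴴ * (R : Mat N)ᴴ = 1 := by rw [← conjTranspose_mul, h1, conjTranspose_one]
  calc (Ad R (a : Mat N))ᴴ * Ad R (a : Mat N)
      = ((R⁻¹).val)ᴴ * ((a : Mat N)ᴴ * ((R : Mat N)ᴴ * R) * a) * (R⁻¹).val := by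
        simp only [Ad, conjTranspose_mul, mul_assoc]
    _ = (((R⁻¹).val)ᴴ * (R : Mat N)ᴴ) * (R * (R⁻¹).val) := by rw [h]; simp only [mul_assoc]
    _ = 1 := by rw [h1, h2, one_mul]

/-- The conjugate-linear anti-involution of the matrices that is obtained from `Xᴴ` by the
conjugation by `R`, that is the adjoint for the Hermitian form `Rᴴ R`. -/
noncomputable def hstar (R : GLN N) (X : Mat N) : Mat N := Ad R⁻¹ (Ad R X).conjTranspose

section hstar

variable (R : GLN N)

theorem hstar_add (X Y : Mat N) : hstar R (X + Y) = hstar R X + hstar R Y := by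
  simp [hstar, Ad_add]

theorem hstar_smul (z : ℂ) (X : Mat N) : hstar R (z • X) = (starRingEnd ℂ z) • hstar R X := by
  simp [hstar, Ad_smul]

theorem hstar_smul_real (s : ℝ) (X : Mat N) : hstar R (s • X) = s • hstar R X := by
  simp [hstar, Ad_smul_real]

theorem hstar_neg (X : Mat N) : hstar R (-X) = -hstar R X := by
  have := hstar_smul_real R (-1) X
  simpa using this

theorem hstar_sub (X Y : Mat N) : hstar R (X - Y) = hstar R X - hstar R Y := by
  rw [sub_eq_add_neg, hstar_add, hstar_neg, ← sub_eq_add_neg]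

theorem hstar_hstar (X : Mat N) : hstar R (hstar R X) = X := by
  simp [hstar, Ad_Ad_inv, Ad_inv_Ad]

theorem hstar_lie (X Y : Mat N) : hstar R ⁅X, Y⁆ = ⁅hstar R Y, hstar R X⁆ := by
  simp only [hstar, ← Ad_lie]
  rw [Ad_lie, Ring.lie_def, Ring.lie_def]
  simp

open scoped ComplexOrder in
/-- The trace form is positive on the pairs `(X, X⋆)`. -/
theorem trace_mul_hstar_pos {X : Mat N} (hX : X ≠ 0) : 0 < ((X * hstar R X).trace).re := by
  have e : (X * hstar R X).trace = (Ad R X * (Ad R X).conjTranspose).trace := by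
    rw [← trace_Ad_mul_Ad R, hstar, Ad_Ad_inv]
  have hne : Ad R X ≠ 0 := fun h => hX (Ad_injective R (by rw [h, Ad_zero]))
  have h1 := (Matrix.posSemidef_self_mul_conjTranspose (Ad R X)).trace_nonneg
  have h2 : (Ad R X * (Ad R X).conjTranspose).trace ≠ 0 := fun h =>
    hne (Matrix.trace_mul_conjTranspose_self_eq_zero_iff.1 h)
  rw [e]
  exact (Complex.pos_iff.1 (lt_of_le_of_ne h1 h2.symm)).1

/-- The Lie algebra of a unitary group consists of skew-Hermitian matrices. -/
theorem hstar_eq_neg {U : Subgroup (GLN N)}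
    (hR : ∀ a ∈ U, (Ad R (a : Mat N)).conjTranspose * Ad R (a : Mat N) = 1)
    {X : Mat N} (hX : ∀ s : ℝ, expGL (s • X) ∈ U) : hstar R X = -X := by
  have key : (Ad R X).conjTranspose = -Ad R X := by
    have e : ∀ s : ℝ, Ad R (NormedSpace.exp (s • X)) = NormedSpace.exp (s • Ad R X) := fun s => by
      rw [← Ad_smul_real]
      exact (Matrix.exp_units_conj R (s • X)).symm
    have h1 := hasDerivAt_exp_smul_const (Ad R X) (0 : ℝ)
    have h2 := hasDerivAt_exp_smul_const (Ad R X).conjTranspose (0 : ℝ)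
    have h3 := h2.mul h1
    have e2 : (fun s : ℝ => NormedSpace.exp (s • (Ad R X).conjTranspose)) *
        (fun s : ℝ => NormedSpace.exp (s • Ad R X)) = fun _ => 1 := by
      funext s
      have := hR _ (hX s)
      rw [coe_expGL, e, ← Matrix.exp_conjTranspose] at this
      simpa using this
    rw [e2] at h3
    have h4 := h3.unique (hasDerivAt_const (0 : ℝ) (1 : Mat N))
    simp at h4
    exact eq_neg_of_add_eq_zero_left h4
  rw [hstar, key, ← neg_one_smul ℂ, Ad_smul, Ad_inv_Ad, neg_one_smul]

end hstar

end SymFlag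

namespace SymFlag

/-! ### Roots and the characteristic element -/

section Roots

open LieAlgebra LieAlgebra.IsKilling LieModule

variable {N : ℕ} {g : LieSubalgebra ℂ (Mat N)} [LieAlgebra.IsSemisimple ℂ g]
  {h : LieSubalgebra ℂ g} [h.IsCartanSubalgebra]

omit [LieAlgebra.IsSemisimple ℂ g] in
/-- Root space decomposition: an additive property of elements of `g` has to be checked on the
Cartan subalgebra and on the root spaces only. -/
theorem root_induction {p : g → Prop} (hh : ∀ X ∈ h, p X)
    (hr : ∀ α : h.root, ∀ X ∈ rootSpace h (α : Weight ℂ h g), p X)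
    (hadd : ∀ X Y, p X → p Y → p (X + Y)) (X : g) : p X := by
  have hX : X ∈ (⨆ χ : Weight ℂ h g, genWeightSpace g χ) := by
    rw [iSup_genWeightSpace_eq_top' ℂ h g]; trivial
  induction hX using LieSubmodule.iSup_induction' with
  | mem χ X hX =>
    by_cases hχ : χ.IsZero
    · refine hh X ?_
      have h0 : (χ : h → ℂ) = 0 := hχ
      rw [h0] at hX
      have : X ∈ rootSpace h (0 : h → ℂ) := hX
      rwa [rootSpace_zero_eq ℂ g h] at this
    · exact hr ⟨χ, by simpa using hχ⟩ X hX
  | zero => exact hh 0 h.zero_mem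
  | add X Y _ _ hX hY => exact hadd X Y hX hY

theorem lie_of_mem_rootSpace {α : Weight ℂ h g} {X : g} (hX : X ∈ rootSpace h α) (A : h) :
    ⁅(A : g), X⁆ = α A • X :=
  lie_eq_smul_of_mem_rootSpace hX A

theorem lie_of_mem_cartan (A : h) {X : g} (hX : X ∈ h) : ⁅(A : g), X⁆ = 0 := by
  have : ⁅A, (⟨X, hX⟩ : h)⁆ = 0 := trivial_lie_zero _ _ _ _
  exact congrArg Subtype.val this

/-- There is an element of the Cartan subalgebra at which the simple roots have given values. -/
theorem exists_root_eq (b : (rootSystem h).Base) (v : h.root → ℂ) :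
    ∃ H : h, ∀ α ∈ b.support, (α : Weight ℂ h g) H = v α := by
  let f : Module.Dual ℂ (Module.Dual ℂ h) := b.toWeightBasis.constr ℂ fun α => v α
  refine ⟨(Module.evalEquiv ℂ h).symm f, fun α hα => ?_⟩
  have h1 : f (b.toWeightBasis ⟨α, hα⟩) = v α := Module.Basis.constr_basis _ _ _ _
  rw [RootPairing.Base.toWeightBasis_apply] at h1
  rw [← h1, ← Module.apply_evalEquiv_symm_apply]
  rfl

/-- The values of the roots at an element `H` at which the simple roots are `0` on `Θ` and `c`
outside. -/
theorem root_value_of_isPos {b : (rootSystem h).Base} {Θ : Finset h.root} {c : ℂ} {H : h}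
    (hH : ∀ α ∈ b.support, (α ∈ Θ → (α : Weight ℂ h g) H = 0) ∧
      (α ∉ Θ → (α : Weight ℂ h g) H = c))
    {α : h.root} (hα : b.IsPos α) :
    ∃ n : ℕ, (α : Weight ℂ h g) H = n * c ∧ (n = 0 → α ∈ generatedRoots Θ) := by
  refine hα.induction_on_add (p := fun α => ∃ n : ℕ, (α : Weight ℂ h g) H = n * c ∧
    (n = 0 → α ∈ generatedRoots Θ)) (fun α hα => ?_) (fun α β γ hγ ih hβ => ?_)
  · by_cases hΘ : α ∈ Θ
    · exact ⟨0, by simp [(hH α hα).1 hΘ], fun _ => Submodule.subset_span ⟨α, hΘ, rfl⟩⟩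
    · exact ⟨1, by simp [(hH α hα).2 hΘ], by simp⟩
  · obtain ⟨n, hn, hn0⟩ := ih
    have hval : (γ : Weight ℂ h g) H = (α : Weight ℂ h g) H + (β : Weight ℂ h g) H :=
      LinearMap.congr_fun hγ H
    rw [hval, hn]
    by_cases hΘ : β ∈ Θ
    · refine ⟨n, by simp [(hH β hβ).1 hΘ], fun h0 => ?_⟩
      simp only [generatedRoots, Set.mem_ofPred_eq]
      rw [hγ]
      exact Submodule.add_mem _ (hn0 h0) (Submodule.subset_span ⟨β, hΘ, rfl⟩)
    · exact ⟨n + 1, by rw [(hH β hβ).2 hΘ]; push_cast; ring, by simp⟩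

theorem root_value_of_mem_generatedRoots {b : (rootSystem h).Base} {Θ : Finset h.root}
    (hΘ : Θ ⊆ b.support) {c : ℂ} {H : h}
    (hH : ∀ α ∈ b.support, (α ∈ Θ → (α : Weight ℂ h g) H = 0) ∧
      (α ∉ Θ → (α : Weight ℂ h g) H = c))
    {α : h.root} (hα : α ∈ generatedRoots Θ) : (α : Weight ℂ h g) H = 0 := by
  have key : ∀ f ∈ Submodule.span ℤ ((rootSystem h).root '' (Θ : Set h.root)), f H = 0 := by
    intro f hf
    induction hf using Submodule.span_induction with
    | mem f hf =>
      obtain ⟨β, hβ, rfl⟩ := hf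
      exact (hH β (hΘ hβ)).1 hβ
    | zero => rfl
    | add f f' _ _ h1 h2 => rw [LinearMap.add_apply, h1, h2, add_zero]
    | smul n f _ h1 => rw [LinearMap.smul_apply, h1, smul_zero]
  exact key _ hα

/-- The eigenspace of `ad H` in `g` for the eigenvalue `k c`. -/
def gradedPiece (g : LieSubalgebra ℂ (Mat N)) (c : ℂ) (H : Mat N) (k : ℤ) :
    Submodule ℂ (Mat N) where
  carrier := {X | X ∈ g ∧ ⁅H, X⁆ = ((k : ℂ) * c) • X}
  add_mem' := by
    rintro X Y ⟨hX, hX'⟩ ⟨hY, hY'⟩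
    exact ⟨g.add_mem hX hY, by rw [lie_add, hX', hY', smul_add]⟩
  zero_mem' := ⟨g.zero_mem, by simp⟩
  smul_mem' := by
    rintro z X ⟨hX, hX'⟩
    exact ⟨g.smul_mem z hX, by rw [lie_smul, hX', smul_comm]⟩

theorem lie_mem_gradedPiece {g : LieSubalgebra ℂ (Mat N)} {c : ℂ} {H : Mat N} {j k : ℤ}
    {X Y : Mat N} (hX : X ∈ gradedPiece g c H j) (hY : Y ∈ gradedPiece g c H k) :
    ⁅X, Y⁆ ∈ gradedPiece g c H (j + k) := by
  refine ⟨g.lie_mem hX.1 hY.1, ?_⟩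
  rw [leibniz_lie, hX.2, hY.2, smul_lie, lie_smul, ← add_smul]
  push_cast
  ring_nf

/-- `gradedPiece`s of degrees that are not opposite are orthogonal for the trace form. -/
theorem trace_mul_eq_zero {g : LieSubalgebra ℂ (Mat N)} {c : ℂ} (hc : c ≠ 0) {H : Mat N} {j k : ℤ}
    (hjk : j + k ≠ 0) {X Y : Mat N} (hX : X ∈ gradedPiece g c H j)
    (hY : Y ∈ gradedPiece g c H k) : (X * Y).trace = 0 := by
  have h1 : (⁅H, X⁆ * Y).trace + (X * ⁅H, Y⁆).trace = 0 := by
    rw [← Matrix.trace_add, Ring.lie_def, Ring.lie_def, sub_mul, mul_sub, mul_assoc X H Y,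
      ← mul_assoc X Y H, sub_add_sub_cancel, Matrix.trace_sub, mul_assoc, Matrix.trace_mul_comm,
      sub_self]
  rw [hX.2, hY.2, smul_mul_assoc, mul_smul_comm, Matrix.trace_smul, Matrix.trace_smul,
    ← add_smul, ← add_mul] at h1
  have h2 : ((j : ℂ) + k) * c ≠ 0 := mul_ne_zero (by exact_mod_cast hjk) hc
  exact (smul_eq_zero.1 h1).resolve_left h2

theorem mem_gradedPiece_of_mem_rootSpace {α : Weight ℂ h g} {X : g} (hX : X ∈ rootSpace h α)
    {H : h} {c : ℂ} {k : ℤ} (hk : α H = k * c) :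
    (X : Mat N) ∈ gradedPiece g c ((H : g) : Mat N) k := by
  refine ⟨X.2, ?_⟩
  have := congrArg (Subtype.val) (lie_of_mem_rootSpace hX H)
  rw [hk] at this
  exact this

theorem mem_gradedPiece_of_mem_cartan {X : g} (hX : X ∈ h) {H : h} {c : ℂ} :
    (X : Mat N) ∈ gradedPiece g c ((H : g) : Mat N) 0 := by
  refine ⟨X.2, ?_⟩
  have := congrArg (Subtype.val) (lie_of_mem_cartan H hX)
  simpa using this

theorem iSupIndep_gradedPiece {g : LieSubalgebra ℂ (Mat N)} {c : ℂ} (hc : c ≠ 0) {H : Mat N} :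
    iSupIndep (gradedPiece g c H) := by
  have h1 : iSupIndep fun k : ℤ => Module.End.eigenspace (LieAlgebra.ad ℂ (Mat N) H) (k * c) :=
    (Module.End.eigenspaces_iSupIndep (LieAlgebra.ad ℂ (Mat N) H)).comp fun j k hjk => by
      exact_mod_cast mul_right_cancel₀ hc hjk
  refine h1.mono fun k X hX => ?_
  rw [Module.End.mem_eigenspace_iff]
  exact hX.2

/-- The parabolic subalgebra is the sum of the eigenspaces of `ad H` of nonnegative degree. -/
theorem map_parabolic_eq {b : (rootSystem h).Base} {Θ : Finset h.root}
    (hΘ : Θ ⊆ b.support) {c : ℂ} (hc : c ≠ 0) {H : h}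
    (hH : ∀ α ∈ b.support, (α ∈ Θ → (α : Weight ℂ h g) H = 0) ∧
      (α ∉ Θ → (α : Weight ℂ h g) H = c)) :
    (parabolic b Θ).map g.toSubmodule.subtype =
      ⨆ n : ℕ, gradedPiece g c ((H : g) : Mat N) n := by
  have hle : (parabolic b Θ).map g.toSubmodule.subtype ≤
      ⨆ n : ℕ, gradedPiece g c ((H : g) : Mat N) n := by
    rw [Submodule.map_le_iff_le_comap, parabolic]
    refine sup_le (fun X hX => ?_) (iSup_le fun α X hX => ?_)
    · exact Submodule.mem_iSup_of_mem (ι := ℕ) 0 (mem_gradedPiece_of_mem_cartan hX)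
    · obtain ⟨n, hn⟩ : ∃ n : ℕ, ((α : h.root) : Weight ℂ h g) H = n * c := by
        rcases α.2 with hα | hα
        · obtain ⟨n, hn, -⟩ := root_value_of_isPos hH hα
          exact ⟨n, hn⟩
        · exact ⟨0, by simpa using root_value_of_mem_generatedRoots hΘ hH hα⟩
      exact Submodule.mem_iSup_of_mem n
        (mem_gradedPiece_of_mem_rootSpace hX (k := n) (by exact_mod_cast hn))
  refine le_antisymm hle fun X hX => ?_
  have hg : (⨆ n : ℕ, gradedPiece g c ((H : g) : Mat N) n) ≤ g.toSubmodule :=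
    iSup_le fun n X hX => hX.1
  -- decompose `X` into a part in the parabolic subalgebra and a part of negative degree
  have hdec : ∀ Y : g, ∃ P ∈ parabolic b Θ, ∃ Q : Mat N,
      Q ∈ (⨆ k : {k : ℤ // k < 0}, gradedPiece g c ((H : g) : Mat N) k) ∧
      (Y : Mat N) = P + Q := by
    refine root_induction (h := h) ?_ ?_ ?_
    · intro Y hY
      exact ⟨Y, Submodule.mem_sup_left hY, 0, Submodule.zero_mem _, by simp⟩
    · intro α Y hY
      by_cases hα : b.IsPos α ∨ α ∈ generatedRoots Θ
      · exact ⟨Y, Submodule.mem_sup_right (Submodule.mem_iSup_of_mem ⟨α, hα⟩ hY), 0,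
          Submodule.zero_mem _, by simp⟩
      · push Not at hα
        obtain ⟨α', hneg, hroot⟩ : ∃ α' : h.root, b.IsPos α' ∧
            (rootSystem h).root α' = -(rootSystem h).root α := by
          rcases RootPairing.Base.IsPos.or_neg b α with h1 | h1
          · exact absurd h1 hα.1
          · refine ⟨(rootSystem h).reflectionPerm α α, h1, ?_⟩
            rw [RootPairing.root_reflectionPerm, RootPairing.reflection_apply_self]
        obtain ⟨n, hn, hn0⟩ := root_value_of_isPos hH hneg
        have hval : (α : Weight ℂ h g) H = ((-n : ℤ) : ℂ) * c := by
          have := LinearMap.congr_fun hroot H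
          have h2 : (α' : Weight ℂ h g) H = -((α : Weight ℂ h g) H) := this
          rw [hn] at h2
          push_cast
          rw [neg_mul, h2, neg_neg]
        have hn' : n ≠ 0 := fun h0 => hα.2 (by
          have h1 := hn0 h0
          simp only [generatedRoots, Set.mem_ofPred_eq] at h1 ⊢
          rw [hroot] at h1
          exact (Submodule.neg_mem_iff _).1 h1)
        refine ⟨0, Submodule.zero_mem _, Y, ?_, by simp⟩
        exact Submodule.mem_iSup_of_mem (⟨-n, by omega⟩ : {k : ℤ // k < 0})
          (mem_gradedPiece_of_mem_rootSpace hY hval)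
    · rintro Y Y' ⟨P, hP, Q, hQ, e⟩ ⟨P', hP', Q', hQ', e'⟩
      refine ⟨P + P', Submodule.add_mem _ hP hP', Q + Q', Submodule.add_mem _ hQ hQ', ?_⟩
      push_cast
      rw [e, e']
      abel
  obtain ⟨P, hP, Q, hQ, e⟩ := hdec ⟨X, hg hX⟩
  have e : X = P + Q := e
  have hP' : (P : Mat N) ∈ (parabolic b Θ).map g.toSubmodule.subtype := ⟨P, hP, rfl⟩
  have hQ' : Q ∈ ⨆ n : ℕ, gradedPiece g c ((H : g) : Mat N) n := by
    have : Q = X - P := by rw [e]; abel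
    rw [this]
    exact Submodule.sub_mem _ hX (hle hP')
  have hdisj : Disjoint (⨆ n : ℕ, gradedPiece g c ((H : g) : Mat N) n)
      (⨆ k : {k : ℤ // k < 0}, gradedPiece g c ((H : g) : Mat N) k) := by
    have := (iSupIndep_gradedPiece (g := g) hc (H := ((H : g) : Mat N))).disjoint_biSup_biSup
      (s := {k : ℤ | 0 ≤ k}) (t := {k : ℤ | k < 0}) (by
        rw [Set.disjoint_left]; intro k hk hk'; exact (not_lt.2 (show (0 : ℤ) ≤ k from hk)) hk')
    refine this.mono ?_ ?_
    · exact iSup_le fun n => le_biSup (gradedPiece g c ((H : g) : Mat N))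
        (show (n : ℤ) ∈ {k : ℤ | 0 ≤ k} from Int.natCast_nonneg n)
    · exact iSup_le fun k => le_biSup (gradedPiece g c ((H : g) : Mat N)) k.2
  have hQ0 : Q = 0 := by simpa using hdisj.le_bot ⟨hQ', hQ⟩
  rw [e, hQ0, add_zero]
  exact hP'

/-- If the brackets of root spaces of degrees `j`, `k` with `j, k, j + k ≠ 0` vanish, then the
positive roots have degree at most one. The reason is that if `γ = α + β` with a simple root `β`,
and `α`, `β` of degree one, then `sl₂`-theory for `β` gives `γ(β^∨) = 0` and
`α(β^∨) = -2`, while a root vector of `α` is primitive for this `sl₂`. -/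
theorem root_value_eq_zero_or {b : (rootSystem h).Base} {Θ : Finset h.root} {c : ℂ} (hc : c ≠ 0)
    {H : h} (hH : ∀ α ∈ b.support, (α ∈ Θ → (α : Weight ℂ h g) H = 0) ∧
      (α ∉ Θ → (α : Weight ℂ h g) H = c))
    (hab : ∀ (α β : Weight ℂ h g) (X Y : g), X ∈ rootSpace h α → Y ∈ rootSpace h β →
      α H ≠ 0 → β H ≠ 0 → α H + β H ≠ 0 → ⁅X, Y⁆ = 0)
    {α : h.root} (hα : b.IsPos α) :
    (α : Weight ℂ h g) H = 0 ∨ (α : Weight ℂ h g) H = c := by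
  have hsimple : ∀ α ∈ b.support, (α : Weight ℂ h g) H = 0 ∨ (α : Weight ℂ h g) H = c := by
    intro α hα
    by_cases hΘ : α ∈ Θ
    · exact Or.inl ((hH α hα).1 hΘ)
    · exact Or.inr ((hH α hα).2 hΘ)
  refine hα.induction_on_add
    (p := fun α => (α : Weight ℂ h g) H = 0 ∨ (α : Weight ℂ h g) H = c)
    hsimple (fun α β γ hγ ih hβ => ?_)
  · have hval : ∀ A : h, (γ : Weight ℂ h g) A = (α : Weight ℂ h g) A + (β : Weight ℂ h g) A :=
      fun A => LinearMap.congr_fun hγ A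
    have hβ' := hsimple β hβ
    rcases ih with hα0 | hα1
    · rw [hval, hα0, zero_add]; exact hβ'
    rcases hβ' with hβ0 | hβ1
    · rw [hval, hα1, hβ0, add_zero]; simp
    exfalso
    have hnz : (β : Weight ℂ h g).IsNonZero := h.isNonZero_coe_root β
    obtain ⟨h', e, f, ht, he, hf⟩ := exists_isSl2Triple_of_weight_isNonZero hnz
    have hcor := ht.h_eq_coroot hnz he hf
    obtain ⟨x, hx, hx0⟩ := (γ : Weight ℂ h g).exists_ne_zero
    obtain ⟨y, hy, hy0⟩ := (α : Weight ℂ h g).exists_ne_zero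
    have hγ2 : (γ : Weight ℂ h g) H = c + c := by rw [hval, hα1, hβ1]
    have hcc : c + c ≠ 0 := by rw [← two_mul]; exact mul_ne_zero two_ne_zero hc
    have hccc : c + (c + c) ≠ 0 := by
      have : c + (c + c) = 3 * c := by ring
      rw [this]; exact mul_ne_zero three_ne_zero hc
    have hex : ⁅e, x⁆ = 0 := hab β γ e x he hx (by rw [hβ1]; exact hc) (by rw [hγ2]; exact hcc)
      (by rw [hβ1, hγ2]; exact hccc)
    have hey : ⁅e, y⁆ = 0 := hab β α e y he hy (by rw [hβ1]; exact hc) (by rw [hα1]; exact hc)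
      (by rw [hβ1, hα1]; exact hcc)
    have hfx : ⁅f, x⁆ ∈ rootSpace h (α : Weight ℂ h g) := by
      have h1 := lie_mem_genWeightSpace_of_mem_genWeightSpace hf hx
      have h2 : (-((β : Weight ℂ h g) : h → ℂ) + ((γ : Weight ℂ h g) : h → ℂ)) =
          ((α : Weight ℂ h g) : h → ℂ) := by
        funext A
        simp only [Pi.add_apply, Pi.neg_apply, hval]
        ring
      rwa [h2] at h1
    have hefx : ⁅e, ⁅f, x⁆⁆ = 0 := hab β α e _ he hfx (by rw [hβ1]; exact hc)
      (by rw [hα1]; exact hc) (by rw [hβ1, hα1]; exact hcc)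
    have hhx : (γ : Weight ℂ h g) (coroot (β : Weight ℂ h g)) = 0 := by
      have h1 := leibniz_lie e f x
      rw [hefx, ht.lie_e_f, hex, lie_zero, add_zero, hcor] at h1
      have h2 := lie_of_mem_rootSpace hx (coroot (β : Weight ℂ h g))
      rw [← h1] at h2
      exact (smul_eq_zero.1 h2.symm).resolve_right hx0
    have hay : (α : Weight ℂ h g) (coroot (β : Weight ℂ h g)) = -2 := by
      rw [hval, root_apply_coroot hnz] at hhx
      exact eq_neg_of_add_eq_zero_left hhx
    have P : ht.HasPrimitiveVectorWith y (-2 : ℂ) :=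
      { ne_zero := hy0
        lie_h := by rw [hcor, lie_of_mem_rootSpace hy, hay]
        lie_e := hey }
    obtain ⟨n, hn⟩ := P.exists_nat
    have h3 := congrArg Complex.re hn
    simp at h3
    linarith [Nat.cast_nonneg (α := ℝ) n]

end Roots

end SymFlag

namespace SymFlag

variable {N : ℕ}

/-! ### The trace form on the compact real form -/

/-- The number `π i`. -/
noncomputable def piI : ℂ := Real.pi * Complex.I

theorem piI_ne_zero : piI ≠ 0 :=
  mul_ne_zero (Complex.ofReal_ne_zero.2 Real.pi_ne_zero) Complex.I_ne_zero

theorem piI_mul_self : piI * piI = ((-(Real.pi ^ 2) : ℝ) : ℂ) := by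
  rw [piI, mul_mul_mul_comm, Complex.I_mul_I]
  push_cast
  ring

theorem exp_piI : Complex.exp piI = -1 := Complex.exp_pi_mul_I

theorem trace_lie_mul (H X Y : Mat N) : (⁅H, X⁆ * Y).trace = -(X * ⁅H, Y⁆).trace := by
  rw [eq_neg_iff_add_eq_zero, ← Matrix.trace_add, Ring.lie_def, Ring.lie_def, sub_mul, mul_sub,
    mul_assoc X H Y, ← mul_assoc X Y H, sub_add_sub_cancel, Matrix.trace_sub, mul_assoc,
    Matrix.trace_mul_comm, sub_self]

theorem eq_zero_of_trace_mul_self {R : GLN N} {X : Mat N} (hX : hstar R X = -X)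
    (h : (X * X).trace = 0) : X = 0 := by
  by_contra hne
  have := trace_mul_hstar_pos R hne
  rw [hX, mul_neg, Matrix.trace_neg, h] at this
  simp at this

/-- If `A` is skew-Hermitian then `ad A` has imaginary eigenvalues. -/
theorem re_eq_zero_of_lie_eq_smul {R : GLN N} {A X : Mat N} (hA : hstar R A = -A) (hX : X ≠ 0)
    {z : ℂ} (h : ⁅A, X⁆ = z • X) : z.re = 0 := by
  have h1 : ⁅A, hstar R X⁆ = (starRingEnd ℂ z) • hstar R X := by
    rw [← hstar_smul, ← h, hstar_lie, hA, lie_neg, lie_skew]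
  have h2 := trace_lie_mul A X (hstar R X)
  rw [h, h1, smul_mul_assoc, mul_smul_comm, Matrix.trace_smul, Matrix.trace_smul,
    eq_neg_iff_add_eq_zero, ← add_smul] at h2
  have h3 : (X * hstar R X).trace ≠ 0 := fun h0 => by
    have := trace_mul_hstar_pos R hX
    rw [h0] at this
    simp at this
  have h4 := (smul_eq_zero.1 h2).resolve_right h3
  have h5 := congrArg Complex.re h4
  simp at h5
  linarith

/-- On `u` the kernels of `ad H` and of its square coincide, as `ad H` is skew for the definite
trace form. -/
theorem lie_eq_zero_of_lie_lie_eq_zero {R : GLN N} {u : LieSubalgebra ℝ (Mat N)}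
    (hu : ∀ X ∈ u, hstar R X = -X) {H X : Mat N} (hH : H ∈ u) (hX : X ∈ u)
    (h : ⁅H, ⁅H, X⁆⁆ = 0) : ⁅H, X⁆ = 0 := by
  refine eq_zero_of_trace_mul_self (hu _ (u.lie_mem hH hX)) ?_
  rw [trace_lie_mul, h, mul_zero, Matrix.trace_zero, neg_zero]

theorem mem_of_hasDerivAt {V : Submodule ℝ (Mat N)} {f : ℝ → Mat N} {f' : Mat N}
    (hf : HasDerivAt f f' 0) (hV : ∀ s, f s ∈ V) : f' ∈ V := by
  have hcl : IsClosed (V : Set (Mat N)) := V.closed_of_finiteDimensional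
  refine hcl.mem_of_tendsto hf.tendsto_slope_zero (Eventually.of_forall fun s => ?_)
  exact V.smul_mem _ (V.sub_mem (hV _) (hV _))

/-- `Ad(exp H)` is `-1` where `(ad H)² = (π i)²`. -/
theorem Ad_expGL_of_lie_lie {H Y : Mat N} (h : ⁅H, ⁅H, Y⁆⁆ = (piI * piI) • Y) :
    Ad (expGL H) Y = -Y := by
  have hp : ⁅H, piI • Y + ⁅H, Y⁆⁆ = piI • (piI • Y + ⁅H, Y⁆) := by
    rw [lie_add, lie_smul, h, smul_add, smul_smul, add_comm]
  have hm : ⁅H, piI • Y - ⁅H, Y⁆⁆ = (-piI) • (piI • Y - ⁅H, Y⁆) := by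
    rw [lie_sub, lie_smul, h, neg_smul, smul_sub, smul_smul, neg_sub]
  have e1 := Ad_expGL_of_lie_eq_smul hp
  have e2 := Ad_expGL_of_lie_eq_smul hm
  have exp_neg : Complex.exp (-piI) = -1 := by rw [Complex.exp_neg, exp_piI]; norm_num
  rw [exp_piI] at e1
  rw [exp_neg] at e2
  have e3 : Ad (expGL H) ((2 * piI) • Y) = -((2 * piI) • Y) := by
    have : (2 * piI) • Y = (piI • Y + ⁅H, Y⁆) + (piI • Y - ⁅H, Y⁆) := by
      rw [mul_smul, two_smul]; abel
    rw [this, Ad_add, e1, e2]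
    simp only [neg_smul, one_smul]
    abel
  rw [Ad_smul, ← smul_neg] at e3
  exact smul_right_injective _ (mul_ne_zero two_ne_zero piI_ne_zero) e3

/-! ### Symmetric flags -/

/-- The elements of `g` on which `ad H`, whose eigenvalues on `g` are `0` and `± π i`, has only the
eigenvalues `0` and `π i`. -/
def nonnegPart (g : LieSubalgebra ℂ (Mat N)) (H : Mat N) : Set (Mat N) :=
  {X | X ∈ g ∧ ⁅H, ⁅H, X⁆⁆ = piI • ⁅H, X⁆}

/-- The data which describe a symmetric flag space without reference to roots: `ad H`
is diagonalizable on `g` with eigenvalues among `0, ± π i`, and `P` is the normalizer in `G` of the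
sum of the eigenspaces for `0` and `π i`. The conjugation by `R` makes the compact group `U`
unitary. -/
structure IsSymmetricFlag (G U P : Subgroup (GLN N)) (g : LieSubalgebra ℂ (Mat N))
    (u : LieSubalgebra ℝ (Mat N)) (H : Mat N) (R : GLN N) : Prop where
  groupG : IsConnectedComplexGroup G g
  groupU : IsCompactRealForm G g U u
  center : ∀ X ∈ g, (∀ Y ∈ g, ⁅X, Y⁆ = 0) → X = 0
  unitary : ∀ a ∈ U, (Ad R (a : Mat N)).conjTranspose * Ad R (a : Mat N) = 1
  mem_u : H ∈ u
  cube : ∀ X ∈ g, ⁅H, ⁅H, ⁅H, X⁆⁆⁆ = (piI * piI) • ⁅H, X⁆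
  mem_P : ∀ a, a ∈ P ↔ a ∈ G ∧ ∀ X, Ad a X ∈ nonnegPart g H ↔ X ∈ nonnegPart g H

theorem IsCompactRealForm.mem_of_mem {G : Subgroup (GLN N)} {g : LieSubalgebra ℂ (Mat N)}
    {U : Subgroup (GLN N)} {u : LieSubalgebra ℝ (Mat N)} (hU : IsCompactRealForm G g U u)
    {X : Mat N} (hX : X ∈ u) : X ∈ g :=
  (hU.span X).2 ⟨X, hX, 0, u.zero_mem, by simp⟩

theorem IsConnectedComplexGroup.Ad_mem {G : Subgroup (GLN N)} {g : LieSubalgebra ℂ (Mat N)}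
    (hG : IsConnectedComplexGroup G g) {a : GLN N} (ha : a ∈ G) {X : Mat N} (hX : X ∈ g) :
    Ad a X ∈ g :=
  hG.lie.Ad_mem ha (X := X) hX

/-- If `ad H` has only the eigenvalues `0` and `± π i`, those of nonnegative degree are `0` and
`π i`. -/
theorem mem_nonnegPart_iff_of_cube {g : LieSubalgebra ℂ (Mat N)} {H : Mat N}
    (hH : H ∈ g) (cube : ∀ X ∈ g, ⁅H, ⁅H, ⁅H, X⁆⁆⁆ = (piI * piI) • ⁅H, X⁆) (X : Mat N) :
    X ∈ nonnegPart g H ↔ X ∈ ⨆ n : ℕ, gradedPiece g piI H n := by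
  constructor
  · rintro ⟨hX, h⟩
    have e : X = (X - piI⁻¹ • ⁅H, X⁆) + piI⁻¹ • ⁅H, X⁆ := by abel
    have hHX := g.lie_mem hH hX
    rw [e]
    refine Submodule.add_mem _ (Submodule.mem_iSup_of_mem 0 ⟨?_, ?_⟩)
      (Submodule.mem_iSup_of_mem 1 ⟨?_, ?_⟩)
    · exact g.sub_mem hX (g.smul_mem _ hHX)
    · rw [lie_sub, lie_smul, h, smul_smul, inv_mul_cancel₀ piI_ne_zero]; simp
    · exact g.smul_mem _ hHX
    · rw [lie_smul, h]
      simp [smul_smul, mul_comm]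
  · intro hX
    induction hX using Submodule.iSup_induction' with
    | mem n X hX =>
      refine ⟨hX.1, ?_⟩
      have h3 := cube X hX.1
      have hn := hX.2
      push_cast at hn
      simp only [hn, lie_smul, smul_smul] at h3 ⊢
      by_cases hX0 : X = 0
      · simp [hX0]
      have h4 := smul_left_injective ℂ hX0 h3
      have h5 : (n : ℂ) * (n * n) = n := by
        have h6 : (piI * piI * piI) * ((n : ℂ) * (n * n)) = (piI * piI * piI) * n := by
          linear_combination h4
        exact mul_left_cancel₀ (by simp [piI_ne_zero]) h6
      have h7 : n * (n * n) = n := by exact_mod_cast h5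
      have h8 : n = 0 ∨ n = 1 := by
        rcases Nat.eq_zero_or_pos n with h | h
        · exact Or.inl h
        · right
          have : n * n = 1 := Nat.eq_of_mul_eq_mul_left h (by rw [h7, mul_one])
          exact Nat.eq_one_of_mul_eq_one_left this
      rcases h8 with rfl | rfl <;> simp
    | zero => exact ⟨g.zero_mem, by simp⟩
    | add X Y _ _ hX hY =>
      exact ⟨g.add_mem hX.1 hY.1, by rw [lie_add, lie_add, hX.2, hY.2, smul_add]⟩

section Characteristic

open LieAlgebra LieAlgebra.IsKilling LieModule

variable {G : Subgroup (GLN N)} {g : LieSubalgebra ℂ (Mat N)} [LieAlgebra.IsSemisimple ℂ g]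
  {U : Subgroup (GLN N)} {u : LieSubalgebra ℝ (Mat N)}
  {h : LieSubalgebra ℂ g} [h.IsCartanSubalgebra]

theorem eq_zero_of_forall_lie_eq_zero {X : Mat N} (hX : X ∈ g) (h : ∀ Y ∈ g, ⁅X, Y⁆ = 0) :
    X = 0 := by
  have h1 : (⟨X, hX⟩ : g) ∈ LieAlgebra.center ℂ g := by
    rw [LieModule.mem_maxTrivSubmodule]
    intro Y
    refine Subtype.ext ?_
    change ⁅(Y : Mat N), X⁆ = 0
    rw [← lie_skew, h Y Y.2, neg_zero]
  rw [LieAlgebra.center_eq_bot] at h1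
  exact congrArg Subtype.val ((LieSubmodule.mem_bot _).1 h1)

/-- An element of the Cartan subalgebra at which all roots are imaginary lies in the compact real
form. -/
theorem exists_mem_of_root_imaginary (hU : IsCompactRealForm G g U u) {R : GLN N}
    (hu : ∀ X ∈ u, hstar R X = -X) {t : LieSubalgebra ℝ u} (hth : IsComplexificationOf h t)
    {H : h} (hH : ∀ α : h.root, ((α : Weight ℂ h g) H).re = 0) :
    ∃ A ∈ t, (A : Mat N) = ((H : g) : Mat N) := by
  obtain ⟨A, hA, B, hB, e⟩ := (hth (H : g)).1 H.2
  have hmem : ∀ A ∈ t, ∃ A' : h, ((A' : g) : Mat N) = (A : Mat N) := fun A hA =>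
    ⟨⟨⟨A, hU.mem_of_mem A.2⟩, (hth _).2 ⟨A, hA, 0, t.zero_mem, by simp⟩⟩, rfl⟩
  obtain ⟨A', hA'⟩ := hmem A hA
  obtain ⟨B', hB'⟩ := hmem B hB
  have eH : H = A' + Complex.I • B' := by
    ext1; ext1
    push_cast
    rw [e, hA', hB']
  have him : ∀ (α : h.root) (C : u) (C' : h), ((C' : g) : Mat N) = (C : Mat N) →
      ((α : Weight ℂ h g) C').re = 0 := by
    intro α C C' hC
    obtain ⟨X, hX, hX0⟩ := (α : Weight ℂ h g).exists_ne_zero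
    have h1 := congrArg Subtype.val (lie_of_mem_rootSpace hX C')
    have h2 : ⁅(C : Mat N), (X : Mat N)⁆ = (α : Weight ℂ h g) C' • (X : Mat N) := by
      rw [← hC]; exact h1
    exact re_eq_zero_of_lie_eq_smul (hu _ C.2) (by simpa using hX0) h2
  have hB0 : ∀ α : h.root, (α : Weight ℂ h g) B' = 0 := by
    intro α
    have h1 := hH α
    rw [eH] at h1
    have h2 : (α : Weight ℂ h g) (A' + Complex.I • B') =
        (α : Weight ℂ h g) A' + Complex.I * (α : Weight ℂ h g) B' := by
      have := map_add ((rootSystem h).root α) A' (Complex.I • B')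
      rw [map_smul] at this
      exact this
    rw [h2, Complex.add_re, him α A A' hA', Complex.I_mul_re, zero_add, neg_eq_zero] at h1
    exact Complex.ext (him α B B' hB') h1
  have hBc : (((B' : g)) : Mat N) = 0 := by
    refine eq_zero_of_forall_lie_eq_zero (B' : g).2 fun Y hY => ?_
    have := root_induction (h := h) (p := fun Y : g => ⁅(B' : g), Y⁆ = 0)
      (fun X hX => lie_of_mem_cartan B' hX)
      (fun α X hX => by rw [lie_of_mem_rootSpace hX, hB0, zero_smul])
      (fun X Y hX hY => by rw [lie_add, hX, hY, add_zero]) ⟨Y, hY⟩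
    exact congrArg Subtype.val this
  refine ⟨A, hA, ?_⟩
  rw [e, ← hB', hBc, smul_zero, add_zero]

theorem coe_image_parabolic {b : (rootSystem h).Base} {Θ : Finset h.root}
    (hΘ : Θ ⊆ b.support) {H : h}
    (hH : ∀ α ∈ b.support, (α ∈ Θ → (α : Weight ℂ h g) H = 0) ∧
      (α ∉ Θ → (α : Weight ℂ h g) H = piI)) :
    (fun X : g => (X : Mat N)) '' (parabolic b Θ : Set g) =
      ((⨆ n : ℕ, gradedPiece g piI ((H : g) : Mat N) n : Submodule ℂ (Mat N)) : Set (Mat N)) := by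
  rw [← map_parabolic_eq hΘ piI_ne_zero hH]
  rfl

omit [LieAlgebra.IsSemisimple ℂ g] in
theorem Ad_mem_iSup_gradedPiece (hG : IsConnectedComplexGroup G g) {H : Mat N} {a : GLN N}
    (ha : a ∈ G) (haH : Ad a H = H) {X : Mat N} (hX : X ∈ ⨆ n : ℕ, gradedPiece g piI H n) :
    Ad a X ∈ ⨆ n : ℕ, gradedPiece g piI H n := by
  induction hX using Submodule.iSup_induction' with
  | mem n X hX =>
    refine Submodule.mem_iSup_of_mem n ⟨hG.Ad_mem ha hX.1, ?_⟩
    nth_rewrite 1 [← haH]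
    rw [← Ad_lie, hX.2, Ad_smul]
  | zero => rw [Ad_zero]; exact Submodule.zero_mem _
  | add X Y _ _ hX hY => rw [Ad_add]; exact Submodule.add_mem _ hX hY

/-- The centralizer of `H` in `G` preserves the eigenspaces of `ad H`, hence is contained in the
parabolic subgroup. -/
theorem centralizer_mem_parabolicSubgroup (hG : IsConnectedComplexGroup G g)
    {b : (rootSystem h).Base} {Θ : Finset h.root} (hΘ : Θ ⊆ b.support) {H : h}
    (hH : ∀ α ∈ b.support, (α ∈ Θ → (α : Weight ℂ h g) H = 0) ∧
      (α ∉ Θ → (α : Weight ℂ h g) H = piI))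
    {a : GLN N} (ha : a ∈ G) (haH : Ad a ((H : g) : Mat N) = ((H : g) : Mat N)) :
    a ∈ parabolicSubgroup G b Θ := by
  refine ⟨ha, ?_⟩
  rw [coe_image_parabolic hΘ hH]
  intro X
  refine ⟨fun hX => ?_, fun hX => Ad_mem_iSup_gradedPiece hG ha haH hX⟩
  have haH' : Ad a⁻¹ ((H : g) : Mat N) = ((H : g) : Mat N) := by
    conv_lhs => rw [← haH]
    rw [Ad_inv_Ad]
  have := Ad_mem_iSup_gradedPiece hG (G.inv_mem ha) haH' hX
  rwa [Ad_inv_Ad] at this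

omit [LieAlgebra.IsSemisimple ℂ g] in
/-- The trace form vanishes on the nilradical `[H, p]` of the parabolic subalgebra `p`. -/
theorem trace_lie_mul_lie_of_mem {H X Y : Mat N}
    (hX : X ∈ ⨆ n : ℕ, gradedPiece g piI H n) (hY : Y ∈ ⨆ n : ℕ, gradedPiece g piI H n) :
    (⁅H, X⁆ * ⁅H, Y⁆).trace = 0 := by
  induction hX using Submodule.iSup_induction' with
  | mem m X hX =>
    induction hY using Submodule.iSup_induction' with
    | mem n Y hY =>
      rw [hX.2, hY.2, smul_mul_assoc, mul_smul_comm]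
      by_cases hmn : m = 0
      · simp [hmn]
      · have : ((m : ℤ) + (n : ℤ)) ≠ 0 := by omega
        rw [Matrix.trace_smul, Matrix.trace_smul, trace_mul_eq_zero piI_ne_zero this hX hY]
        simp
    | zero => simp
    | add Y Y' _ _ h1 h2 => rw [lie_add, mul_add, Matrix.trace_add, h1, h2, add_zero]
  | zero => simp
  | add X X' _ _ h1 h2 => rw [lie_add, add_mul, Matrix.trace_add, h1, h2, add_zero]

end Characteristic

end SymFlag

namespace SymFlag

variable {N : ℕ}

section Characteristic

open LieAlgebra LieAlgebra.IsKilling LieModule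

variable {G : Subgroup (GLN N)} {g : LieSubalgebra ℂ (Mat N)} [LieAlgebra.IsSemisimple ℂ g]
  {U : Subgroup (GLN N)} {u : LieSubalgebra ℝ (Mat N)}
  {h : LieSubalgebra ℂ g} [h.IsCartanSubalgebra]

/-- The elements of `u` fixed by the differential `T` of `τ` are those that commute with `H`. -/
theorem lie_eq_zero_iff_fixed (hG : IsConnectedComplexGroup G g) (hU : IsCompactRealForm G g U u)
    {R : GLN N} (hu : ∀ X ∈ u, hstar R X = -X)
    {b : (rootSystem h).Base} {Θ : Finset h.root} (hΘ : Θ ⊆ b.support) {H : h}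
    (hH : ∀ α ∈ b.support, (α ∈ Θ → (α : Weight ℂ h g) H = 0) ∧
      (α ∉ Θ → (α : Weight ℂ h g) H = piI)) (hHu : ((H : g) : Mat N) ∈ u)
    {τ : U ≃* U} (hτ : IsSymmetricSpace (isotropy G U b Θ) τ) {T : Mat N →ₗ[ℝ] Mat N}
    (hT : ∀ X (hX : X ∈ u), (τ ⟨expGL X, hU.lie.exp_mem hX⟩ : GLN N) = expGL (T X))
    {X : Mat N} (hX : X ∈ u) : ⁅((H : g) : Mat N), X⁆ = 0 ↔ T X = X := by
  set H' : Mat N := ((H : g) : Mat N) with hH'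
  have hexpU : ∀ s : ℝ, expGL (s • X) ∈ U := (hU.lie X).1 hX
  have hTs : ∀ s : ℝ, (τ ⟨expGL (s • X), hexpU s⟩ : GLN N) = expGL (s • T X) := fun s => by
    rw [hT _ (u.smul_mem s hX), map_smul]
  constructor
  · intro hHX
    refine expGL_smul_injective fun s => ?_
    rw [← hTs]
    have hXH : ⁅s • X, H'⁆ = 0 := by rw [smul_lie, ← lie_skew, hHX, neg_zero, smul_zero]
    have hmem : (⟨expGL (s • X), hexpU s⟩ : U) ∈ isotropy G U b Θ :=
      centralizer_mem_parabolicSubgroup hG hΘ hH (hU.le (hexpU s)) (Ad_expGL_of_lie_eq_zero hXH)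
    rw [hτ.le_fixed _ hmem]
  · intro hTX
    -- the curve `exp (s X)` lies in the identity component of the fixed-point group
    have hcurve : Set.range (fun s : ℝ => (⟨expGL (s • X), hexpU s⟩ : U)) ⊆
        connectedComponentIn {a : U | τ a = a} 1 := by
      refine IsPreconnected.subset_connectedComponentIn ?_ ?_ ?_
      · refine isPreconnected_range ?_
        exact (continuous_expGL.comp (by fun_prop)).subtype_mk _
      · exact ⟨0, by ext1; simp⟩
      · rintro _ ⟨s, rfl⟩
        refine Subtype.ext ?_
        rw [hTs, hTX]
    have hmemP : ∀ s : ℝ, expGL (s • X) ∈ parabolicSubgroup G b Θ := fun s =>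
      hτ.component_le (hcurve ⟨s, rfl⟩)
    have hHp : H' ∈ ⨆ n : ℕ, gradedPiece g piI H' n :=
      Submodule.mem_iSup_of_mem 0 (mem_gradedPiece_of_mem_cartan H.2)
    have hXHp : ⁅X, H'⁆ ∈ (⨆ n : ℕ, gradedPiece g piI H' n).restrictScalars ℝ := by
      have hder := hasDerivAt_Ad_exp X H' 0
      rw [zero_smul, expGL_zero, Ad_one] at hder
      refine mem_of_hasDerivAt hder fun s => ?_
      have := (hmemP s).2
      rw [coe_image_parabolic hΘ hH] at this
      exact (this H').2 hHp
    have hY : ⁅H', X⁆ ∈ ⨆ n : ℕ, gradedPiece g piI H' n := by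
      rw [← lie_skew]; exact Submodule.neg_mem _ hXHp
    have hYu : ⁅H', X⁆ ∈ u := u.lie_mem hHu hX
    have hHY : ⁅H', ⁅H', X⁆⁆ = 0 :=
      eq_zero_of_trace_mul_self (hu _ (u.lie_mem hHu hYu)) (trace_lie_mul_lie_of_mem hY hY)
    exact lie_eq_zero_of_lie_lie_eq_zero hu hHu hX hHY

/-- If the fixed elements in `u` of the involution `T` are those that commute with `H`, then `T` is
`-1` on `[H, u]`: the element `X + T X` is fixed, hence commutes with `H`. -/
theorem differential_eq_neg {R : GLN N} (hu : ∀ X ∈ u, hstar R X = -X) {H : Mat N} (hH : H ∈ u)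
    {T : Mat N →ₗ[ℝ] Mat N} (hTu : ∀ X ∈ u, T X ∈ u) (hTT : ∀ X ∈ u, T (T X) = X)
    (hlie : ∀ X ∈ u, ∀ Y ∈ u, T ⁅X, Y⁆ = ⁅T X, T Y⁆)
    (hfix : ∀ X ∈ u, ⁅H, X⁆ = 0 ↔ T X = X) {X : Mat N} (hX : X ∈ u) : T ⁅H, X⁆ = -⁅H, X⁆ := by
  have hTH : T H = H := (hfix H hH).1 (lie_self H)
  have hHX := u.lie_mem hH hX
  have h1 : T ⁅H, X⁆ = ⁅H, T X⁆ := by rw [hlie H hH X hX, hTH]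
  have h2 : ⁅H, ⁅H, X⁆ + T ⁅H, X⁆⁆ = 0 := by
    rw [hfix _ (u.add_mem hHX (hTu _ hHX)), map_add, hTT _ hHX, add_comm]
  rw [h1, ← lie_add] at h2
  have h3 := lie_eq_zero_of_lie_lie_eq_zero hu hH (u.add_mem hX (hTu X hX)) h2
  rw [lie_add, ← h1] at h3
  exact eq_neg_of_add_eq_zero_right h3

omit [LieAlgebra.IsSemisimple ℂ g] in
/-- The bracket of two elements of `[H, u]` is fixed by `T`, hence commutes with `H`; by complex
linearity, the same holds for `[H, g]`. -/
theorem lie_lie_lie_lie_eq_zero (hU : IsCompactRealForm G g U u) {H : Mat N} (hH : H ∈ u)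
    {T : Mat N →ₗ[ℝ] Mat N} (hlie : ∀ X ∈ u, ∀ Y ∈ u, T ⁅X, Y⁆ = ⁅T X, T Y⁆)
    (hfix : ∀ X ∈ u, ⁅H, X⁆ = 0 ↔ T X = X) (hneg : ∀ X ∈ u, T ⁅H, X⁆ = -⁅H, X⁆)
    {X Y : Mat N} (hX : X ∈ g) (hY : Y ∈ g) : ⁅H, ⁅⁅H, X⁆, ⁅H, Y⁆⁆⁆ = 0 := by
  have hu : ∀ X ∈ u, ∀ Y ∈ u, ⁅H, ⁅⁅H, X⁆, ⁅H, Y⁆⁆⁆ = 0 := by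
    intro X hX Y hY
    have h1 := u.lie_mem hH hX
    have h2 := u.lie_mem hH hY
    rw [hfix _ (u.lie_mem h1 h2), hlie _ h1 _ h2, hneg X hX, hneg Y hY, neg_lie, lie_neg, neg_neg]
  obtain ⟨A, hA, B, hB, rfl⟩ := (hU.span X).1 hX
  obtain ⟨A', hA', B', hB', rfl⟩ := (hU.span Y).1 hY
  simp only [lie_add, lie_smul, add_lie, smul_lie, hu A hA A' hA', hu A hA B' hB', hu B hB A' hA',
    hu B hB B' hB', smul_zero, add_zero]

/-- If the brackets of elements of `[H, g]` commute with `H`, then the roots take only the values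
`0` and `± π i` at `H`. -/
theorem cube_of_lie_eq_zero {b : (rootSystem h).Base} {Θ : Finset h.root} {H : h}
    (hH : ∀ α ∈ b.support, (α ∈ Θ → (α : Weight ℂ h g) H = 0) ∧
      (α ∉ Θ → (α : Weight ℂ h g) H = piI))
    (hbr : ∀ X Y : g, ⁅(H : g), ⁅⁅(H : g), X⁆, ⁅(H : g), Y⁆⁆⁆ = 0) (X : g) :
    ⁅(H : g), ⁅(H : g), ⁅(H : g), X⁆⁆⁆ = (piI * piI) • ⁅(H : g), X⁆ := by
  have hab : ∀ (α β : Weight ℂ h g) (X Y : g), X ∈ rootSpace h α → Y ∈ rootSpace h β →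
      α H ≠ 0 → β H ≠ 0 → α H + β H ≠ 0 → ⁅X, Y⁆ = 0 := by
    intro α β X Y hX hY hα hβ hαβ
    have h1 := hbr X Y
    have h2 : ⁅(H : g), ⁅X, Y⁆⁆ = (α H + β H) • ⁅X, Y⁆ := by
      rw [leibniz_lie, lie_of_mem_rootSpace hX, lie_of_mem_rootSpace hY, smul_lie, lie_smul,
        add_smul]
    rw [lie_of_mem_rootSpace hX, lie_of_mem_rootSpace hY, smul_lie, lie_smul, lie_smul, lie_smul,
      h2, smul_smul, smul_smul] at h1
    exact (smul_eq_zero.1 h1).resolve_left (mul_ne_zero (mul_ne_zero hα hβ) hαβ)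
  refine root_induction (h := h) (p := fun X : g => ⁅(H : g), ⁅(H : g), ⁅(H : g), X⁆⁆⁆ =
    (piI * piI) • ⁅(H : g), X⁆) (fun X hX => ?_) (fun α X hX => ?_) (fun X Y hX hY => ?_) X
  · simp [lie_of_mem_cartan H hX]
  · have hval : (α : Weight ℂ h g) H = 0 ∨ (α : Weight ℂ h g) H = piI ∨
        (α : Weight ℂ h g) H = -piI := by
      rcases RootPairing.Base.IsPos.or_neg b α with h1 | h1
      · rcases root_value_eq_zero_or piI_ne_zero hH hab h1 with h2 | h2
        · exact Or.inl h2
        · exact Or.inr (Or.inl h2)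
      · have hroot : (rootSystem h).root ((rootSystem h).reflectionPerm α α) =
            -(rootSystem h).root α := by
          rw [RootPairing.root_reflectionPerm, RootPairing.reflection_apply_self]
        have h3 : (((rootSystem h).reflectionPerm α α : h.root) : Weight ℂ h g) H =
            -((α : Weight ℂ h g) H) := LinearMap.congr_fun hroot H
        have h2 := root_value_eq_zero_or piI_ne_zero hH hab h1
        have h4 : -((α : Weight ℂ h g) H) = 0 ∨ -((α : Weight ℂ h g) H) = piI := by
          rw [← h3]; exact h2
        rcases h4 with h4 | h4
        · exact Or.inl (neg_eq_zero.1 h4)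
        · exact Or.inr (Or.inr (by rw [← h4, neg_neg]))
    simp only [lie_of_mem_rootSpace hX, lie_smul, smul_smul]
    congr 1
    rcases hval with h1 | h1 | h1 <;> rw [h1] <;> ring
  · simp only [lie_add, hX, hY, smul_add]

/-- The main structural consequence of the existence of the involution `τ`: the flag manifold comes
from an element `H` for which `ad H` has only the eigenvalues `0` and `± π i`, and `τ` is the
conjugation by `exp H`. -/
theorem exists_isSymmetricFlag (hG : IsConnectedComplexGroup G g)
    (hU : IsCompactRealForm G g U u) {t : LieSubalgebra ℝ u} (hth : IsComplexificationOf h t)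
    {b : (rootSystem h).Base} {Θ : Finset h.root} (hΘ : Θ ⊆ b.support)
    {τ : U ≃* U} (hτ : IsSymmetricSpace (isotropy G U b Θ) τ) :
    ∃ (H : h) (R : GLN N), (∃ A ∈ t, (A : Mat N) = ((H : g) : Mat N)) ∧
      (∀ α ∈ b.support, α ∈ Θ ↔ (α : Weight ℂ h g) H = 0) ∧
      IsSymmetricFlag G U (parabolicSubgroup G b Θ) g u ((H : g) : Mat N) R ∧
      ∀ a : U, (τ a : GLN N) = expGL ((H : g) : Mat N) * a * (expGL ((H : g) : Mat N))⁻¹ := by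
  classical
  obtain ⟨R, hR⟩ := exists_unitary_conj hU.compact
  have hu : ∀ X ∈ u, hstar R X = -X := fun X hX => hstar_eq_neg R hR ((hU.lie X).1 hX)
  obtain ⟨H, hHv⟩ := exists_root_eq b fun α => if α ∈ Θ then 0 else piI
  have hH : ∀ α ∈ b.support, (α ∈ Θ → (α : Weight ℂ h g) H = 0) ∧
      (α ∉ Θ → (α : Weight ℂ h g) H = piI) := fun α hα =>
    ⟨fun h1 => by rw [hHv α hα, if_pos h1], fun h1 => by rw [hHv α hα, if_neg h1]⟩
  have hre : ∀ α : h.root, b.IsPos α → ((α : Weight ℂ h g) H).re = 0 := fun α hα => by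
    obtain ⟨n, hn, -⟩ := root_value_of_isPos hH hα
    rw [hn, piI]
    simp
  have him : ∀ α : h.root, ((α : Weight ℂ h g) H).re = 0 := by
    intro α
    rcases RootPairing.Base.IsPos.or_neg b α with h1 | h1
    · exact hre α h1
    · have hroot : (rootSystem h).root ((rootSystem h).reflectionPerm α α) =
          -(rootSystem h).root α := by
        rw [RootPairing.root_reflectionPerm, RootPairing.reflection_apply_self]
      have h3 : (((rootSystem h).reflectionPerm α α : h.root) : Weight ℂ h g) H =
          -((α : Weight ℂ h g) H) := LinearMap.congr_fun hroot H
      have h4 := hre _ h1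
      have h5 : (-((α : Weight ℂ h g) H)).re = 0 := by rw [← h3]; exact h4
      simpa using h5
  obtain ⟨A, hAt, hA⟩ := exists_mem_of_root_imaginary hU hu hth him
  have hHu : ((H : g) : Mat N) ∈ u := by rw [← hA]; exact A.2
  obtain ⟨T, hTu, hTexp, hTlie⟩ := exists_differential hU.lie τ.toMonoidHom hτ.continuous
  have hTexp' : ∀ X (hX : X ∈ u),
      (τ ⟨expGL X, hU.lie.exp_mem hX⟩ : GLN N) = expGL (T X) := hTexp
  have hTT : ∀ X ∈ u, T (T X) = X := by
    intro X hX
    refine expGL_smul_injective fun s => ?_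
    have hsX := u.smul_mem s hX
    have e1 := hTexp' _ hsX
    have e2 := hTexp' _ (hTu _ hsX)
    have e3 : τ ⟨expGL (s • X), hU.lie.exp_mem hsX⟩ =
        ⟨expGL (T (s • X)), hU.lie.exp_mem (hTu _ hsX)⟩ := Subtype.ext e1
    rw [← e3, hτ.involutive] at e2
    rw [← map_smul, ← map_smul, ← e2]
  have hfix : ∀ X ∈ u, ⁅((H : g) : Mat N), X⁆ = 0 ↔ T X = X := fun X hX =>
    lie_eq_zero_iff_fixed hG hU hu hΘ hH hHu hτ hTexp' hX
  have hneg : ∀ X ∈ u, T ⁅((H : g) : Mat N), X⁆ = -⁅((H : g) : Mat N), X⁆ := fun X hX =>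
    differential_eq_neg hu hHu hTu hTT hTlie hfix hX
  have hcube : ∀ X ∈ g, ⁅((H : g) : Mat N), ⁅((H : g) : Mat N), ⁅((H : g) : Mat N), X⁆⁆⁆ =
      (piI * piI) • ⁅((H : g) : Mat N), X⁆ := by
    intro X hX
    have := cube_of_lie_eq_zero hH (fun Y Z => Subtype.ext
      (lie_lie_lie_lie_eq_zero hU hHu hTlie hfix hneg Y.2 Z.2)) ⟨X, hX⟩
    exact congrArg Subtype.val this
  have hPset : (fun X : g => (X : Mat N)) '' (parabolic b Θ : Set g) =
      nonnegPart g ((H : g) : Mat N) := by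
    rw [coe_image_parabolic hΘ hH]
    ext X
    exact (mem_nonnegPart_iff_of_cube (H : g).2 hcube X).symm
  refine ⟨H, R, ⟨A, hAt, hA⟩, fun α hα => ⟨(hH α hα).1, fun h1 => ?_⟩,
    ⟨hG, hU, fun X hX => eq_zero_of_forall_lie_eq_zero hX, hR, hHu, hcube, fun a => ?_⟩, ?_⟩
  · by_contra h2
    exact piI_ne_zero (((hH α hα).2 h2).symm.trans h1)
  · rw [parabolicSubgroup, hPset]
    rfl
  · -- both sides are automorphisms of the connected group `U` with the same differential
    let e : U := ⟨expGL ((H : g) : Mat N), hU.lie.exp_mem hHu⟩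
    have hle : U ≤ (MonoidHom.eqLocus τ.toMonoidHom (MulAut.conj e).toMonoidHom).map U.subtype := by
      refine le_of_exp_mem hU.compact.isClosed hU.connected hU.lie fun X hX => ?_
      refine ⟨⟨expGL X, hU.lie.exp_mem hX⟩, ?_, rfl⟩
      refine Subtype.ext ?_
      change (τ ⟨expGL X, hU.lie.exp_mem hX⟩ : GLN N) =
        expGL ((H : g) : Mat N) * expGL X * (expGL ((H : g) : Mat N))⁻¹
      rw [hTexp' X hX, ← expGL_Ad]
      congr 1
      set H' : Mat N := ((H : g) : Mat N)
      have hc := hcube X (hU.mem_of_mem hX)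
      have hpi : (Real.pi ^ 2 : ℝ) ≠ 0 := by positivity
      have hc' : ⁅H', ⁅H', ⁅H', X⁆⁆⁆ = (-(Real.pi ^ 2) : ℝ) • ⁅H', X⁆ := by
        rw [hc, piI_mul_self]; rfl
      -- the components of `X` in the centralizer of `H` and in `[H, u]`
      let W : Mat N := (-(Real.pi ^ 2) : ℝ)⁻¹ • ⁅H', X⁆
      have hW : W ∈ u := u.smul_mem _ (u.lie_mem hHu hX)
      have hHW : ⁅H', ⁅H', W⁆⁆ = ⁅H', X⁆ := by
        rw [lie_smul, lie_smul, hc', smul_smul, inv_mul_cancel₀ (neg_ne_zero.2 hpi), one_smul]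
      have h0 : ⁅H', X - ⁅H', W⁆⁆ = 0 := by rw [lie_sub, hHW, sub_self]
      have hX0 : X - ⁅H', W⁆ ∈ u := u.sub_mem hX (u.lie_mem hHu hW)
      have hd : X = (X - ⁅H', W⁆) + ⁅H', W⁆ := by abel
      rw [hd, map_add, (hfix _ hX0).1 h0, hneg W hW, Ad_add, Ad_expGL_of_lie_eq_zero h0,
        Ad_expGL_of_lie_lie (hcube W (hU.mem_of_mem hW))]
    intro a
    obtain ⟨a', ha', e'⟩ := hle a.2
    have : a' = a := Subtype.ext e'
    rw [this] at ha'
    exact congrArg Subtype.val ha'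

end Characteristic

end SymFlag

namespace SymFlag

variable {N : ℕ}

/-! ### The three-term grading -/

/-- The projection of `g` onto the eigenspace of `ad H` for `π i` (along the eigenspaces for `0`
and `-π i`), as a polynomial in `ad H`. -/
noncomputable def projPos (H : Mat N) : Mat N →ₗ[ℂ] Mat N :=
  (2 : ℂ)⁻¹ • ((piI⁻¹ • LieAlgebra.ad ℂ (Mat N) H) * (piI⁻¹ • LieAlgebra.ad ℂ (Mat N) H) +
    piI⁻¹ • LieAlgebra.ad ℂ (Mat N) H)

/-- The projection of `g` onto the eigenspace of `ad H` for `-π i`, as a polynomial in `ad H`. -/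
noncomputable def projNeg (H : Mat N) : Mat N →ₗ[ℂ] Mat N :=
  (2 : ℂ)⁻¹ • ((piI⁻¹ • LieAlgebra.ad ℂ (Mat N) H) * (piI⁻¹ • LieAlgebra.ad ℂ (Mat N) H) -
    piI⁻¹ • LieAlgebra.ad ℂ (Mat N) H)

/-- The projection of `g` onto the centralizer of `H`, as a polynomial in `ad H`. -/
noncomputable def projZero (H : Mat N) : Mat N →ₗ[ℂ] Mat N :=
  1 - (piI⁻¹ • LieAlgebra.ad ℂ (Mat N) H) * (piI⁻¹ • LieAlgebra.ad ℂ (Mat N) H)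

theorem projPos_apply (H X : Mat N) : projPos H X =
    (2 : ℂ)⁻¹ • (piI⁻¹ • ⁅H, piI⁻¹ • ⁅H, X⁆⁆ + piI⁻¹ • ⁅H, X⁆) := rfl

theorem projNeg_apply (H X : Mat N) : projNeg H X =
    (2 : ℂ)⁻¹ • (piI⁻¹ • ⁅H, piI⁻¹ • ⁅H, X⁆⁆ - piI⁻¹ • ⁅H, X⁆) := rfl

theorem projZero_apply (H X : Mat N) : projZero H X = X - piI⁻¹ • ⁅H, piI⁻¹ • ⁅H, X⁆⁆ := rfl

theorem projNeg_add_projZero_add_projPos (H X : Mat N) :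
    projNeg H X + projZero H X + projPos H X = X := by
  rw [projNeg_apply, projZero_apply, projPos_apply]
  module

theorem projPos_of_mem {g : LieSubalgebra ℂ (Mat N)} {H X : Mat N} {k : ℤ}
    (hX : X ∈ gradedPiece g piI H k) : projPos H X = ((2 : ℂ)⁻¹ * (k * k + k)) • X := by
  have hp := piI_ne_zero
  rw [projPos_apply, hX.2]
  simp only [lie_smul, hX.2, smul_smul, ← add_smul]
  congr 1
  field_simp

theorem projNeg_of_mem {g : LieSubalgebra ℂ (Mat N)} {H X : Mat N} {k : ℤ}
    (hX : X ∈ gradedPiece g piI H k) : projNeg H X = ((2 : ℂ)⁻¹ * (k * k - k)) • X := by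
  have hp := piI_ne_zero
  rw [projNeg_apply, hX.2]
  simp only [lie_smul, hX.2, smul_smul, ← sub_smul]
  congr 1
  field_simp

theorem projZero_of_mem {g : LieSubalgebra ℂ (Mat N)} {H X : Mat N} {k : ℤ}
    (hX : X ∈ gradedPiece g piI H k) : projZero H X = (1 - (k * k : ℂ)) • X := by
  have hp := piI_ne_zero
  rw [projZero_apply, hX.2]
  simp only [lie_smul, hX.2, smul_smul, sub_smul, one_smul]
  congr 2
  field_simp

theorem Ad_mem_gradedPiece {G : Subgroup (GLN N)} {g : LieSubalgebra ℂ (Mat N)}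
    (hG : IsConnectedComplexGroup G g) {H : Mat N} {a : GLN N}
    (ha : a ∈ G) (haH : Ad a H = H) {k : ℤ} {X : Mat N} (hX : X ∈ gradedPiece g piI H k) :
    Ad a X ∈ gradedPiece g piI H k := by
  refine ⟨hG.Ad_mem ha hX.1, ?_⟩
  nth_rewrite 1 [← haH]
  rw [← Ad_lie, hX.2, Ad_smul]

namespace IsSymmetricFlag

variable {G U P : Subgroup (GLN N)} {g : LieSubalgebra ℂ (Mat N)}
  {u : LieSubalgebra ℝ (Mat N)} {H : Mat N} {R : GLN N}

theorem mem_g (hF : IsSymmetricFlag G U P g u H R) : H ∈ g := hF.groupU.mem_of_mem hF.mem_u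

theorem hstar_of_mem (hF : IsSymmetricFlag G U P g u H R) {X : Mat N} (hX : X ∈ u) :
    hstar R X = -X := hstar_eq_neg R hF.unitary ((hF.groupU.lie X).1 hX)

theorem hstar_mem (hF : IsSymmetricFlag G U P g u H R) {X : Mat N} (hX : X ∈ g) :
    hstar R X ∈ g := by
  obtain ⟨A, hA, B, hB, rfl⟩ := (hF.groupU.span X).1 hX
  rw [hstar_add, hstar_smul, hF.hstar_of_mem hA, hF.hstar_of_mem hB]
  exact g.add_mem (g.neg_mem (hF.groupU.mem_of_mem hA))
    (g.smul_mem _ (g.neg_mem (hF.groupU.mem_of_mem hB)))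

theorem mem_u_of_hstar (hF : IsSymmetricFlag G U P g u H R) {X : Mat N} (hX : X ∈ g)
    (h : hstar R X = -X) : X ∈ u := by
  obtain ⟨A, hA, B, hB, rfl⟩ := (hF.groupU.span X).1 hX
  rw [hstar_add, hstar_smul, hF.hstar_of_mem hA, hF.hstar_of_mem hB, Complex.conj_I, neg_smul,
    smul_neg, neg_neg, neg_add] at h
  have h1 : Complex.I • B = -(Complex.I • B) := add_left_cancel h
  have h2 : Complex.I • B = 0 := by
    have : (2 : ℂ) • (Complex.I • B) = 0 := by
      rw [two_smul]; nth_rewrite 1 [h1]; exact neg_add_cancel _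
    exact (smul_eq_zero.1 this).resolve_left two_ne_zero
  rw [h2, add_zero]
  exact hA

theorem hstar_mem_gradedPiece (hF : IsSymmetricFlag G U P g u H R) {k : ℤ} {X : Mat N}
    (hX : X ∈ gradedPiece g piI H k) : hstar R X ∈ gradedPiece g piI H (-k) := by
  refine ⟨hF.hstar_mem hX.1, ?_⟩
  have h1 : ⁅H, hstar R X⁆ = hstar R ⁅H, X⁆ := by
    rw [hstar_lie, hF.hstar_of_mem hF.mem_u, lie_neg, lie_skew]
  rw [h1, hX.2, hstar_smul]
  congr 1
  simp [piI]

theorem eq_zero_of_mem_gradedPiece (hF : IsSymmetricFlag G U P g u H R) {k : ℤ}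
    (hk : k * k * k ≠ k) {X : Mat N} (hX : X ∈ gradedPiece g piI H k) : X = 0 := by
  have h := hF.cube X hX.1
  simp only [hX.2, lie_smul, smul_smul] at h
  rw [← sub_eq_zero, ← sub_smul] at h
  refine (smul_eq_zero.1 h).resolve_left ?_
  have e : (k : ℂ) * piI * (k * piI) * (k * piI) - piI * piI * (k * piI) =
      ((k * k * k - k : ℤ) : ℂ) * (piI * piI * piI) := by push_cast; ring
  rw [e]
  refine mul_ne_zero (by exact_mod_cast sub_ne_zero.2 hk) ?_
  simp [piI_ne_zero]

theorem projPos_mem (hF : IsSymmetricFlag G U P g u H R) {X : Mat N} (hX : X ∈ g) :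
    projPos H X ∈ gradedPiece g piI H 1 := by
  have h1 := g.lie_mem hF.mem_g hX
  have h2 := g.lie_mem hF.mem_g h1
  rw [projPos_apply]
  refine ⟨?_, ?_⟩
  · rw [lie_smul]
    exact g.smul_mem _ (g.add_mem (g.smul_mem _ (g.smul_mem _ h2)) (g.smul_mem _ h1))
  · simp only [lie_smul, lie_add, hF.cube X hX, smul_smul, smul_add]
    have hp := piI_ne_zero
    rw [add_comm]
    congr 2 <;> push_cast <;> field_simp

theorem projNeg_mem (hF : IsSymmetricFlag G U P g u H R) {X : Mat N} (hX : X ∈ g) :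
    projNeg H X ∈ gradedPiece g piI H (-1) := by
  have h1 := g.lie_mem hF.mem_g hX
  have h2 := g.lie_mem hF.mem_g h1
  rw [projNeg_apply]
  refine ⟨?_, ?_⟩
  · rw [lie_smul]
    exact g.smul_mem _ (g.sub_mem (g.smul_mem _ (g.smul_mem _ h2)) (g.smul_mem _ h1))
  · simp only [lie_smul, lie_sub, hF.cube X hX, smul_smul, smul_sub]
    have hp := piI_ne_zero
    rw [← neg_sub, ← neg_sub, neg_neg, sub_eq_add_neg, sub_eq_add_neg, ← neg_smul, ← neg_smul]
    rw [add_comm]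
    congr 2 <;> push_cast <;> field_simp

theorem projZero_mem (hF : IsSymmetricFlag G U P g u H R) {X : Mat N} (hX : X ∈ g) :
    projZero H X ∈ gradedPiece g piI H 0 := by
  have h1 := g.lie_mem hF.mem_g hX
  have h2 := g.lie_mem hF.mem_g h1
  rw [projZero_apply]
  refine ⟨?_, ?_⟩
  · rw [lie_smul]
    exact g.sub_mem hX (g.smul_mem _ (g.smul_mem _ h2))
  · simp only [lie_smul, lie_sub, hF.cube X hX, smul_smul]
    have hp := piI_ne_zero
    have : piI⁻¹ * (piI⁻¹ * (piI * piI)) = 1 := by field_simp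
    simp [this, mul_assoc]

theorem lie_eq_zero_of_pos (hF : IsSymmetricFlag G U P g u H R) {X Y : Mat N}
    (hX : X ∈ gradedPiece g piI H 1) (hY : Y ∈ gradedPiece g piI H 1) : ⁅X, Y⁆ = 0 :=
  hF.eq_zero_of_mem_gradedPiece (by norm_num) (lie_mem_gradedPiece hX hY)

theorem lie_eq_zero_of_neg (hF : IsSymmetricFlag G U P g u H R) {X Y : Mat N}
    (hX : X ∈ gradedPiece g piI H (-1)) (hY : Y ∈ gradedPiece g piI H (-1)) : ⁅X, Y⁆ = 0 :=
  hF.eq_zero_of_mem_gradedPiece (by norm_num) (lie_mem_gradedPiece hX hY)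

/-- The trace form pairs the eigenspaces for `± π i` nondegenerately. -/
theorem eq_zero_of_trace (hF : IsSymmetricFlag G U P g u H R) {k : ℤ} {X : Mat N}
    (hX : X ∈ gradedPiece g piI H k)
    (h : ∀ Y ∈ gradedPiece g piI H (-k), ((X * Y).trace).re = 0) : X = 0 := by
  by_contra hne
  exact (trace_mul_hstar_pos R hne).ne' (h _ (hF.hstar_mem_gradedPiece hX))

/-- The Lie algebra `u` meets the nilradicals in `0`, because they are isotropic for the trace form.
-/
theorem eq_zero_of_mem_u (_hF : IsSymmetricFlag G U P g u H R) {k : ℤ} (hk : k ≠ 0) {X : Mat N}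
    (hX : X ∈ gradedPiece g piI H k) (hXu : hstar R X = -X) : X = 0 :=
  eq_zero_of_trace_mul_self hXu
    (trace_mul_eq_zero piI_ne_zero (by omega) hX hX)

theorem mem_nonnegPart_iff (_hF : IsSymmetricFlag G U P g u H R) {X : Mat N} :
    X ∈ nonnegPart g H ↔ X ∈ g ∧ projNeg H X = 0 := by
  refine and_congr_right fun _ => ?_
  have hp := piI_ne_zero
  rw [projNeg_apply, smul_eq_zero, or_iff_right (by norm_num), sub_eq_zero, lie_smul]
  constructor
  · intro h
    rw [h, smul_smul, smul_smul]
    congr 1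
    field_simp
  · intro h
    have := congrArg (fun Y => (piI * piI) • Y) h
    simp only [smul_smul] at this
    have e1 : piI * piI * (piI⁻¹ * piI⁻¹) = 1 := by field_simp
    have e2 : piI * piI * piI⁻¹ = piI := by field_simp
    rwa [← mul_assoc, mul_assoc (piI * piI), e1, e2, one_smul] at this

theorem mem_nonnegPart_of_mem (hF : IsSymmetricFlag G U P g u H R) {k : ℤ} (hk : k = 0 ∨ k = 1)
    {X : Mat N} (hX : X ∈ gradedPiece g piI H k) : X ∈ nonnegPart g H := by
  rw [hF.mem_nonnegPart_iff]
  refine ⟨hX.1, ?_⟩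
  rw [projNeg_of_mem hX]
  rcases hk with rfl | rfl <;> simp

theorem eq_add_of_mem_nonnegPart (hF : IsSymmetricFlag G U P g u H R) {X : Mat N}
    (hX : X ∈ nonnegPart g H) : X = projZero H X + projPos H X := by
  have := projNeg_add_projZero_add_projPos H X
  rw [(hF.mem_nonnegPart_iff.1 hX).2, zero_add] at this
  exact this.symm

/-- `nonnegPart` as a real subspace. -/
def nonnegSubmodule (hF : IsSymmetricFlag G U P g u H R) : Submodule ℝ (Mat N) where
  carrier := nonnegPart g H
  add_mem' := by
    intro X Y hX hY
    rw [hF.mem_nonnegPart_iff] at *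
    exact ⟨g.add_mem hX.1 hY.1, by rw [map_add, hX.2, hY.2, add_zero]⟩
  zero_mem' := by
    rw [hF.mem_nonnegPart_iff]
    exact ⟨g.zero_mem, map_zero _⟩
  smul_mem' := by
    intro s X hX
    rw [hF.mem_nonnegPart_iff] at *
    have e : s • X = (s : ℂ) • X := rfl
    exact ⟨by rw [e]; exact g.smul_mem _ hX.1, by rw [e, map_smul, hX.2, smul_zero]⟩

theorem trace_eq_zero_of_pos_of_nonneg (hF : IsSymmetricFlag G U P g u H R) {X Y : Mat N}
    (hX : X ∈ gradedPiece g piI H 1) (hY : Y ∈ nonnegPart g H) : (X * Y).trace = 0 := by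
  rw [hF.eq_add_of_mem_nonnegPart hY, mul_add, Matrix.trace_add,
    trace_mul_eq_zero piI_ne_zero (by norm_num) hX (hF.projZero_mem hY.1),
    trace_mul_eq_zero piI_ne_zero (by norm_num) hX (hF.projPos_mem hY.1), add_zero]

/-! ### The parabolic subgroup -/

theorem Ad_nonneg (hF : IsSymmetricFlag G U P g u H R) {p : GLN N} (hp : p ∈ P) {X : Mat N}
    (hX : X ∈ nonnegPart g H) : Ad p X ∈ nonnegPart g H :=
  (((hF.mem_P p).1 hp).2 X).2 hX

/-- The parabolic subgroup preserves the nilradical, because the latter is the orthogonal of the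
parabolic subalgebra for the trace form. -/
theorem Ad_pos (hF : IsSymmetricFlag G U P g u H R) {p : GLN N} (hp : p ∈ P) {X : Mat N}
    (hX : X ∈ gradedPiece g piI H 1) : Ad p X ∈ gradedPiece g piI H 1 := by
  have hZ := hF.Ad_nonneg hp (hF.mem_nonnegPart_of_mem (Or.inr rfl) hX)
  set Z := Ad p X
  have h0 := hF.projZero_mem hZ.1
  have hs : hstar R (projZero H Z) ∈ gradedPiece g piI H 0 := by
    simpa using hF.hstar_mem_gradedPiece h0
  have h1 : (Z * hstar R (projZero H Z)).trace = 0 := by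
    have h2 := trace_Ad_mul_Ad p X (Ad p⁻¹ (hstar R (projZero H Z)))
    rw [Ad_Ad_inv] at h2
    rw [h2]
    exact hF.trace_eq_zero_of_pos_of_nonneg hX
      (hF.Ad_nonneg (P.inv_mem hp) (hF.mem_nonnegPart_of_mem (Or.inl rfl) hs))
  have hd := hF.eq_add_of_mem_nonnegPart hZ
  rw [hd, add_mul, Matrix.trace_add, ← hd,
    trace_mul_eq_zero piI_ne_zero (by norm_num) (hF.projPos_mem hZ.1) hs, add_zero] at h1
  have h3 : projZero H Z = 0 := by
    by_contra hne
    have := trace_mul_hstar_pos R hne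
    rw [h1] at this
    simp at this
  rw [hd, h3, zero_add]
  exact hF.projPos_mem hZ.1

theorem mem_P_of_centralizer (hF : IsSymmetricFlag G U P g u H R) {a : GLN N} (ha : a ∈ G)
    (haH : Ad a H = H) : a ∈ P := by
  rw [hF.mem_P]
  have key : ∀ a ∈ G, Ad a H = H → ∀ X ∈ nonnegPart g H, Ad a X ∈ nonnegPart g H := by
    rintro a ha haH X ⟨hX, hX'⟩
    refine ⟨hF.groupG.Ad_mem ha hX, ?_⟩
    have e : ∀ Y, ⁅H, Ad a Y⁆ = Ad a ⁅H, Y⁆ := fun Y => by rw [Ad_lie, haH]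
    rw [e, e, hX', Ad_smul]
  refine ⟨ha, fun X => ⟨fun hX => ?_, key a ha haH X⟩⟩
  have haH' : Ad a⁻¹ H = H := by
    conv_lhs => rw [← haH]
    rw [Ad_inv_Ad]
  have := key _ (G.inv_mem ha) haH' _ hX
  rwa [Ad_inv_Ad] at this

theorem lie_lie_lie_eq_zero (hF : IsSymmetricFlag G U P g u H R) {k : ℤ} (hk : k = 1 ∨ k = -1)
    {X : Mat N} (hX : X ∈ gradedPiece g piI H k) {Y : Mat N} (hY : Y ∈ g) :
    ⁅X, ⁅X, ⁅X, Y⁆⁆⁆ = 0 := by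
  have key : ∀ j : ℤ, j = -1 ∨ j = 0 ∨ j = 1 → ∀ Z ∈ gradedPiece g piI H j,
      ⁅X, ⁅X, ⁅X, Z⁆⁆⁆ = 0 := by
    intro j hj Z hZ
    refine hF.eq_zero_of_mem_gradedPiece ?_
      (lie_mem_gradedPiece hX (lie_mem_gradedPiece hX (lie_mem_gradedPiece hX hZ)))
    rcases hk with rfl | rfl <;> rcases hj with rfl | rfl | rfl <;> norm_num
  have hd := projNeg_add_projZero_add_projPos H Y
  rw [← hd]
  simp only [lie_add]
  rw [key _ (by simp) _ (hF.projNeg_mem hY), key _ (by simp) _ (hF.projZero_mem hY),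
    key _ (by simp) _ (hF.projPos_mem hY), add_zero, add_zero]

theorem Ad_exp_pos (hF : IsSymmetricFlag G U P g u H R) {X : Mat N}
    (hX : X ∈ gradedPiece g piI H 1) {Y : Mat N} (hY : Y ∈ g) :
    Ad (expGL X) Y = Y + ⁅X, Y⁆ + (2⁻¹ : ℝ) • ⁅X, ⁅X, Y⁆⁆ := by
  exact Ad_expGL_of_lie_lie_lie (hF.lie_lie_lie_eq_zero (Or.inl rfl) hX hY)

theorem Ad_exp_neg (hF : IsSymmetricFlag G U P g u H R) {X : Mat N}
    (hX : X ∈ gradedPiece g piI H (-1)) {Y : Mat N} (hY : Y ∈ g) :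
    Ad (expGL X) Y = Y + ⁅X, Y⁆ + (2⁻¹ : ℝ) • ⁅X, ⁅X, Y⁆⁆ := by
  exact Ad_expGL_of_lie_lie_lie (hF.lie_lie_lie_eq_zero (Or.inr rfl) hX hY)

theorem Ad_exp_pos_H (hF : IsSymmetricFlag G U P g u H R) {X : Mat N}
    (hX : X ∈ gradedPiece g piI H 1) : Ad (expGL X) H = H - piI • X := by
  have h1 : ⁅X, H⁆ = -(piI • X) := by
    rw [← lie_skew, hX.2]
    simp
  rw [hF.Ad_exp_pos hX hF.mem_g, h1, lie_neg, lie_smul, lie_self]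
  simp [sub_eq_add_neg]

theorem Ad_exp_neg_H (hF : IsSymmetricFlag G U P g u H R) {X : Mat N}
    (hX : X ∈ gradedPiece g piI H (-1)) : Ad (expGL X) H = H + piI • X := by
  have h1 : ⁅X, H⁆ = piI • X := by
    rw [← lie_skew, hX.2]
    simp
  rw [hF.Ad_exp_neg hX hF.mem_g, h1, lie_smul, lie_self]
  simp

theorem exp_mem_G (hF : IsSymmetricFlag G U P g u H R) {X : Mat N} (hX : X ∈ g) : expGL X ∈ G :=
  hF.groupG.lie.exp_mem (X := X) hX

/-- The parabolic subgroup moves `H` by elements of the nilradical: the difference `E` to `H` acts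
on the parabolic subalgebra and on its quotients in such a way that the component of `E` in the
centralizer of `H` is central in `g`. -/
theorem Ad_H_sub_mem (hF : IsSymmetricFlag G U P g u H R) {p : GLN N} (hp : p ∈ P) :
    Ad p H - H ∈ gradedPiece g piI H 1 := by
  have hpG := ((hF.mem_P p).1 hp).1
  have hH0 : H ∈ gradedPiece g piI H 0 := ⟨hF.mem_g, by simp⟩
  have hEg : Ad p H - H ∈ g := g.sub_mem (hF.groupG.Ad_mem hpG hF.mem_g) hF.mem_g
  have hEp : Ad p H - H ∈ nonnegPart g H := by
    have h1 := hF.mem_nonnegPart_of_mem (Or.inl rfl) hH0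
    exact hF.nonnegSubmodule.sub_mem (hF.Ad_nonneg hp h1) h1
  set E := Ad p H - H with hE
  have hdec := hF.eq_add_of_mem_nonnegPart hEp
  have hE0 := hF.projZero_mem hEg
  have hE1 := hF.projPos_mem hEg
  have hback : ∀ Y, Ad p (Ad p⁻¹ Y) = Y := Ad_Ad_inv p
  have hlie : ∀ Y, ⁅E, Y⁆ = Ad p ⁅H, Ad p⁻¹ Y⁆ - ⁅H, Y⁆ := fun Y => by
    rw [hE, sub_lie, Ad_lie, hback]
  have hHnn : ∀ Y ∈ nonnegPart g H, ⁅H, Y⁆ ∈ gradedPiece g piI H 1 := by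
    intro Y hY
    rw [hF.eq_add_of_mem_nonnegPart hY, lie_add, (hF.projZero_mem hY.1).2,
      (hF.projPos_mem hY.1).2]
    simpa using Submodule.smul_mem _ _ (hF.projPos_mem hY.1)
  -- `[E, p] ⊆ n`, `[E, n] = 0` and `[E, g] ⊆ p`
  have h1 : ∀ Y ∈ nonnegPart g H, ⁅E, Y⁆ ∈ gradedPiece g piI H 1 := by
    intro Y hY
    rw [hlie]
    exact Submodule.sub_mem _ (hF.Ad_pos hp (hHnn _ (hF.Ad_nonneg (P.inv_mem hp) hY))) (hHnn _ hY)
  have h2 : ∀ Y ∈ gradedPiece g piI H 1, ⁅E, Y⁆ = 0 := by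
    intro Y hY
    rw [hlie, (hF.Ad_pos (P.inv_mem hp) hY).2, hY.2, Ad_smul, hback, sub_self]
  have h3 : ∀ Y ∈ gradedPiece g piI H (-1), ⁅E, Y⁆ ∈ nonnegPart g H := by
    intro Y hY
    have hY' : Ad p⁻¹ Y ∈ g := hF.groupG.Ad_mem (G.inv_mem hpG) hY.1
    set W := Ad p⁻¹ Y with hW
    -- modulo `p`, the operator `ad H` is the multiplication by `-π i`
    have hmod : ⁅H, W⁆ + piI • W ∈ nonnegPart g H := by
      rw [hF.mem_nonnegPart_iff]
      refine ⟨g.add_mem (g.lie_mem hF.mem_g hY') (g.smul_mem _ hY'), ?_⟩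
      have hd := projNeg_add_projZero_add_projPos H W
      have ha := hF.projNeg_mem hY'
      have hb := hF.projZero_mem hY'
      have hc := hF.projPos_mem hY'
      rw [← hd]
      simp only [lie_add, map_add, smul_add, map_smul, ha.2, hb.2, hc.2, projNeg_of_mem ha,
        projNeg_of_mem hb, projNeg_of_mem hc]
      push_cast
      module
    have e : ⁅E, Y⁆ = Ad p (⁅H, W⁆ + piI • W) := by
      rw [hlie, Ad_add, Ad_smul, hW, hback, hY.2]
      push_cast
      module
    rw [e]
    exact hF.Ad_nonneg hp hmod
  have hc0 : projZero H E = 0 := by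
    refine hF.center _ hE0.1 fun Y hY => ?_
    have e : projZero H E = E - projPos H E := eq_sub_of_add_eq hdec.symm
    have ha := hF.projNeg_mem hY
    have hb := hF.projZero_mem hY
    have hc := hF.projPos_mem hY
    rw [← projNeg_add_projZero_add_projPos H Y, lie_add, lie_add]
    have z1 : ⁅projZero H E, projPos H Y⁆ = 0 := by
      rw [e, sub_lie, h2 _ hc, hF.lie_eq_zero_of_pos hE1 hc, sub_self]
    have z2 : ⁅projZero H E, projZero H Y⁆ = 0 := by
      have m1 : ⁅projZero H E, projZero H Y⁆ ∈ gradedPiece g piI H 1 := by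
        rw [e, sub_lie]
        refine Submodule.sub_mem _ (h1 _ (hF.mem_nonnegPart_of_mem (Or.inl rfl) hb)) ?_
        simpa using lie_mem_gradedPiece hE1 hb
      have m2 : ⁅projZero H E, projZero H Y⁆ ∈ gradedPiece g piI H 0 := by
        simpa using lie_mem_gradedPiece hE0 hb
      have t1 := projPos_of_mem m1
      have t2 := projPos_of_mem m2
      rw [t1] at t2
      simpa using t2
    have z3 : ⁅projZero H E, projNeg H Y⁆ = 0 := by
      have m1 : ⁅projZero H E, projNeg H Y⁆ ∈ nonnegPart g H := by
        rw [e, sub_lie]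
        refine hF.nonnegSubmodule.sub_mem (h3 _ ha) ?_
        exact hF.mem_nonnegPart_of_mem (Or.inl (by norm_num)) (lie_mem_gradedPiece hE1 ha)
      have m2 : ⁅projZero H E, projNeg H Y⁆ ∈ gradedPiece g piI H (-1) := by
        simpa using lie_mem_gradedPiece hE0 ha
      have t2 := projNeg_of_mem m2
      rw [(hF.mem_nonnegPart_iff.1 m1).2] at t2
      have t3 : ((2 : ℂ)⁻¹ * (((-1 : ℤ) : ℂ) * ((-1 : ℤ) : ℂ) - ((-1 : ℤ) : ℂ))) = 1 := by
        push_cast; norm_num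
      rw [t3, one_smul] at t2
      exact t2.symm
    rw [z1, z2, z3, add_zero, add_zero]
  rw [hdec, hc0, zero_add]
  exact hE1

/-- The Levi decomposition of the parabolic subgroup. -/
theorem exists_eq_exp_mul (hF : IsSymmetricFlag G U P g u H R) {a : GLN N} (ha : a ∈ G)
    (h : Ad a H - H ∈ gradedPiece g piI H 1) :
    ∃ X ∈ gradedPiece g piI H 1, ∃ z ∈ G, Ad z H = H ∧ a = expGL X * z := by
  have hX : -(piI⁻¹ • (Ad a H - H)) ∈ gradedPiece g piI H 1 :=
    Submodule.neg_mem _ (Submodule.smul_mem _ _ h)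
  set X := -(piI⁻¹ • (Ad a H - H)) with hXdef
  refine ⟨X, hX, (expGL X)⁻¹ * a, G.mul_mem (G.inv_mem (hF.exp_mem_G hX.1)) ha, ?_, by group⟩
  have e : Ad a H = Ad (expGL X) H := by
    rw [hF.Ad_exp_pos_H hX, hXdef, smul_neg, smul_smul, mul_inv_cancel₀ piI_ne_zero, one_smul]
    abel
  rw [Ad_mul, e, Ad_inv_Ad]

theorem exp_pos_mem_P (hF : IsSymmetricFlag G U P g u H R) {X : Mat N}
    (hX : X ∈ gradedPiece g piI H 1) : expGL X ∈ P := by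
  rw [hF.mem_P]
  have key : ∀ X ∈ gradedPiece g piI H 1, ∀ Y ∈ nonnegPart g H,
      Ad (expGL X) Y ∈ nonnegPart g H := by
    intro X hX Y hY
    have h1 : ∀ Y ∈ nonnegPart g H, ⁅X, Y⁆ ∈ nonnegPart g H := by
      intro Y hY
      rw [hF.eq_add_of_mem_nonnegPart hY, lie_add,
        hF.lie_eq_zero_of_pos hX (hF.projPos_mem hY.1), add_zero]
      refine hF.mem_nonnegPart_of_mem (Or.inr ?_) (lie_mem_gradedPiece hX (hF.projZero_mem hY.1))
      norm_num
    rw [hF.Ad_exp_pos hX hY.1]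
    exact hF.nonnegSubmodule.add_mem (hF.nonnegSubmodule.add_mem hY (h1 _ hY))
      (hF.nonnegSubmodule.smul_mem _ (h1 _ (h1 _ hY)))
  refine ⟨hF.exp_mem_G hX.1, fun Y => ⟨fun hY => ?_, key X hX Y⟩⟩
  have := key _ (Submodule.neg_mem _ hX) _ hY
  rwa [expGL_neg, Ad_inv_Ad] at this

theorem mem_P_iff (hF : IsSymmetricFlag G U P g u H R) {a : GLN N} :
    a ∈ P ↔ a ∈ G ∧ Ad a H - H ∈ gradedPiece g piI H 1 := by
  refine ⟨fun ha => ⟨((hF.mem_P a).1 ha).1, hF.Ad_H_sub_mem ha⟩, fun ⟨ha, h⟩ => ?_⟩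
  obtain ⟨X, hX, z, hz, hzH, rfl⟩ := hF.exists_eq_exp_mul ha h
  exact P.mul_mem (hF.exp_pos_mem_P hX) (hF.mem_P_of_centralizer hz hzH)

theorem P_le (hF : IsSymmetricFlag G U P g u H R) : P ≤ G := fun a ha => ((hF.mem_P a).1 ha).1

theorem isClosed_P (hF : IsSymmetricFlag G U P g u H R) : IsClosed (P : Set (GLN N)) := by
  have h1 : IsClosed {a : GLN N | Ad a H - H ∈ (gradedPiece g piI H 1).restrictScalars ℝ} := by
    have hcl : IsClosed (((gradedPiece g piI H 1).restrictScalars ℝ : Submodule ℝ (Mat N)) :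
      Set (Mat N)) := Submodule.closed_of_finiteDimensional _
    refine hcl.preimage ?_
    exact (continuous_Ad.comp (continuous_id.prodMk continuous_const)).sub continuous_const
  convert hF.groupG.closed.inter h1 using 1
  ext a
  exact hF.mem_P_iff

theorem Ad_H_mem_u (hF : IsSymmetricFlag G U P g u H R) {a : GLN N} (ha : a ∈ U) :
    Ad a H ∈ u :=
  hF.groupU.lie.Ad_mem ha (X := H) hF.mem_u

/-- `U ∩ P` is the centralizer of `H` in `U`, since `Ad a H - H` is in `u` as well as in the
nilradical. -/
theorem mem_P_iff_of_mem_U (hF : IsSymmetricFlag G U P g u H R) {a : GLN N} (ha : a ∈ U) :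
    a ∈ P ↔ Ad a H = H := by
  refine ⟨fun h => ?_, fun h => hF.mem_P_of_centralizer (hF.groupU.le ha) h⟩
  have h1 := hF.Ad_H_sub_mem h
  have h2 := hF.eq_zero_of_mem_u one_ne_zero h1
    (hF.hstar_of_mem (u.sub_mem (hF.Ad_H_mem_u ha) hF.mem_u))
  exact sub_eq_zero.1 h2

end IsSymmetricFlag

end SymFlag

namespace SymFlag

variable {N : ℕ}

/-- A nonempty closed part of a preconnected set that is also open in it is the whole set. -/
theorem subset_of_eventually {α : Type*} [TopologicalSpace α] {s t : Set α} (hs : IsPreconnected s)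
    (ht : IsClosed t) (hne : (s ∩ t).Nonempty)
    (h : ∀ x ∈ s, x ∈ t → ∀ᶠ y in 𝓝 x, y ∈ s → y ∈ t) : s ⊆ t := by
  have : PreconnectedSpace s := Subtype.preconnectedSpace hs
  have hopen : IsOpen ((↑) ⁻¹' t : Set s) := by
    rw [isOpen_iff_mem_nhds]
    intro x hx
    have := (continuous_subtype_val.tendsto x).eventually (h x x.2 hx)
    filter_upwards [this] with y hy
    exact hy y.2
  obtain ⟨x, hx, hxt⟩ := hne
  have := IsClopen.eq_univ ⟨ht.preimage continuous_subtype_val, hopen⟩ ⟨⟨x, hx⟩, hxt⟩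
  intro y hy
  have hy' : (⟨y, hy⟩ : s) ∈ ((↑) ⁻¹' t : Set s) := by rw [this]; trivial
  exact hy'

theorem isClosed_centralizerIn (K : Subgroup (GLN N)) (H : Mat N) :
    IsClosed (centralizerIn K H : Set K) := by
  have h1 : Continuous fun a : K => Ad (a : GLN N) H :=
    continuous_Ad.comp (f := fun a : K => ((a : GLN N), H))
      (continuous_subtype_val.prodMk continuous_const)
  have e : (centralizerIn K H : Set K) = (fun a : K => Ad (a : GLN N) H) ⁻¹' {H} :=
    Set.ext fun _ => Iff.rfl
  rw [e]
  exact isClosed_singleton.preimage h1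

theorem Ad_inv_of_Ad_eq {a : GLN N} {X : Mat N} (h : Ad a X = X) : Ad a⁻¹ X = X := by
  conv_lhs => rw [← h]
  rw [Ad_inv_Ad]

namespace IsSymmetricFlag

variable {G U P : Subgroup (GLN N)} {g : LieSubalgebra ℂ (Mat N)}
  {u : LieSubalgebra ℝ (Mat N)} {H : Mat N} {R : GLN N}

/-! ### The decompositions `G = U P` and `N⁻ P` -/

theorem exp_mem_P (hF : IsSymmetricFlag G U P g u H R) {X : Mat N} (hX : X ∈ nonnegPart g H) :
    expGL X ∈ P := by
  have h0 : ∀ Y ∈ gradedPiece g piI H 0, expGL Y ∈ P := by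
    intro Y hY
    refine hF.mem_P_of_centralizer (hF.exp_mem_G hY.1) (Ad_expGL_of_lie_eq_zero ?_)
    rw [← lie_skew, hY.2]
    simp
  rw [hF.eq_add_of_mem_nonnegPart hX]
  refine hF.isClosed_P.mem_of_tendsto (tendsto_expGL_mul_expGL_pow _ _)
    (Eventually.of_forall fun n => P.pow_mem (P.mul_mem (h0 _ ?_) (hF.exp_pos_mem_P ?_)) n)
  · exact Submodule.smul_mem ((gradedPiece g piI H 0).restrictScalars ℝ) _ (hF.projZero_mem hX.1)
  · exact Submodule.smul_mem ((gradedPiece g piI H 1).restrictScalars ℝ) _ (hF.projPos_mem hX.1)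

/-- `g = u + p`: an element `X` of the opposite nilradical is `(X - X⋆) + X⋆`. -/
theorem exists_eq_add (hF : IsSymmetricFlag G U P g u H R) {X : Mat N} (hX : X ∈ g) :
    ∃ A ∈ u, ∃ B ∈ nonnegPart g H, X = A + B := by
  have hm := hF.projNeg_mem hX
  have hs := hF.hstar_mem_gradedPiece hm
  refine ⟨projNeg H X - hstar R (projNeg H X), ?_,
    hstar R (projNeg H X) + (projZero H X + projPos H X), ?_, ?_⟩
  · refine hF.mem_u_of_hstar (g.sub_mem hm.1 hs.1) ?_
    rw [hstar_sub, hstar_hstar, neg_sub]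
  · refine hF.nonnegSubmodule.add_mem (hF.mem_nonnegPart_of_mem (Or.inr (by norm_num)) hs)
      (hF.nonnegSubmodule.add_mem (hF.mem_nonnegPart_of_mem (Or.inl rfl) (hF.projZero_mem hX))
        (hF.mem_nonnegPart_of_mem (Or.inr rfl) (hF.projPos_mem hX)))
  · nth_rewrite 1 [← projNeg_add_projZero_add_projPos H X]
    abel

/-- The set `U P` is closed in `G`, because `U` is compact, and open, because `g = u + p`. -/
theorem exists_eq_mul (hF : IsSymmetricFlag G U P g u H R) {a : GLN N} (ha : a ∈ G) :
    ∃ x ∈ U, ∃ p ∈ P, a = x * p := by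
  have hcl : IsClosed {a : GLN N | ∃ x ∈ U, ∃ p ∈ P, a = x * p} := by
    have := hF.isClosed_P.mul_left_of_isCompact hF.groupU.compact
    convert this using 1
    ext a
    simp [Set.mem_mul, eq_comm]
  refine subset_of_eventually (s := (G : Set (GLN N))) hF.groupG.connected.isPreconnected hcl
    ⟨1, G.one_mem, 1, U.one_mem, 1, P.one_mem, by simp⟩ (fun x _ hx => ?_) ha
  refine eventually_mem_mul hF.groupG.closed hF.groupG.lie (a := u.toSubmodule)
    (b := hF.nonnegSubmodule) (fun X hX => hF.groupU.mem_of_mem hX) (fun X hX => hX.1)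
    (fun X hX => ?_) hF.groupU.le hF.P_le (fun X hX => hF.groupU.lie.exp_mem hX)
    (fun X hX => hF.exp_mem_P hX) hx
  obtain ⟨A, hA, B, hB, rfl⟩ := hF.exists_eq_add hX
  exact Submodule.add_mem_sup (S := u.toSubmodule) (T := hF.nonnegSubmodule) hA hB

theorem expGL_add_of_neg (hF : IsSymmetricFlag G U P g u H R) {X Y : Mat N}
    (hX : X ∈ gradedPiece g piI H (-1)) (hY : Y ∈ gradedPiece g piI H (-1)) :
    expGL (X + Y) = expGL X * expGL Y := by
  refine expGL_add ?_
  have h := hF.lie_eq_zero_of_neg hX hY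
  rw [Ring.lie_def, sub_eq_zero] at h
  exact h

theorem expGL_add_of_pos (hF : IsSymmetricFlag G U P g u H R) {X Y : Mat N}
    (hX : X ∈ gradedPiece g piI H 1) (hY : Y ∈ gradedPiece g piI H 1) :
    expGL (X + Y) = expGL X * expGL Y := by
  refine expGL_add ?_
  have h := hF.lie_eq_zero_of_pos hX hY
  rw [Ring.lie_def, sub_eq_zero] at h
  exact h

/-- The unipotent radical of the parabolic subgroup opposite to `P`. -/
def oppositeRadical (hF : IsSymmetricFlag G U P g u H R) : Subgroup (GLN N) where
  carrier := {a | ∃ Y ∈ gradedPiece g piI H (-1), a = expGL Y}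
  mul_mem' := by
    rintro _ _ ⟨X, hX, rfl⟩ ⟨Y, hY, rfl⟩
    exact ⟨X + Y, Submodule.add_mem _ hX hY, (hF.expGL_add_of_neg hX hY).symm⟩
  one_mem' := ⟨0, Submodule.zero_mem _, by simp⟩
  inv_mem' := by
    rintro _ ⟨X, hX, rfl⟩
    exact ⟨-X, Submodule.neg_mem _ hX, (expGL_neg X).symm⟩

theorem eq_zero_of_exp_neg_mem_P (hF : IsSymmetricFlag G U P g u H R) {Y : Mat N}
    (hY : Y ∈ gradedPiece g piI H (-1)) (h : expGL Y ∈ P) : Y = 0 := by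
  have h1 := hF.Ad_H_sub_mem h
  rw [hF.Ad_exp_neg_H hY, add_sub_cancel_left] at h1
  have h2 : piI • Y ∈ gradedPiece g piI H (-1) := Submodule.smul_mem _ _ hY
  have e1 := projPos_of_mem h1
  have e2 := projPos_of_mem h2
  rw [e1] at e2
  simpa [piI_ne_zero] using e2

theorem exp_neg_mul_injective (hF : IsSymmetricFlag G U P g u H R) {Y Y' : Mat N}
    (hY : Y ∈ gradedPiece g piI H (-1)) (hY' : Y' ∈ gradedPiece g piI H (-1)) {p p' : GLN N}
    (hp : p ∈ P) (hp' : p' ∈ P) (h : expGL Y * p = expGL Y' * p') : Y = Y' ∧ p = p' := by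
  have h1 : expGL (-Y' + Y) = p' * p⁻¹ := by
    rw [hF.expGL_add_of_neg (Submodule.neg_mem _ hY') hY, expGL_neg, eq_mul_inv_iff_mul_eq,
      mul_assoc, h, inv_mul_cancel_left]
  have h2 := hF.eq_zero_of_exp_neg_mem_P
    (Submodule.add_mem _ (Submodule.neg_mem _ hY') hY) (h1 ▸ P.mul_mem hp' (P.inv_mem hp))
  have h3 : Y = Y' := (neg_add_eq_zero.1 h2).symm
  refine ⟨h3, ?_⟩
  rw [h3] at h
  exact mul_left_cancel h

/-- The set `N⁻ P` is open in `G`. -/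
theorem eventually_eq_exp_neg_mul (hF : IsSymmetricFlag G U P g u H R) {x : GLN N}
    (hx : ∃ Y ∈ gradedPiece g piI H (-1), ∃ p ∈ P, x = expGL Y * p) :
    ∀ᶠ y in 𝓝 x, y ∈ G → ∃ Y ∈ gradedPiece g piI H (-1), ∃ p ∈ P, y = expGL Y * p := by
  obtain ⟨Y₀, hY₀, p₀, hp₀, rfl⟩ := hx
  have := eventually_mem_mul hF.groupG.closed hF.groupG.lie
    (a := (gradedPiece g piI H (-1)).restrictScalars ℝ) (A := hF.oppositeRadical) (B := P)
    (b := hF.nonnegSubmodule) (fun X hX => hX.1) (fun X hX => hX.1)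
    (fun X hX => ?_) ?_ hF.P_le (fun X hX => ⟨X, hX, rfl⟩)
    (fun X hX => hF.exp_mem_P hX) ⟨expGL Y₀, ⟨Y₀, hY₀, rfl⟩, p₀, hp₀, rfl⟩
  · filter_upwards [this] with y hy hyG
    obtain ⟨_, ⟨Y, hY, rfl⟩, p, hp, h⟩ := hy hyG
    exact ⟨Y, hY, p, hp, h⟩
  · rw [← projNeg_add_projZero_add_projPos H X, add_assoc]
    exact Submodule.add_mem_sup (S := (gradedPiece g piI H (-1)).restrictScalars ℝ)
      (T := hF.nonnegSubmodule) (hF.projNeg_mem hX)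
      (hF.nonnegSubmodule.add_mem (hF.mem_nonnegPart_of_mem (Or.inl rfl) (hF.projZero_mem hX))
        (hF.mem_nonnegPart_of_mem (Or.inr rfl) (hF.projPos_mem hX)))
  · rintro _ ⟨Y, hY, rfl⟩
    exact hF.exp_mem_G hY.1

/-! ### The involution -/

theorem Ad_exp_H (hF : IsSymmetricFlag G U P g u H R) {X : Mat N} (hX : X ∈ g) :
    Ad (expGL H) X = projZero H X - projNeg H X - projPos H X := by
  have h0 : Ad (expGL H) (projZero H X) = projZero H X :=
    Ad_expGL_of_lie_eq_zero (by rw [(hF.projZero_mem hX).2]; simp)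
  have h1 : Ad (expGL H) (projPos H X) = -projPos H X :=
    Ad_expGL_of_lie_lie (by simp [(hF.projPos_mem hX).2, smul_smul])
  have h2 : Ad (expGL H) (projNeg H X) = -projNeg H X :=
    Ad_expGL_of_lie_lie (by simp [(hF.projNeg_mem hX).2, smul_smul])
  nth_rewrite 1 [← projNeg_add_projZero_add_projPos H X]
  rw [Ad_add, Ad_add, h0, h1, h2]
  abel

theorem Ad_exp_H_of_pos {X : Mat N}
    (hX : X ∈ gradedPiece g piI H 1) : Ad (expGL H) X = -X :=
  Ad_expGL_of_lie_lie (by simp [hX.2, smul_smul])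

theorem Ad_exp_H_eq_iff (hF : IsSymmetricFlag G U P g u H R) {X : Mat N} (hX : X ∈ g) :
    Ad (expGL H) X = X ↔ ⁅H, X⁆ = 0 := by
  refine ⟨fun h => ?_, Ad_expGL_of_lie_eq_zero⟩
  rw [hF.Ad_exp_H hX] at h
  have hd := projNeg_add_projZero_add_projPos H X
  have h2 : (2 : ℂ) • X = (2 : ℂ) • projZero H X := by
    nth_rewrite 1 [two_smul]
    nth_rewrite 1 [← h]
    nth_rewrite 4 [← hd]
    module
  have h3 : X = projZero H X := smul_right_injective _ two_ne_zero h2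
  rw [h3, (hF.projZero_mem hX).2]
  simp

theorem Ad_exp_H_Ad_exp_H (hF : IsSymmetricFlag G U P g u H R) {X : Mat N} (hX : X ∈ g) :
    Ad (expGL H) (Ad (expGL H) X) = X := by
  have ha := hF.projNeg_mem hX
  have hb := hF.projZero_mem hX
  have hc := hF.projPos_mem hX
  have hY := hF.groupG.Ad_mem (hF.exp_mem_G hF.mem_g) hX
  rw [hF.Ad_exp_H hY, hF.Ad_exp_H hX]
  simp only [map_sub, projNeg_of_mem ha, projNeg_of_mem hb, projNeg_of_mem hc, projZero_of_mem ha,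
    projZero_of_mem hb, projZero_of_mem hc, projPos_of_mem ha, projPos_of_mem hb, projPos_of_mem hc]
  nth_rewrite 10 [← projNeg_add_projZero_add_projPos H X]
  push_cast
  module

theorem exp_H_involutive (hF : IsSymmetricFlag G U P g u H R) {a : GLN N} (ha : a ∈ G) :
    expGL H * (expGL H * a * (expGL H)⁻¹) * (expGL H)⁻¹ = a := by
  have h := le_of_exp_mem hF.groupG.closed hF.groupG.connected hF.groupG.lie
    (M := Subgroup.centralizer {expGL H * expGL H}) (fun X hX => ?_) ha
  · rw [Subgroup.mem_centralizer_singleton_iff] at h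
    calc _ = expGL H * expGL H * a * (expGL H)⁻¹ * (expGL H)⁻¹ := by group
      _ = a := by rw [← h]; group
  · rw [Subgroup.mem_centralizer_singleton_iff]
    have h1 := expGL_Ad (expGL H * expGL H) X
    rw [Ad_mul, hF.Ad_exp_H_Ad_exp_H hX] at h1
    rw [eq_mul_inv_iff_mul_eq] at h1
    exact h1

theorem exp_H_conj_of_centralizer {a : GLN N} {H : Mat N} (ha : Ad a H = H) :
    expGL H * a * (expGL H)⁻¹ = a := by
  have h := expGL_Ad a H
  rw [ha, eq_mul_inv_iff_mul_eq] at h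
  rw [h, mul_inv_cancel_right]

/-- Near `1` the fixed points of the conjugation by `exp H` are exponentials of fixed points of
`Ad(exp H)`, that is, of elements that commute with `H`. So the centralizer of `H` contains the
identity component of the fixed-point group. -/
theorem isSymmetricSpace (hF : IsSymmetricFlag G U P g u H R) {K : Subgroup (GLN N)}
    (hc : IsClosed (K : Set (GLN N))) (hconn : IsConnected (K : Set (GLN N)))
    {k : Submodule ℝ (Mat N)} (hk : IsLieAlgebraOf K k) (hkg : ∀ X ∈ k, X ∈ g) (hKG : K ≤ G)
    (e : K) (he : (e : GLN N) = expGL H) :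
    IsSymmetricSpace (centralizerIn K H) (MulAut.conj e) where
  connected := isConnected_iff_connectedSpace.1 hconn
  closed := isClosed_centralizerIn K H
  continuous := by
    change Continuous fun a => e * a * e⁻¹
    fun_prop
  involutive a := by
    apply Subtype.ext
    simpa [he] using hF.exp_H_involutive (hKG a.2)
  le_fixed a ha := by
    apply Subtype.ext
    simpa [he] using exp_H_conj_of_centralizer (H := H) ha
  component_le := by
    have hfix : ∀ a : K, MulAut.conj e a = a ↔ expGL H * a * (expGL H)⁻¹ = (a : GLN N) := fun a => by
      rw [Subtype.ext_iff]; simp [he]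
    have hone : (1 : K) ∈ {a : K | MulAut.conj e a = a} := map_one _
    refine subset_of_eventually isPreconnected_connectedComponentIn (isClosed_centralizerIn K H)
      ⟨1, mem_connectedComponentIn hone, Subgroup.one_mem _⟩ fun x hx hxZ => ?_
    obtain ⟨V, hV, hinj⟩ := eventually_injOn_exp (N := N)
    -- near `1`, the logarithm of a fixed point of the conjugation commutes with `H`
    have hAd : Tendsto (fun X : Mat N => Ad (expGL H) X) (𝓝 0) (𝓝 0) :=
      (continuous_Ad.comp (continuous_const.prodMk continuous_id)).tendsto' _ _ (by simp)
    have hV' : V ∩ (fun X : Mat N => Ad (expGL H) X) ⁻¹' V ∈ 𝓝 0 := inter_mem hV (hAd hV)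
    have ht : Tendsto (fun y : K => ((x⁻¹ * y : K) : GLN N)) (𝓝 x) (𝓝 1) :=
      (by fun_prop : Continuous fun y : K => ((x⁻¹ * y : K) : GLN N)).tendsto' _ _ (by simp)
    filter_upwards [ht.eventually (eventually_eq_exp hc hk hV')] with y hy hys
    obtain ⟨X, hX, ⟨hXV, hXV'⟩, h⟩ := hy (x⁻¹ * y).2
    have hxF : x ∈ {a : K | MulAut.conj e a = a} := connectedComponentIn_subset _ _ hx
    have hyF : y ∈ {a : K | MulAut.conj e a = a} := connectedComponentIn_subset _ _ hys
    have hF1 : MulAut.conj e (x⁻¹ * y) = x⁻¹ * y := by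
      rw [map_mul, map_inv, show MulAut.conj e x = x from hxF, show MulAut.conj e y = y from hyF]
    rw [hfix, h, ← expGL_Ad] at hF1
    have h3 := (hF.Ad_exp_H_eq_iff (hkg X hX)).1 (hinj hXV' hXV hF1)
    have h4 : x⁻¹ * y ∈ centralizerIn K H := by
      change Ad ((x⁻¹ * y : K) : GLN N) H = H
      rw [h]
      exact Ad_expGL_of_lie_eq_zero (by rw [← lie_skew, h3, neg_zero])
    exact (Subgroup.mul_mem_cancel_left _ ((centralizerIn K H).inv_mem hxZ)).1 h4

/-- If the centralizer of `H` in `U` is the full fixed-point group of the conjugation by `exp H`,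
then so is its centralizer in `G`: in the decomposition `G = U N⁺ Z`, the conjugation inverts the
elements of `N⁺`. -/
theorem centralizer_of_fixed (hF : IsSymmetricFlag G U P g u H R)
    (h : ∀ a ∈ U, expGL H * a * (expGL H)⁻¹ = a → Ad a H = H) {c : GLN N} (hc : c ∈ G)
    (hfix : expGL H * c * (expGL H)⁻¹ = c) : Ad c H = H := by
  obtain ⟨x, hx, p, hp, rfl⟩ := hF.exists_eq_mul hc
  obtain ⟨X, hX, z, hz, hzH, rfl⟩ := hF.exists_eq_exp_mul (hF.P_le hp) (hF.Ad_H_sub_mem hp)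
  have hzf := exp_H_conj_of_centralizer hzH
  have hXf : expGL H * expGL X * (expGL H)⁻¹ = (expGL X)⁻¹ := by
    rw [← expGL_Ad, Ad_exp_H_of_pos hX, expGL_neg]
  have e1 : (expGL H * x * (expGL H)⁻¹) * (expGL X)⁻¹ * z = x * expGL X * z := by
    rw [← hXf, mul_assoc x, ← hfix]
    conv_lhs => rw [← hzf]
    group
  have e2 : expGL (X + X) = x⁻¹ * (expGL H * x * (expGL H)⁻¹) := by
    rw [hF.expGL_add_of_pos hX hX, eq_inv_mul_iff_mul_eq, ← mul_assoc]
    rw [mul_left_inj, mul_inv_eq_iff_eq_mul] at e1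
    exact e1.symm
  have hXX : X + X ∈ gradedPiece g piI H 1 := Submodule.add_mem _ hX hX
  have hHU := hF.groupU.lie.exp_mem (X := H) hF.mem_u
  have e3 : Ad (expGL (X + X)) H = H := by
    rw [← hF.mem_P_iff_of_mem_U]
    · exact hF.exp_pos_mem_P hXX
    · rw [e2]
      exact U.mul_mem (U.inv_mem hx) (U.mul_mem (U.mul_mem hHU hx) (U.inv_mem hHU))
  rw [hF.Ad_exp_pos_H hXX, sub_eq_self, smul_eq_zero, or_iff_right piI_ne_zero, ← two_smul ℂ,
    smul_eq_zero, or_iff_right two_ne_zero] at e3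
  subst e3
  rw [expGL_zero, inv_one, mul_one, mul_one, mul_left_inj] at e1
  rw [expGL_zero, one_mul, Ad_mul, hzH]
  exact h x hx e1

end IsSymmetricFlag

end SymFlag

namespace SymFlag

variable {N : ℕ}

/-! ### Smooth dependence of the solutions of linear systems -/

/-- An injective linear system with smooth coefficients has at most one solution, and the solutions
at nearby parameters are the values of a smooth function. -/
theorem exists_contDiffAt_of_linear_system {E V W : Type*} [NormedAddCommGroup E] [NormedSpace ℝ E]
    [NormedAddCommGroup V] [NormedSpace ℝ V] [FiniteDimensional ℝ V] [NormedAddCommGroup W]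
    [NormedSpace ℝ W] [FiniteDimensional ℝ W] {n : ℕ∞ω} {M : E → V →L[ℝ] W} {w : E → W} {s₀ : E}
    (hM : ContDiffAt ℝ n M s₀) (hw : ContDiffAt ℝ n w s₀) (hinj : ∀ y, M s₀ y = 0 → y = 0) :
    ∃ v : E → V, ContDiffAt ℝ n v s₀ ∧ ∀ᶠ s in 𝓝 s₀, ∀ y, M s y = w s → y = v s := by
  have : CompleteSpace V := FiniteDimensional.complete ℝ V
  have hker : LinearMap.ker (M s₀ : V →ₗ[ℝ] W) = ⊥ := LinearMap.ker_eq_bot'.2 hinj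
  obtain ⟨L, hL⟩ := LinearMap.exists_leftInverse_of_injective _ hker
  let L' : W →L[ℝ] V := LinearMap.toContinuousLinearMap L
  let B : E → V →L[ℝ] V := fun s => L'.comp (M s)
  have hB : ContDiffAt ℝ n B s₀ := contDiffAt_const.clm_comp hM
  have hB0 : B s₀ = ((1 : (V →L[ℝ] V)ˣ) : V →L[ℝ] V) := by
    refine ContinuousLinearMap.ext fun y => ?_
    exact LinearMap.congr_fun hL y
  have hinv : ContDiffAt ℝ n Ring.inverse (B s₀) := by
    rw [hB0]; exact contDiffAt_ringInverse ℝ _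
  refine ⟨fun s => Ring.inverse (B s) (L' (w s)),
    (hinv.comp s₀ hB).clm_apply (L'.contDiff.contDiffAt.comp s₀ hw), ?_⟩
  have hu : ∀ᶠ s in 𝓝 s₀, IsUnit (B s) := by
    refine hB.continuousAt.eventually (Units.isOpen.mem_nhds ?_)
    rw [hB0]; exact Units.isUnit _
  filter_upwards [hu] with s hs y hy
  have h1 : Ring.inverse (B s) * B s = 1 := Ring.inverse_mul_cancel _ hs
  have h2 := congrArg (fun T : V →L[ℝ] V => T y) h1
  simp only [ContinuousLinearMap.mul_def, ContinuousLinearMap.comp_apply,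
    one_apply_eq_self, B, hy] at h2
  exact h2.symm

theorem contDiffAt_of_clm_apply {E V W : Type*} [NormedAddCommGroup E] [NormedSpace ℝ E]
    [NormedAddCommGroup V] [NormedSpace ℝ V] [FiniteDimensional ℝ V] [NormedAddCommGroup W]
    [NormedSpace ℝ W] {n : ℕ∞ω} {M : E → V →L[ℝ] W} {s₀ : E}
    (hM : ∀ y, ContDiffAt ℝ n (fun s => M s y) s₀) : ContDiffAt ℝ n M s₀ := by
  let d := Module.finrank ℝ V
  have hd : d = Module.finrank ℝ (Fin d → ℝ) := (Module.finrank_fin_fun ℝ).symm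
  let e₁ := ContinuousLinearEquiv.ofFinrankEq hd
  let e₂ := (e₁.arrowCongr (1 : W ≃L[ℝ] W)).trans (ContinuousLinearEquiv.piRing (Fin d))
  rw [← Function.id_comp M, ← e₂.symm_comp_self]
  exact e₂.symm.contDiff.contDiffAt.comp _ (contDiffAt_pi.mpr fun i => hM _)

/-- The map `m ↦ m Z m⁻¹` is smooth near the invertible matrices. -/
theorem contDiffAt_conj (x : GLN N) (Z : Mat N) {n : ℕ∞ω} :
    ContDiffAt ℝ n (fun m : Mat N => m * Z * Ring.inverse m) (x : Mat N) :=
  (contDiffAt_id.mul contDiffAt_const).mul (contDiffAt_ringInverse ℝ x)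

theorem conj_coe (x : GLN N) (Z : Mat N) : (x : Mat N) * Z * Ring.inverse (x : Mat N) = Ad x Z := by
  rw [Ring.inverse_unit]; rfl

theorem contDiff_Ad_exp (Z : Mat N) {n : ℕ∞ω} :
    ContDiff ℝ n (fun Y : Mat N => Ad (expGL Y) Z) := by
  have e : (fun Y : Mat N => Ad (expGL Y) Z) =
      fun Y => NormedSpace.exp Y * Z * NormedSpace.exp (-Y) := rfl
  rw [e]
  exact (contDiff_exp.mul contDiff_const).mul (contDiff_exp.comp contDiff_neg)

/-- A complex eigenspace of `ad H`, as a real subspace. -/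
noncomputable abbrev realPiece (g : LieSubalgebra ℂ (Mat N)) (H : Mat N) (k : ℤ) :
    Submodule ℝ (Mat N) :=
  (gradedPiece g piI H k).restrictScalars ℝ

namespace IsSymmetricFlag

variable {G U P : Subgroup (GLN N)} {g : LieSubalgebra ℂ (Mat N)}
  {u : LieSubalgebra ℝ (Mat N)} {H : Mat N} {R : GLN N}

theorem eq_zero_of_lie_pos (hF : IsSymmetricFlag G U P g u H R) {Y : Mat N}
    (hY : Y ∈ gradedPiece g piI H (-1)) (h : ∀ W ∈ gradedPiece g piI H 1, ⁅Y, W⁆ = 0) : Y = 0 := by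
  refine hF.eq_zero_of_trace hY fun W hW => ?_
  have h1 := trace_lie_mul Y W H
  rw [h W (by simpa using hW), zero_mul, Matrix.trace_zero, ← lie_skew, hY.2] at h1
  have h2 : (W * Y).trace = 0 := by
    simpa [piI_ne_zero] using h1
  rw [Matrix.trace_mul_comm, h2, Complex.zero_re]

/-- The components of `Ad(exp Y) W`, for `W` in the nilradical, determine `W` and `[Y, W]`. -/
theorem projPos_Ad_exp_neg (hF : IsSymmetricFlag G U P g u H R) {Y W : Mat N}
    (hY : Y ∈ gradedPiece g piI H (-1)) (hW : W ∈ gradedPiece g piI H 1) :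
    projPos H (Ad (expGL Y) W) = W ∧ projZero H (Ad (expGL Y) W) = ⁅Y, W⁆ := by
  have h1 := lie_mem_gradedPiece hY hW
  have h2 := lie_mem_gradedPiece hY h1
  have e : Ad (expGL Y) W = W + ⁅Y, W⁆ + (2⁻¹ : ℂ) • ⁅Y, ⁅Y, W⁆⁆ := by
    rw [hF.Ad_exp_neg hY hW.1]
    congr 1
    rw [← Complex.coe_smul]
    norm_num
  rw [e]
  constructor
  · simp only [map_add, map_smul, projPos_of_mem hW, projPos_of_mem h1, projPos_of_mem h2]
    push_cast
    module
  · simp only [map_add, map_smul, projZero_of_mem hW, projZero_of_mem h1, projZero_of_mem h2]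
    push_cast
    module

/-- The coordinate `Y` of the points `exp(Y) p` of the open set `N⁻ P` is a smooth function, since
it is the solution of the injective linear system `[Y, W₁] = W₀`, where `W₁` and `W₀` are the
components in the nilradical and in the centralizer of `H` of `Ad(exp(Y) p) Z`, for `Z` in the
nilradical. -/
theorem exists_coord (hF : IsSymmetricFlag G U P g u H R) {Y₀ : Mat N} {p₀ : GLN N}
    (hY₀ : Y₀ ∈ gradedPiece g piI H (-1)) (hp₀ : p₀ ∈ P) :
    ∃ c : Mat N → realPiece g H (-1), ContDiffAt ℝ ∞ c (expGL Y₀ * p₀ : GLN N) ∧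
      ∀ᶠ m : Mat N in 𝓝 ((expGL Y₀ * p₀ : GLN N) : Mat N), ∀ (Y : realPiece g H (-1)), ∀ p ∈ P,
        m = (expGL (Y : Mat N) * p : GLN N) → Y = c m := by
  let e := Module.finBasis ℝ (realPiece g H 1)
  let proj₁ : Mat N →L[ℝ] Mat N := LinearMap.toContinuousLinearMap ((projPos H).restrictScalars ℝ)
  let proj₀ : Mat N →L[ℝ] Mat N := LinearMap.toContinuousLinearMap ((projZero H).restrictScalars ℝ)
  let A : Mat N → Fin (Module.finrank ℝ (realPiece g H 1)) → Mat N :=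
    fun m i => m * (e i : Mat N) * Ring.inverse m
  let M : Mat N → realPiece g H (-1) →L[ℝ]
      (Fin (Module.finrank ℝ (realPiece g H 1)) → Mat N) := fun m =>
    LinearMap.toContinuousLinearMap
      { toFun := fun Y i => ⁅(Y : Mat N), proj₁ (A m i)⁆
        map_add' := fun Y Y' => by ext1 i; simp [add_lie]
        map_smul' := fun s Y => by
          ext1 i
          simp only [Ring.lie_def, RingHom.id_apply, Pi.smul_apply, Submodule.coe_smul, smul_sub,
            smul_mul_assoc, mul_smul_comm] }
  have hA : ∀ i, ContDiffAt ℝ ∞ (fun m => A m i) ((expGL Y₀ * p₀ : GLN N) : Mat N) := fun i =>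
    contDiffAt_conj _ _
  have hM : ContDiffAt ℝ ∞ M ((expGL Y₀ * p₀ : GLN N) : Mat N) := by
    refine contDiffAt_of_clm_apply fun Y => ?_
    rw [contDiffAt_pi]
    intro i
    have h1 : ContDiffAt ℝ ∞ (fun m => proj₁ (A m i)) ((expGL Y₀ * p₀ : GLN N) : Mat N) :=
      proj₁.contDiff.contDiffAt.comp _ (hA i)
    have h2 : ContDiffAt ℝ ∞ (fun m => (Y : Mat N) * proj₁ (A m i) - proj₁ (A m i) * (Y : Mat N))
        ((expGL Y₀ * p₀ : GLN N) : Mat N) :=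
      (contDiffAt_const.mul h1).sub (h1.mul contDiffAt_const)
    exact h2
  have hw : ContDiffAt ℝ ∞ (fun m i => proj₀ (A m i)) ((expGL Y₀ * p₀ : GLN N) : Mat N) :=
    contDiffAt_pi.2 fun i => proj₀.contDiff.contDiffAt.comp _ (hA i)
  have hAeq : ∀ (Y : Mat N) (p : GLN N) i, A (expGL Y * p : GLN N) i =
      Ad (expGL Y) (Ad p (e i : Mat N)) := fun Y p i => by
    rw [← Ad_mul]; exact conj_coe _ _
  have hinj : ∀ Y, M (expGL Y₀ * p₀ : GLN N) Y = 0 → Y = 0 := by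
    intro Y hY
    apply Subtype.ext
    refine hF.eq_zero_of_lie_pos Y.2 fun W hW => ?_
    have h1 : ∀ i, ⁅(Y : Mat N), Ad p₀ (e i : Mat N)⁆ = 0 := by
      intro i
      have h2 := congrFun hY i
      change ⁅(Y : Mat N), projPos H (A _ i)⁆ = 0 at h2
      rwa [hAeq, (hF.projPos_Ad_exp_neg hY₀ (hF.Ad_pos hp₀ (e i).2)).1] at h2
    let T : realPiece g H 1 →ₗ[ℝ] Mat N :=
      { toFun := fun Z => ⁅(Y : Mat N), Ad p₀ (Z : Mat N)⁆
        map_add' := fun Z Z' => by simp [Ad_add]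
        map_smul' := fun s Z => by
          simp only [Submodule.coe_smul, Ad_smul_real, RingHom.id_apply, Ring.lie_def, smul_sub,
            smul_mul_assoc, mul_smul_comm] }
    have hT : T = 0 := e.ext fun i => h1 i
    have h3 := LinearMap.congr_fun hT ⟨Ad p₀⁻¹ W, hF.Ad_pos (P.inv_mem hp₀) hW⟩
    change ⁅(Y : Mat N), Ad p₀ (Ad p₀⁻¹ W)⁆ = 0 at h3
    rwa [Ad_Ad_inv] at h3
  obtain ⟨c, hc, hev⟩ := exists_contDiffAt_of_linear_system hM hw hinj
  refine ⟨c, hc, ?_⟩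
  filter_upwards [hev] with m hm Y p hp hmY
  refine hm Y ?_
  funext i
  change ⁅(Y : Mat N), projPos H (A m i)⁆ = projZero H (A m i)
  have h := hF.projPos_Ad_exp_neg Y.2 (hF.Ad_pos hp (e i).2)
  rw [hmY, hAeq, h.1, h.2]

theorem contDiff_hstar (R : GLN N) {n : ℕ∞ω} : ContDiff ℝ n (hstar R) := by
  let T : Mat N →ₗ[ℝ] Mat N :=
    { toFun := hstar R
      map_add' := hstar_add R
      map_smul' := hstar_smul_real R }
  exact (LinearMap.toContinuousLinearMap T).contDiff

/-- For `Y` in the opposite nilradical, there is a unique `X` in the nilradical for which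
`Ad(exp Y exp X) H` belongs to the Lie algebra of `U`, and it depends smoothly on `Y`: it is the
solution of an injective linear system. -/
theorem exists_radial (hF : IsSymmetricFlag G U P g u H R) :
    ∃ X : realPiece g H (-1) → realPiece g H 1, ContDiff ℝ ∞ X ∧
      (∀ Y : realPiece g H (-1),
        Ad (expGL (Y : Mat N)) (Ad (expGL (X Y : Mat N)) H) ∈ u) ∧
      ∀ (Y : realPiece g H (-1)) (p : GLN N), p ∈ P → expGL (Y : Mat N) * p ∈ U →
        ∃ z ∈ G, Ad z H = H ∧ p = expGL (X Y : Mat N) * z := by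
  have hex : ∀ Y : realPiece g H (-1), ∃ X : realPiece g H 1,
      Ad (expGL (Y : Mat N)) (Ad (expGL (X : Mat N)) H) ∈ u := by
    intro Y
    obtain ⟨x, hx, p, hp, h⟩ := hF.exists_eq_mul (hF.exp_mem_G Y.2.1)
    have hp' := P.inv_mem hp
    obtain ⟨X, hX, z, hz, hzH, h2⟩ := hF.exists_eq_exp_mul (hF.P_le hp') (hF.Ad_H_sub_mem hp')
    refine ⟨⟨X, hX⟩, ?_⟩
    have e : Ad (expGL (Y : Mat N)) (Ad (expGL X) H) = Ad x H := by
      have : Ad (expGL X) H = Ad p⁻¹ H := by rw [h2, Ad_mul, hzH]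
      rw [this, ← Ad_mul, h, mul_inv_cancel_right]
    change Ad (expGL (Y : Mat N)) (Ad (expGL X) H) ∈ u
    rw [e]
    exact hF.Ad_H_mem_u hx
  choose X hX using hex
  let M : realPiece g H (-1) → realPiece g H 1 →L[ℝ] Mat N := fun Y =>
    LinearMap.toContinuousLinearMap
      { toFun := fun X => Ad (expGL (Y : Mat N)) (piI • (X : Mat N)) +
          hstar R (Ad (expGL (Y : Mat N)) (piI • (X : Mat N)))
        map_add' := fun X X' => by
          simp only [Submodule.coe_add, smul_add, Ad_add, hstar_add]; abel
        map_smul' := fun s X => by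
          simp only [Submodule.coe_smul, smul_comm piI s, Ad_smul_real, hstar_smul_real,
            RingHom.id_apply, smul_add] }
  let w : realPiece g H (-1) → Mat N := fun Y =>
    Ad (expGL (Y : Mat N)) H + hstar R (Ad (expGL (Y : Mat N)) H)
  have hAd : ∀ Z : Mat N, ContDiff ℝ ∞ fun Y : realPiece g H (-1) =>
      Ad (expGL (Y : Mat N)) Z := fun Z =>
    (contDiff_Ad_exp Z).comp (realPiece g H (-1)).subtypeL.contDiff
  have hM : ContDiff ℝ ∞ M := by
    rw [contDiff_clm_apply_iff]
    intro Z
    exact (hAd _).add ((contDiff_hstar R).comp (hAd _))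
  have hw : ContDiff ℝ ∞ w := (hAd _).add ((contDiff_hstar R).comp (hAd _))
  have hsol : ∀ (Y : realPiece g H (-1)) (X : realPiece g H 1),
      Ad (expGL (Y : Mat N)) (Ad (expGL (X : Mat N)) H) ∈ u → M Y X = w Y := by
    intro Y X h
    have h1 := hF.hstar_of_mem h
    rw [hF.Ad_exp_pos_H X.2, Ad_sub, hstar_sub] at h1
    change Ad (expGL (Y : Mat N)) (piI • (X : Mat N)) +
      hstar R (Ad (expGL (Y : Mat N)) (piI • (X : Mat N))) =
      Ad (expGL (Y : Mat N)) H + hstar R (Ad (expGL (Y : Mat N)) H)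
    rw [sub_eq_iff_eq_add] at h1
    rw [h1]
    abel
  have hinj : ∀ Y X, M Y X = 0 → X = 0 := by
    intro Y X h
    change Ad (expGL (Y : Mat N)) (piI • (X : Mat N)) +
      hstar R (Ad (expGL (Y : Mat N)) (piI • (X : Mat N))) = 0 at h
    have h1 : piI • (X : Mat N) ∈ gradedPiece g piI H 1 := Submodule.smul_mem _ _ X.2
    have h2 := eq_zero_of_trace_mul_self (eq_neg_of_add_eq_zero_right h) (by
      rw [trace_Ad_mul_Ad]
      exact trace_mul_eq_zero piI_ne_zero (by norm_num) h1 h1)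
    have h3 := Ad_injective _ (h2.trans (Ad_zero _).symm)
    exact Subtype.ext ((smul_eq_zero.1 h3).resolve_left piI_ne_zero)
  refine ⟨X, ?_, hX, ?_⟩
  · rw [contDiff_iff_contDiffAt]
    intro Y₀
    obtain ⟨v, hv, hev⟩ := exists_contDiffAt_of_linear_system (hM.contDiffAt (x := Y₀))
      hw.contDiffAt (hinj Y₀)
    refine hv.congr_of_eventuallyEq ?_
    filter_upwards [hev] with Y hY
    exact hY _ (hsol Y _ (hX Y))
  · intro Y p hp hpU
    obtain ⟨X', hX', z, hz, hzH, rfl⟩ := hF.exists_eq_exp_mul (hF.P_le hp) (hF.Ad_H_sub_mem hp)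
    have h1 : Ad (expGL (Y : Mat N)) (Ad (expGL X') H) ∈ u := by
      have := hF.Ad_H_mem_u hpU
      rwa [Ad_mul, Ad_mul, hzH] at this
    have h2 : M Y ((⟨X', hX'⟩ : realPiece g H 1) - X Y) = 0 := by
      rw [map_sub, hsol Y ⟨X', hX'⟩ h1, hsol Y _ (hX Y), sub_self]
    have h3 := hinj _ _ h2
    rw [sub_eq_zero] at h3
    exact ⟨z, hz, hzH, by rw [← h3]⟩

end IsSymmetricFlag

end SymFlag

namespace SymFlag

variable {N : ℕ}

/-! ### Homogeneous manifolds from a slice -/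

/-- A slice for the homogeneous space `K / L`, where `K` is contained in `G` and the projection of
`K` on `K / L` extends to a map `π` on `G` which is equivariant under `K`. It is a smooth map `lift`
from a vector space `V` to `G` which induces an injective map from `V` to `K / L`, such that the
inverse of the latter is locally given, on `G`, by smooth functions of the matrix coefficients. The
field `tangent` says that every direction `v` is the velocity at `0` of the curve
`s ↦ z exp(s X) L` in this coordinate, for some `X` in the Lie algebra `k` of `K`. -/
structure IsSlice {G K : Subgroup (GLN N)} (hKG : K ≤ G) (k : Submodule ℝ (Mat N)) (L : Subgroup K)
    {V : Type*} [NormedAddCommGroup V] [NormedSpace ℝ V] (π : G → K ⧸ L) (lift : V → G) : Prop where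
  contDiff_lift : ContDiff ℝ ∞ fun v => ((lift v : GLN N) : Mat N)
  continuous_lift : Continuous lift
  proj_coe : ∀ a : K, π (Subgroup.inclusion hKG a) = QuotientGroup.mk a
  proj_smul : ∀ (a : K) (x : G), π (Subgroup.inclusion hKG a * x) = a • π x
  continuous_proj_lift : Continuous fun v => π (lift v)
  lift_zero : π (lift 0) = QuotientGroup.mk 1
  injective : ∀ v w, π (lift v) = π (lift w) → v = w
  coord : ∀ x₀ v₀, π x₀ = π (lift v₀) → ∃ c : Mat N → V,
    ContDiffAt ℝ ∞ c ((x₀ : GLN N) : Mat N) ∧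
      ∀ᶠ x : G in 𝓝 x₀, π x = π (lift (c ((x : GLN N) : Mat N)))
  tangent : ∀ z ∈ L, ∀ v, ∃ X ∈ k, ∃ c : ℝ → V, HasDerivAt c v 0 ∧
    ∀ᶠ s : ℝ in 𝓝 0, ∀ a : K, (a : GLN N) = (z : GLN N) * expGL (s • X) →
      QuotientGroup.mk a = π (lift (c s))

namespace IsSlice

variable {G K : Subgroup (GLN N)} {hKG : K ≤ G} {k : Submodule ℝ (Mat N)} {L : Subgroup K}
  {V : Type*} [NormedAddCommGroup V] [NormedSpace ℝ V] {π : G → K ⧸ L} {lift : V → G}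

/-- The parametrization of an open subset of `K / L`, centered at the class of `b`. -/
def param (_ : IsSlice hKG k L π lift) (b : K) (v : V) : K ⧸ L := b • π (lift v)

theorem param_eq (hS : IsSlice hKG k L π lift) (b : K) (v : V) :
    hS.param b v = π (Subgroup.inclusion hKG b * lift v) := (hS.proj_smul b _).symm

theorem param_zero (hS : IsSlice hKG k L π lift) (b : K) :
    hS.param b 0 = QuotientGroup.mk b := by
  rw [param, hS.lift_zero, MulAction.Quotient.smul_mk, smul_eq_mul, mul_one]

theorem isOpenEmbedding_param (hS : IsSlice hKG k L π lift) (b : K) :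
    IsOpenEmbedding (hS.param b) := by
  have h1 : IsOpenEmbedding fun v => π (lift v) := by
    refine .of_continuous_injective_isOpenMap hS.continuous_proj_lift (fun v w => hS.injective v w) ?_
    rw [isOpenMap_iff_nhds_le]
    intro v₀
    obtain ⟨a, ha⟩ := QuotientGroup.mk_surjective (π (lift v₀))
    rw [← ha, ← (QuotientGroup.isOpenQuotientMap_mk (N := L)).map_nhds_eq]
    obtain ⟨c, hc, hev⟩ := hS.coord (Subgroup.inclusion hKG a) v₀ (by rw [hS.proj_coe, ha])
    have hincl : Continuous (Subgroup.inclusion hKG) :=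
      Continuous.subtype_mk continuous_subtype_val _
    have hval : Continuous fun x : G => ((x : GLN N) : Mat N) :=
      Units.continuous_val.comp continuous_subtype_val
    have hev' := (hincl.tendsto a).eventually hev
    have hv₀ : c ((Subgroup.inclusion hKG a : GLN N) : Mat N) = v₀ := by
      refine (hS.injective _ _ ?_).symm
      rw [← ha, ← hS.proj_coe]
      exact hev.self_of_nhds
    have hct : Tendsto (fun x : K => c ((Subgroup.inclusion hKG x : GLN N) : Mat N)) (𝓝 a)
        (𝓝 v₀) := by
      have := hc.continuousAt.tendsto.comp ((hval.comp hincl).tendsto a)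
      rwa [hv₀] at this
    intro s hs
    rw [mem_map] at hs ⊢
    filter_upwards [hev', hct hs] with x hx hxs
    rw [Set.mem_preimage, ← hS.proj_coe, hx]
    exact hxs
  exact (Homeomorph.smul b).isOpenEmbedding.comp h1

/-- The chart of `K / L` which is the inverse of a parametrization. -/
noncomputable def chart (hS : IsSlice hKG k L π lift) (b : K) : OpenPartialHomeomorph (K ⧸ L) V :=
  ((hS.isOpenEmbedding_param b).toOpenPartialHomeomorph (hS.param b)).symm

theorem chart_source (hS : IsSlice hKG k L π lift) (b : K) :
    (hS.chart b).source = Set.range (hS.param b) := by simp [chart]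

theorem chart_target (hS : IsSlice hKG k L π lift) (b : K) :
    (hS.chart b).target = Set.univ := by simp [chart]

theorem chart_symm_apply (hS : IsSlice hKG k L π lift) (b : K) (v : V) :
    (hS.chart b).symm v = hS.param b v := by simp [chart]

theorem chart_param (hS : IsSlice hKG k L π lift) (b : K) (v : V) :
    hS.chart b (hS.param b v) = v := by
  rw [← chart_symm_apply, (hS.chart b).right_inv]
  simp [chart_target]

theorem param_chart (hS : IsSlice hKG k L π lift) {b : K} {x : K ⧸ L}
    (hx : x ∈ Set.range (hS.param b)) : hS.param b (hS.chart b x) = x := by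
  obtain ⟨v, rfl⟩ := hx
  rw [chart_param]

/-- In the charts, the projection of a smooth family of elements of `G` is smooth. -/
theorem contDiffAt_chart (hS : IsSlice hKG k L π lift) {E : Type*} [NormedAddCommGroup E]
    [NormedSpace ℝ E] {f : E → G} {s₀ : E} (hf : ContinuousAt f s₀)
    (hf' : ContDiffAt ℝ ∞ (fun s => ((f s : GLN N) : Mat N)) s₀) {b : K}
    (hb : π (f s₀) ∈ Set.range (hS.param b)) :
    ContDiffAt ℝ ∞ (fun s => hS.chart b (π (f s))) s₀ ∧
      ∀ᶠ s in 𝓝 s₀, π (f s) ∈ Set.range (hS.param b) := by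
  obtain ⟨v₀, hv₀⟩ := hb
  let x : E → G := fun s => Subgroup.inclusion hKG b⁻¹ * f s
  have hx : ∀ s, π (x s) = b⁻¹ • π (f s) := fun s => hS.proj_smul _ _
  obtain ⟨c, hc, hev⟩ := hS.coord (x s₀) v₀ (by rw [hx, ← hv₀, param, inv_smul_smul])
  have hxc : ContinuousAt x s₀ := continuousAt_const.mul hf
  have hev' : ∀ᶠ s in 𝓝 s₀, π (f s) = hS.param b (c ((x s : GLN N) : Mat N)) := by
    filter_upwards [hxc.eventually hev] with s hs
    rw [param, ← hs, hx, smul_inv_smul]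
  have hx' : ContDiffAt ℝ ∞ (fun s => ((x s : GLN N) : Mat N)) s₀ := by
    have : (fun s => ((x s : GLN N) : Mat N)) =
        fun s => (((b⁻¹ : K) : GLN N) : Mat N) * ((f s : GLN N) : Mat N) := by
      ext1 s
      simp [x]
    rw [this]
    exact contDiffAt_const.mul hf'
  refine ⟨(hc.comp s₀ hx').congr_of_eventuallyEq ?_, ?_⟩
  · filter_upwards [hev'] with s hs
    rw [hs, chart_param]
    rfl
  · filter_upwards [hev'] with s hs
    exact ⟨_, hs.symm⟩

/-- The atlas of the homogeneous space `K / L` given by the slice. -/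
noncomputable abbrev chartedSpace (hS : IsSlice hKG k L π lift) : ChartedSpace V (K ⧸ L) where
  atlas := Set.range hS.chart
  chartAt x := hS.chart x.out
  mem_chart_source x := by
    rw [chart_source]
    exact ⟨0, by rw [param_zero, QuotientGroup.out_eq']⟩
  chart_mem_atlas x := ⟨_, rfl⟩

theorem isManifold (hS : IsSlice hKG k L π lift) :
    letI := hS.chartedSpace
    IsManifold 𝓘(ℝ, V) ∞ (K ⧸ L) := by
  let _ := hS.chartedSpace
  refine isManifold_of_contDiffOn _ _ _ ?_
  rintro _ _ ⟨b, rfl⟩ ⟨b', rfl⟩ v hv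
  simp only [OpenPartialHomeomorph.trans_source, OpenPartialHomeomorph.symm_source, chart_source,
    chart_target, modelWithCornersSelf_coe_symm, Set.preimage_id, modelWithCornersSelf_coe,
    Set.range_id, Set.inter_univ, Set.univ_inter, Set.mem_preimage, chart_symm_apply] at hv
  refine ContDiffAt.contDiffWithinAt ?_
  have h1 := hS.contDiffAt_chart (f := fun v => Subgroup.inclusion hKG b * lift v) (s₀ := v) (b := b')
    (continuous_const.mul hS.continuous_lift).continuousAt
    (by
      have : (fun v => (((Subgroup.inclusion hKG b * lift v : G) : GLN N) : Mat N)) =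
          fun v => ((b : GLN N) : Mat N) * ((lift v : GLN N) : Mat N) := by
        ext1 v
        simp
      rw [this]
      exact contDiffAt_const.mul hS.contDiff_lift.contDiffAt)
    (by rwa [← hS.param_eq])
  refine h1.1.congr_of_eventuallyEq (Eventually.of_forall fun w => ?_)
  change hS.chart b' ((hS.chart b).symm w) = _
  rw [chart_symm_apply, param_eq]

theorem contMDiff_param (hS : IsSlice hKG k L π lift) (b : K) :
    letI := hS.chartedSpace
    ContMDiff 𝓘(ℝ, V) 𝓘(ℝ, V) ∞ (hS.param b) := by
  let _ := hS.chartedSpace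
  have := hS.isManifold
  have h1 := contMDiffOn_symm_of_mem_maximalAtlas (I := 𝓘(ℝ, V)) (n := ∞)
    (IsManifold.subset_maximalAtlas ⟨b, rfl⟩ :
      hS.chart b ∈ IsManifold.maximalAtlas 𝓘(ℝ, V) ∞ (K ⧸ L))
  rw [chart_target, contMDiffOn_univ] at h1
  exact h1.congr fun v => (hS.chart_symm_apply b v).symm

theorem contMDiffOn_chart (hS : IsSlice hKG k L π lift) (b : K) :
    letI := hS.chartedSpace
    ContMDiffOn 𝓘(ℝ, V) 𝓘(ℝ, V) ∞ (hS.chart b) (Set.range (hS.param b)) := by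
  let _ := hS.chartedSpace
  have := hS.isManifold
  have h1 := contMDiffOn_of_mem_maximalAtlas (I := 𝓘(ℝ, V)) (n := ∞)
    (IsManifold.subset_maximalAtlas ⟨b, rfl⟩ :
      hS.chart b ∈ IsManifold.maximalAtlas 𝓘(ℝ, V) ∞ (K ⧸ L))
  rwa [chart_source] at h1

theorem contMDiffAt_proj (hS : IsSlice hKG k L π lift) {E : Type*} [NormedAddCommGroup E]
    [NormedSpace ℝ E] {f : E → G} {s₀ : E} (hf : ContinuousAt f s₀)
    (hf' : ContDiffAt ℝ ∞ (fun s => ((f s : GLN N) : Mat N)) s₀) {a : K} (ha : π (f s₀) = a) :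
    letI := hS.chartedSpace
    ContMDiffAt 𝓘(ℝ, E) 𝓘(ℝ, V) ∞ (fun s => π (f s)) s₀ := by
  let _ := hS.chartedSpace
  obtain ⟨h1, h2⟩ := hS.contDiffAt_chart hf hf' (b := a) ⟨0, by rw [param_zero, ha]⟩
  refine (((hS.contMDiff_param a).contMDiffAt).comp s₀ h1.contMDiffAt).congr_of_eventuallyEq ?_
  filter_upwards [h2] with s hs
  exact (hS.param_chart hs).symm

theorem isHomogeneousManifold (hS : IsSlice hKG k L π lift) (hk : IsLieAlgebraOf K k) :
    letI := hS.chartedSpace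
    IsHomogeneousManifold hk L V := by
  let _ := hS.chartedSpace
  have hman := hS.isManifold
  have hfun : ∀ (r : ℕ) (X : Module.Basis (Fin r) ℝ k) (a : K), ∃ f : EuclideanSpace ℝ (Fin r) → G,
      Continuous f ∧ ContDiff ℝ ∞ (fun s => ((f s : GLN N) : Mat N)) ∧
        ∀ s, expCoset hk L a (∑ i, s i • X i) = π (f s) := by
    intro r X a
    let l : EuclideanSpace ℝ (Fin r) →ₗ[ℝ] Mat N :=
      k.subtype ∘ₗ X.equivFun.symm.toLinearMap ∘ₗ (WithLp.linearEquiv 2 ℝ (Fin r → ℝ)).toLinearMap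
    have hl : ∀ s, l s = ((∑ i, s i • X i : k) : Mat N) := fun s => by
      simp [l, Module.Basis.equivFun_symm_apply]
    have hlc : ContDiff ℝ ∞ l := (LinearMap.toContinuousLinearMap l).contDiff
    refine ⟨fun s => Subgroup.inclusion hKG (a * ⟨expGL (l s), hl s ▸ hk.exp_mem (Subtype.mem _)⟩),
      ?_, ?_, fun s => ?_⟩
    · have h1 : Continuous fun s => (a : GLN N) * expGL (l s) :=
        continuous_const.mul (continuous_expGL.comp hlc.continuous)
      exact h1.subtype_mk _
    · have h1 : ContDiff ℝ ∞ fun s => ((a : GLN N) : Mat N) * NormedSpace.exp (l s) :=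
        contDiff_const.mul (contDiff_exp.comp hlc)
      exact h1
    · rw [hS.proj_coe, expCoset]
      simp only [hl]
  refine ⟨hman, fun r X a => ?_, fun r X a => ?_⟩
  · obtain ⟨f, hf, hf', hfe⟩ := hfun r X a
    intro s₀
    obtain ⟨a₀, ha₀⟩ := QuotientGroup.mk_surjective (π (f s₀))
    have := hS.contMDiffAt_proj hf.continuousAt hf'.contDiffAt ha₀.symm
    exact this.congr_of_eventuallyEq (Eventually.of_forall hfe)
  · obtain ⟨f, hf, hf', hfe⟩ := hfun r X a
    set F := fun s : EuclideanSpace ℝ (Fin r) => expCoset hk L a (∑ i, s i • X i) with hFdef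
    have hFf : F = fun s => π (f s) := funext hfe
    have hF0 : F 0 = QuotientGroup.mk a := by
      simp only [hFdef, expCoset]
      congr 1
      rw [mul_eq_left]
      apply Subtype.ext
      simp
    set b := (F 0).out with hb
    have hFb : F 0 = hS.param b 0 := by rw [param_zero, hb, QuotientGroup.out_eq']
    have hch : chartAt V (F 0) = hS.chart b := rfl
    have hmd : MDifferentiableAt 𝓘(ℝ, EuclideanSpace ℝ (Fin r)) 𝓘(ℝ, V) F 0 := by
      have := hS.contMDiffAt_proj hf.continuousAt (hf'.contDiffAt (x := 0)) (a := a)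
        (by rw [← hF0, hFf])
      rw [hFf]
      exact this.mdifferentiableAt (by simp)
    have hder : mfderiv 𝓘(ℝ, EuclideanSpace ℝ (Fin r)) 𝓘(ℝ, V) F 0 =
        fderiv ℝ (fun s => hS.chart b (F s)) 0 := by
      rw [hmd.mfderiv]
      simp only [writtenInExtChartAt, extChartAt, mfld_simps, hch]
      exact congrFun fderivWithin_univ 0
    have hdiff : DifferentiableAt ℝ (fun s => hS.chart b (F s)) 0 := by
      have := (hS.contDiffAt_chart hf.continuousAt (hf'.contDiffAt (x := 0)) (b := b)
        ⟨0, by rw [← hFb, hFf]⟩).1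
      rw [hFf]
      exact this.differentiableAt (by simp)
    rw [hder]
    have hz : b⁻¹ * a ∈ L := by
      rw [← QuotientGroup.eq, ← hF0, hb, QuotientGroup.out_eq']
    intro v
    obtain ⟨Y, hY, c, hc, hev⟩ := hS.tangent _ hz v
    let σ : EuclideanSpace ℝ (Fin r) := WithLp.toLp 2 (X.equivFun ⟨Y, hY⟩)
    have hσ : ∀ s : ℝ, ((∑ i, (s • σ) i • X i : k) : Mat N) = s • Y := by
      intro s
      have : ∑ i, (s • σ) i • X i = s • (⟨Y, hY⟩ : k) := by
        simp only [PiLp.smul_apply, smul_eq_mul, mul_smul, ← Finset.smul_sum]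
        congr 1
        exact X.sum_equivFun ⟨Y, hY⟩
      rw [this]; rfl
    refine ⟨σ, ?_⟩
    have h1 : HasDerivAt (fun s : ℝ => s • σ) σ 0 := by
      simpa using (hasDerivAt_id (0 : ℝ)).smul_const σ
    have h2 : HasDerivAt (fun s : ℝ => hS.chart b (F (s • σ)))
        (fderiv ℝ (fun s => hS.chart b (F s)) 0 σ) 0 := by
      have h3 : HasFDerivAt (fun s => hS.chart b (F s)) (fderiv ℝ (fun s => hS.chart b (F s)) 0)
          ((0 : ℝ) • σ) := by rw [zero_smul]; exact hdiff.hasFDerivAt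
      exact h3.comp_hasDerivAt (0 : ℝ) h1
    have h4 : HasDerivAt (fun s : ℝ => hS.chart b (F (s • σ))) v 0 := by
      refine hc.congr_of_eventuallyEq ?_
      filter_upwards [hev] with s hs
      have h5 : F (s • σ) = hS.param b (c s) := by
        rw [param, ← hs (b⁻¹ * (a * ⟨expGL ((∑ i, (s • σ) i • X i : k) : Mat N),
          hk.exp_mem (Subtype.mem _)⟩)) (by simp only [hσ]; simp [mul_assoc])]
        rw [MulAction.Quotient.smul_mk, smul_eq_mul, mul_inv_cancel_left]
        rfl
      rw [h5, chart_param]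
    exact h2.unique h4

end IsSlice

end SymFlag

namespace SymFlag

variable {N : ℕ}

/-! ### The slices of the flag manifold and of the adjoint orbit -/

theorem hasDerivAt_exp_mul (S : Mat N) (x : GLN N) :
    HasDerivAt (fun s : ℝ => ((expGL (s • S) * x : GLN N) : Mat N)) (S * (x : Mat N)) 0 := by
  have h := (hasDerivAt_exp_smul_const S (0 : ℝ)).mul_const (x : Mat N)
  simpa using h

theorem expGL_mul_coe_tendsto (S : Mat N) (x : GLN N) :
    Tendsto (fun s : ℝ => ((expGL (s • S) * x : GLN N) : Mat N)) (𝓝 0) (𝓝 (x : Mat N)) := by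
  have h := (hasDerivAt_exp_mul S x).continuousAt.tendsto
  simpa using h

namespace IsSymmetricFlag

variable {G U P : Subgroup (GLN N)} {g : LieSubalgebra ℂ (Mat N)}
  {u : LieSubalgebra ℝ (Mat N)} {H : Mat N} {R : GLN N}

/-- The differential of the coordinate of `exists_coord` at a point of `P` is the projection on the
opposite nilradical, since the coordinate vanishes on `P` and is the logarithm on `N⁻`. -/
theorem hasDerivAt_coord (hF : IsSymmetricFlag G U P g u H R) {p₀ : GLN N} (hp₀ : p₀ ∈ P)
    {c : Mat N → realPiece g H (-1)} (hc : DifferentiableAt ℝ c (p₀ : Mat N))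
    (hev : ∀ᶠ m : Mat N in 𝓝 (p₀ : Mat N), ∀ (Y : realPiece g H (-1)), ∀ p ∈ P,
        m = (expGL (Y : Mat N) * p : GLN N) → Y = c m) {S : Mat N} (hS : S ∈ g) :
    HasDerivAt (fun s : ℝ => c (expGL (s • S) * p₀ : GLN N))
      (⟨projNeg H S, hF.projNeg_mem hS⟩ : realPiece g H (-1)) 0 := by
  set D := fderiv ℝ c (p₀ : Mat N) with hD
  have key : ∀ S : Mat N, HasDerivAt (fun s : ℝ => c (expGL (s • S) * p₀ : GLN N))
      (D (S * (p₀ : Mat N))) 0 := by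
    intro S
    have h1 : HasFDerivAt c D ((expGL ((0 : ℝ) • S) * p₀ : GLN N) : Mat N) := by
      simpa using hc.hasFDerivAt
    exact h1.comp_hasDerivAt (0 : ℝ) (hasDerivAt_exp_mul S p₀)
  have hneg : ∀ Y : realPiece g H (-1), D ((Y : Mat N) * (p₀ : Mat N)) = Y := by
    intro Y
    have h1 : HasDerivAt (fun s : ℝ => s • Y) Y 0 := by
      simpa using (hasDerivAt_id (0 : ℝ)).smul_const Y
    refine ((key Y).congr_of_eventuallyEq ?_).unique h1
    filter_upwards [(expGL_mul_coe_tendsto (Y : Mat N) p₀).eventually hev] with s hs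
    exact hs (s • Y) p₀ hp₀ rfl
  have hnn : ∀ B ∈ nonnegPart g H, D (B * (p₀ : Mat N)) = 0 := by
    intro B hB
    refine ((key B).congr_of_eventuallyEq ?_).unique (hasDerivAt_const (0 : ℝ) (0 : realPiece g H (-1)))
    filter_upwards [(expGL_mul_coe_tendsto B p₀).eventually hev] with s hs
    refine hs 0 (expGL (s • B) * p₀) (P.mul_mem (hF.exp_mem_P ?_) hp₀) (by simp)
    exact hF.nonnegSubmodule.smul_mem s hB
  have h2 := key S
  have h3 : S * (p₀ : Mat N) = projNeg H S * (p₀ : Mat N) +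
      (projZero H S + projPos H S) * (p₀ : Mat N) := by
    rw [← add_mul, ← add_assoc, projNeg_add_projZero_add_projPos]
  rw [h3, map_add, hnn _ (hF.nonnegSubmodule.add_mem
    (hF.mem_nonnegPart_of_mem (Or.inl rfl) (hF.projZero_mem hS))
    (hF.mem_nonnegPart_of_mem (Or.inr rfl) (hF.projPos_mem hS))), add_zero] at h2
  rwa [hneg ⟨projNeg H S, hF.projNeg_mem hS⟩] at h2

theorem exists_flag (hF : IsSymmetricFlag G U P g u H R) (x : G) :
    ∃ a : U, (a : GLN N)⁻¹ * x ∈ P := by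
  obtain ⟨a, ha, p, hp, h⟩ := hF.exists_eq_mul x.2
  exact ⟨⟨a, ha⟩, by rw [h]; simpa using hp⟩

/-- The projection `G → G / P = U / (U ∩ P)`. -/
noncomputable def flagProj (hF : IsSymmetricFlag G U P g u H R) (x : G) : U ⧸ P.subgroupOf U :=
  QuotientGroup.mk (hF.exists_flag x).choose

theorem flagProj_eq_iff (hF : IsSymmetricFlag G U P g u H R) {x : G} {a : U} :
    hF.flagProj x = QuotientGroup.mk a ↔ (a : GLN N)⁻¹ * x ∈ P := by
  have h := (hF.exists_flag x).choose_spec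
  rw [flagProj, QuotientGroup.eq, Subgroup.mem_subgroupOf]
  set y := (hF.exists_flag x).choose
  have e : (a : GLN N)⁻¹ * x = (((y⁻¹ * a : U) : GLN N))⁻¹ * ((y : GLN N)⁻¹ * x) := by
    push_cast; group
  rw [e, P.mul_mem_cancel_right h, P.inv_mem_iff]

theorem flagProj_eq_flagProj (hF : IsSymmetricFlag G U P g u H R) {x y : G} :
    hF.flagProj x = hF.flagProj y ↔ (x : GLN N)⁻¹ * y ∈ P := by
  obtain ⟨a, ha⟩ := QuotientGroup.mk_surjective (hF.flagProj x)
  have h := hF.flagProj_eq_iff.1 ha.symm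
  rw [← ha, eq_comm, hF.flagProj_eq_iff]
  have e : (a : GLN N)⁻¹ * y = ((a : GLN N)⁻¹ * x) * ((x : GLN N)⁻¹ * y) := by group
  rw [e, P.mul_mem_cancel_left h]

/-- The lift to `N⁻` of the slice of the flag manifold. -/
noncomputable def flagLift (hF : IsSymmetricFlag G U P g u H R) (Y : realPiece g H (-1)) : G :=
  ⟨expGL (Y : Mat N), hF.exp_mem_G Y.2.1⟩

/-- The lift to `N⁻ N⁺` of the slice of the adjoint orbit of `H`. -/
noncomputable def orbitLift (hF : IsSymmetricFlag G U P g u H R) (Y : realPiece g H (-1))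
    (X : realPiece g H 1) : G :=
  ⟨expGL (Y : Mat N) * expGL (X : Mat N), G.mul_mem (hF.exp_mem_G Y.2.1) (hF.exp_mem_G X.2.1)⟩

theorem flagProj_smul (hF : IsSymmetricFlag G U P g u H R) (a : U) (x : G) :
    hF.flagProj (Subgroup.inclusion hF.groupU.le a * x) = a • hF.flagProj x := by
  obtain ⟨b, hb⟩ := QuotientGroup.mk_surjective (hF.flagProj x)
  have h := hF.flagProj_eq_iff.1 hb.symm
  rw [← hb, MulAction.Quotient.smul_mk, hF.flagProj_eq_iff]
  simpa [mul_assoc] using h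

theorem flagProj_flagLift_eq_iff (hF : IsSymmetricFlag G U P g u H R) {x : G}
    {Y : realPiece g H (-1)} :
    hF.flagProj x = hF.flagProj (hF.flagLift Y) ↔ ∃ p ∈ P, (x : GLN N) = expGL (Y : Mat N) * p := by
  rw [eq_comm, hF.flagProj_eq_flagProj]
  refine ⟨fun h => ⟨_, h, by simp [flagLift]⟩, ?_⟩
  rintro ⟨p, hp, h⟩
  simpa [flagLift, h] using hp

/-- The map `a (U ∩ P) ↦ Ad(a) H` from the flag manifold to the adjoint orbit of `H` under `U`. -/
noncomputable def orbitMap (hF : IsSymmetricFlag G U P g u H R) (x : U ⧸ P.subgroupOf U) : Mat N :=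
  Quotient.liftOn' x (fun a => Ad (a : GLN N) H) fun a b h => by
    rw [QuotientGroup.leftRel_apply, Subgroup.mem_subgroupOf,
      hF.mem_P_iff_of_mem_U (a⁻¹ * b).2] at h
    calc Ad (a : GLN N) H = Ad (a : GLN N) (Ad ((a⁻¹ * b : U) : GLN N) H) := by rw [h]
      _ = Ad (b : GLN N) H := by rw [← Ad_mul]; simp

theorem orbitMap_mk (hF : IsSymmetricFlag G U P g u H R) (a : U) :
    hF.orbitMap (QuotientGroup.mk a) = Ad (a : GLN N) H := rfl

/-- As `U` is compact, the flag manifold is homeomorphic to the orbit of `H` under `U`. -/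
theorem isEmbedding_orbitMap (hF : IsSymmetricFlag G U P g u H R) :
    IsEmbedding hF.orbitMap := by
  have : CompactSpace U := isCompact_iff_compactSpace.1 hF.groupU.compact
  have hcont : Continuous hF.orbitMap := by
    have h1 : Continuous fun a : U => Ad (a : GLN N) H :=
      continuous_Ad.comp (f := fun a : U => ((a : GLN N), H))
        (continuous_subtype_val.prodMk continuous_const)
    exact h1.quotient_liftOn' _
  have hinj : Function.Injective hF.orbitMap := by
    intro x y h
    obtain ⟨a, rfl⟩ := QuotientGroup.mk_surjective x
    obtain ⟨b, rfl⟩ := QuotientGroup.mk_surjective y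
    rw [orbitMap_mk, orbitMap_mk] at h
    rw [QuotientGroup.eq, Subgroup.mem_subgroupOf, hF.mem_P_iff_of_mem_U (a⁻¹ * b).2,
      Subgroup.coe_mul, Ad_mul, ← h, Subgroup.coe_inv, Ad_inv_Ad]
  exact (hcont.isClosedEmbedding hinj).isEmbedding

/-- The slice `Y ↦ exp(Y) P` of the flag manifold, where `ι` is a choice of linear coordinates on
the opposite nilradical. -/
theorem isSlice_flag (hF : IsSymmetricFlag G U P g u H R) {V : Type*} [NormedAddCommGroup V]
    [NormedSpace ℝ V] (ι : V ≃L[ℝ] realPiece g H (-1)) :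
    IsSlice hF.groupU.le u.toSubmodule (P.subgroupOf U) hF.flagProj
      (fun v => hF.flagLift (ι v)) where
  contDiff_lift :=
    contDiff_exp.comp ((realPiece g H (-1)).subtypeL.contDiff.comp ι.contDiff)
  continuous_lift :=
    (continuous_expGL.comp (continuous_subtype_val.comp ι.continuous)).subtype_mk _
  proj_coe a := by
    rw [hF.flagProj_eq_iff]
    simp
  proj_smul := hF.flagProj_smul
  continuous_proj_lift := by
    obtain ⟨X, hX, -, hXU⟩ := hF.exists_radial
    rw [hF.isEmbedding_orbitMap.continuous_iff]
    have h1 : Continuous fun v => Ad (expGL (ι v : Mat N)) (Ad (expGL (X (ι v) : Mat N)) H) := by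
      have h2 : Continuous fun v => expGL (X (ι v) : Mat N) :=
        continuous_expGL.comp (continuous_subtype_val.comp (hX.continuous.comp ι.continuous))
      have h3 : Continuous fun v => expGL (ι v : Mat N) :=
        continuous_expGL.comp (continuous_subtype_val.comp ι.continuous)
      have h4 : Continuous fun v => Ad (expGL (X (ι v) : Mat N)) H :=
        continuous_Ad.comp (f := fun v => (expGL (X (ι v) : Mat N), H))
          (h2.prodMk continuous_const)
      exact continuous_Ad.comp
        (f := fun v => (expGL (ι v : Mat N), Ad (expGL (X (ι v) : Mat N)) H)) (h3.prodMk h4)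
    refine h1.congr fun v => ?_
    obtain ⟨a, ha⟩ := QuotientGroup.mk_surjective (hF.flagProj (hF.flagLift (ι v)))
    have h2 := hF.flagProj_eq_iff.1 ha.symm
    obtain ⟨z, -, hz, h3⟩ := hXU (ι v) (((a : GLN N)⁻¹ * (hF.flagLift (ι v) : GLN N))⁻¹)
      (P.inv_mem h2) (by simp [flagLift])
    simp only [Function.comp_apply]
    rw [← ha, orbitMap_mk]
    have h4 : (a : GLN N) = expGL (ι v : Mat N) * (expGL (X (ι v) : Mat N) * z) := by
      rw [← h3]; simp [flagLift]
    rw [h4, Ad_mul, Ad_mul, hz]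
  lift_zero := by
    rw [hF.flagProj_eq_iff]
    simp [flagLift]
  injective v w h := by
    rw [hF.flagProj_flagLift_eq_iff] at h
    obtain ⟨p, hp, h⟩ := h
    have := (hF.exp_neg_mul_injective (ι v).2 (ι w).2 P.one_mem hp (by simpa [flagLift] using h)).1
    exact ι.injective (Subtype.ext this)
  coord x₀ v₀ h := by
    obtain ⟨p, hp, h⟩ := hF.flagProj_flagLift_eq_iff.1 h
    obtain ⟨c, hc, hev⟩ := hF.exists_coord (ι v₀).2 hp
    rw [← h] at hc hev
    refine ⟨fun m => ι.symm (c m), ι.symm.contDiff.contDiffAt.comp _ hc, ?_⟩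
    have hval : Continuous fun x : G => ((x : GLN N) : Mat N) :=
      Units.continuous_val.comp continuous_subtype_val
    filter_upwards [(hval.tendsto x₀).eventually hev, (continuous_subtype_val.tendsto x₀).eventually
      (hF.eventually_eq_exp_neg_mul ⟨_, (ι v₀).2, p, hp, h⟩)] with x hx hx'
    obtain ⟨Y, hY, q, hq, hxq⟩ := hx' x.2
    have h1 := hx ⟨Y, hY⟩ q hq (by rw [hxq])
    rw [ι.apply_symm_apply, ← h1, hF.flagProj_flagLift_eq_iff]
    exact ⟨q, hq, hxq⟩
  tangent z hz v := by
    have hzP : (z : GLN N) ∈ P := hz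
    have hY := (ι v).2
    have hs := hF.hstar_mem_gradedPiece hY
    have hB : (ι v : Mat N) - hstar R (ι v : Mat N) ∈ u := by
      refine hF.mem_u_of_hstar (g.sub_mem hY.1 hs.1) ?_
      rw [hstar_sub, hstar_hstar, neg_sub]
    set B := (ι v : Mat N) - hstar R (ι v : Mat N) with hBdef
    obtain ⟨c, hc, hev⟩ := hF.exists_coord (Submodule.zero_mem _) hzP
    simp only [expGL_zero, one_mul] at hc hev
    refine ⟨Ad (z : GLN N)⁻¹ B, hF.groupU.lie.Ad_mem (U.inv_mem z.2) (X := B) hB,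
      fun s => ι.symm (c (expGL (s • B) * (z : GLN N) : GLN N)), ?_, ?_⟩
    · have h1 := hF.hasDerivAt_coord hzP (hc.differentiableAt (by simp)) hev
        (hF.groupU.mem_of_mem hB)
      have h2 := ι.symm.hasFDerivAt.comp_hasDerivAt (0 : ℝ) h1
      have h3 : (⟨projNeg H B, hF.projNeg_mem (hF.groupU.mem_of_mem hB)⟩ : realPiece g H (-1)) =
          ι v := by
        apply Subtype.ext
        change projNeg H B = _
        rw [hBdef, map_sub, projNeg_of_mem hY, projNeg_of_mem hs]
        push_cast
        module
      rw [h3] at h2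
      have h4 : (ι.symm : realPiece g H (-1) →L[ℝ] V) (ι v) = v := ι.symm_apply_apply v
      rw [h4] at h2
      exact h2
    · have hzG : ∃ Y ∈ gradedPiece g piI H (-1), ∃ p ∈ P, (z : GLN N) = expGL Y * p :=
        ⟨0, Submodule.zero_mem _, z, hzP, by simp⟩
      have ht : Tendsto (fun s : ℝ => expGL (s • B) * (z : GLN N)) (𝓝 0) (𝓝 (z : GLN N)) :=
        ((continuous_expGL.comp (continuous_id.smul continuous_const)).mul
          continuous_const).tendsto' _ _ (by simp)
      filter_upwards [(expGL_mul_coe_tendsto B (z : GLN N)).eventually hev,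
        ht.eventually (hF.eventually_eq_exp_neg_mul hzG)] with s hs hs' a ha
      have ha' : (a : GLN N) = expGL (s • B) * (z : GLN N) := by
        rw [ha, ← Ad_smul_real, expGL_Ad]
        group
      obtain ⟨Y, hY, q, hq, hxq⟩ := hs' (by rw [← ha']; exact hF.groupU.le a.2)
      have h1 := hs ⟨Y, hY⟩ q hq (by rw [hxq])
      rw [ι.apply_symm_apply, ← h1, eq_comm, hF.flagProj_eq_iff, ha', hxq]
      simpa [flagLift] using hq

theorem mk_eq_mk_orbitLift_iff (hF : IsSymmetricFlag G U P g u H R) {x : G}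
    {Y : realPiece g H (-1)} {X : realPiece g H 1} :
    (QuotientGroup.mk x : G ⧸ centralizerIn G H) = QuotientGroup.mk (hF.orbitLift Y X) ↔
      ∃ p ∈ P, (x : GLN N) = expGL (Y : Mat N) * p ∧ Ad p H = H - piI • (X : Mat N) := by
  have key : (QuotientGroup.mk x : G ⧸ centralizerIn G H) = QuotientGroup.mk (hF.orbitLift Y X) ↔
      Ad (x : GLN N) H = Ad (expGL (Y : Mat N)) (Ad (expGL (X : Mat N)) H) := by
    rw [eq_comm, QuotientGroup.eq]
    change Ad (((hF.orbitLift Y X)⁻¹ * x : G) : GLN N) H = H ↔ _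
    rw [Subgroup.coe_mul, Subgroup.coe_inv, Ad_mul]
    change Ad (expGL (Y : Mat N) * expGL (X : Mat N))⁻¹ _ = _ ↔ _
    rw [← Ad_mul (expGL (Y : Mat N))]
    constructor
    · intro h
      rw [← Ad_Ad_inv (expGL (Y : Mat N) * expGL (X : Mat N)) (Ad (x : GLN N) H), h]
    · intro h
      rw [h, Ad_inv_Ad]
  rw [key, hF.Ad_exp_pos_H X.2]
  constructor
  · intro h
    have h1 : Ad ((expGL (Y : Mat N))⁻¹ * (x : GLN N)) H = H - piI • (X : Mat N) := by
      rw [Ad_mul, h, Ad_inv_Ad]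
    refine ⟨(expGL (Y : Mat N))⁻¹ * x, ?_, by group, h1⟩
    rw [hF.mem_P_iff, h1, sub_sub_cancel_left]
    exact ⟨G.mul_mem (G.inv_mem (hF.exp_mem_G Y.2.1)) x.2,
      Submodule.neg_mem _ (Submodule.smul_mem _ _ X.2)⟩
  · rintro ⟨p, -, h1, h2⟩
    rw [h1, Ad_mul, h2]

/-- The slice `(Y, X) ↦ exp(Y) exp(X) Z` of the adjoint orbit of `H`. -/
theorem isSlice_orbit (hF : IsSymmetricFlag G U P g u H R) {V : Type*} [NormedAddCommGroup V]
    [NormedSpace ℝ V] (ι : V ≃L[ℝ] realPiece g H (-1) × realPiece g H 1) :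
    IsSlice (le_refl G) (g.toSubmodule.restrictScalars ℝ) (centralizerIn G H) QuotientGroup.mk
      (fun v => hF.orbitLift (ι v).1 (ι v).2) := by
  have hlift : Continuous fun v => hF.orbitLift (ι v).1 (ι v).2 := by
    refine Continuous.subtype_mk (.mul ?_ ?_) _
    · exact continuous_expGL.comp (continuous_subtype_val.comp (continuous_fst.comp ι.continuous))
    · exact continuous_expGL.comp (continuous_subtype_val.comp (continuous_snd.comp ι.continuous))
  have hinj : ∀ v w, (QuotientGroup.mk (hF.orbitLift (ι v).1 (ι v).2) : G ⧸ centralizerIn G H) =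
      QuotientGroup.mk (hF.orbitLift (ι w).1 (ι w).2) → v = w := by
    intro v w h
    obtain ⟨p, hp, h1, h2⟩ := hF.mk_eq_mk_orbitLift_iff.1 h
    obtain ⟨h3, h4⟩ := hF.exp_neg_mul_injective (ι v).1.2 (ι w).1.2
      (hF.exp_pos_mem_P (ι v).2.2) hp h1
    rw [← h4, hF.Ad_exp_pos_H (ι v).2.2, sub_right_inj] at h2
    exact ι.injective (Prod.ext (Subtype.ext h3)
      (Subtype.ext (smul_right_injective _ piI_ne_zero h2)))
  have hcoord : ∀ (x₀ : G) v₀, (QuotientGroup.mk x₀ : G ⧸ centralizerIn G H) =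
      QuotientGroup.mk (hF.orbitLift (ι v₀).1 (ι v₀).2) → ∃ c : Mat N → V,
      ContDiffAt ℝ ∞ c ((x₀ : GLN N) : Mat N) ∧ ∀ᶠ x : G in 𝓝 x₀,
        (QuotientGroup.mk x : G ⧸ centralizerIn G H) =
          QuotientGroup.mk (hF.orbitLift (ι (c ((x : GLN N) : Mat N))).1
            (ι (c ((x : GLN N) : Mat N))).2) := by
    intro x₀ v₀ h
    obtain ⟨p, hp, h, -⟩ := hF.mk_eq_mk_orbitLift_iff.1 h
    obtain ⟨c, hc, hev⟩ := hF.exists_coord (ι v₀).1.2 hp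
    rw [← h] at hc hev
    have hker : LinearMap.ker (realPiece g H 1).subtype = ⊥ := Submodule.ker_subtype _
    obtain ⟨r, hr⟩ := LinearMap.exists_leftInverse_of_injective _ hker
    let r' : Mat N →L[ℝ] realPiece g H 1 := LinearMap.toContinuousLinearMap r
    have hr' : ∀ X : realPiece g H 1, r' (X : Mat N) = X := fun X => LinearMap.congr_fun hr X
    -- for `x = exp(Y) p`, the coordinate `X` is read off from `Ad(exp(-Y) x) H = H - π i X`
    let f : Mat N → Mat N := fun m => piI⁻¹ • (H - NormedSpace.exp (-(c m : Mat N)) *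
      (m * H * Ring.inverse m) * NormedSpace.exp (c m : Mat N))
    have hf : ContDiffAt ℝ ∞ f ((x₀ : GLN N) : Mat N) := by
      have h1 : ContDiffAt ℝ ∞ (fun m => (c m : Mat N)) ((x₀ : GLN N) : Mat N) :=
        (realPiece g H (-1)).subtypeL.contDiff.contDiffAt.comp _ hc
      have h2 : ContDiffAt ℝ ∞ (fun m => NormedSpace.exp (c m : Mat N)) ((x₀ : GLN N) : Mat N) :=
        contDiff_exp.contDiffAt.comp _ h1
      have h3 : ContDiffAt ℝ ∞ (fun m => NormedSpace.exp (-(c m : Mat N)))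
          ((x₀ : GLN N) : Mat N) := contDiff_exp.contDiffAt.comp _ h1.neg
      exact (contDiffAt_const.sub
        ((h3.mul (contDiffAt_conj (x₀ : GLN N) H)).mul h2)).const_smul piI⁻¹
    refine ⟨fun m => ι.symm (c m, r' (f m)), ι.symm.contDiff.contDiffAt.comp _
      (hc.prodMk (r'.contDiff.contDiffAt.comp _ hf)), ?_⟩
    have hval : Continuous fun x : G => ((x : GLN N) : Mat N) :=
      Units.continuous_val.comp continuous_subtype_val
    filter_upwards [(hval.tendsto x₀).eventually hev, (continuous_subtype_val.tendsto x₀).eventually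
      (hF.eventually_eq_exp_neg_mul ⟨_, (ι v₀).1.2, p, hp, h⟩)] with x hx hx'
    obtain ⟨Y, hY, q, hq, hxq⟩ := hx' x.2
    have h1 := hx ⟨Y, hY⟩ q hq (by rw [hxq])
    obtain ⟨X, hX, z, hz, hzH, hqX⟩ := hF.exists_eq_exp_mul (hF.P_le hq) (hF.Ad_H_sub_mem hq)
    have h2 : Ad q H = H - piI • X := by rw [hqX, Ad_mul, hzH, hF.Ad_exp_pos_H hX]
    have h3 : f ((x : GLN N) : Mat N) = X := by
      have e : NormedSpace.exp (-(c ((x : GLN N) : Mat N) : Mat N)) *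
          (((x : GLN N) : Mat N) * H * Ring.inverse ((x : GLN N) : Mat N)) *
          NormedSpace.exp (c ((x : GLN N) : Mat N) : Mat N) = H - piI • X := by
        rw [conj_coe, ← h1, ← h2, hxq, Ad_mul]
        exact Ad_inv_Ad (expGL Y) _
      simp only [f]
      rw [e, sub_sub_cancel, smul_smul, inv_mul_cancel₀ piI_ne_zero, one_smul]
    rw [ι.apply_symm_apply, ← h1, h3, hr' ⟨X, hX⟩, hF.mk_eq_mk_orbitLift_iff]
    exact ⟨q, hq, hxq, h2⟩
  refine ⟨?_, hlift, fun a => rfl, fun a x => rfl, QuotientGroup.continuous_mk.comp hlift, ?_, hinj,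
    hcoord, ?_⟩
  · have h1 : ContDiff ℝ ∞ fun v => NormedSpace.exp ((ι v).1 : Mat N) := contDiff_exp.comp
      ((realPiece g H (-1)).subtypeL.contDiff.comp (contDiff_fst.comp ι.contDiff))
    have h2 : ContDiff ℝ ∞ fun v => NormedSpace.exp ((ι v).2 : Mat N) := contDiff_exp.comp
      ((realPiece g H 1).subtypeL.contDiff.comp (contDiff_snd.comp ι.contDiff))
    exact h1.mul h2
  · congr 1
    apply Subtype.ext
    simp [orbitLift]
  · intro z hz v
    have hzH : Ad (z : GLN N) H = H := hz
    have hzP := hF.mem_P_of_centralizer z.2 hzH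
    have hz0 : (QuotientGroup.mk z : G ⧸ centralizerIn G H) =
        QuotientGroup.mk (hF.orbitLift (ι 0).1 (ι 0).2) := by
      rw [hF.mk_eq_mk_orbitLift_iff]
      exact ⟨z, hzP, by simp, by simpa using hzH⟩
    obtain ⟨c, hc, hev⟩ := hcoord z 0 hz0
    set D := fderiv ℝ c ((z : GLN N) : Mat N) with hD
    have hmem : ∀ S ∈ g, ∀ s : ℝ, expGL (s • S) * (z : GLN N) ∈ G := fun S hS s =>
      G.mul_mem ((hF.groupG.lie S).1 hS s) z.2
    have key : ∀ S : Mat N, HasDerivAt (fun s : ℝ => c (expGL (s • S) * (z : GLN N) : GLN N))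
        (D (S * ((z : GLN N) : Mat N))) 0 := by
      intro S
      have h1 : HasFDerivAt c D ((expGL ((0 : ℝ) • S) * (z : GLN N) : GLN N) : Mat N) := by
        simpa using (hc.differentiableAt (by simp)).hasFDerivAt
      exact h1.comp_hasDerivAt (0 : ℝ) (hasDerivAt_exp_mul S (z : GLN N))
    have hev' : ∀ S (hS : S ∈ g), ∀ᶠ s : ℝ in 𝓝 0,
        (QuotientGroup.mk ⟨_, hmem S hS s⟩ : G ⧸ centralizerIn G H) =
          QuotientGroup.mk (hF.orbitLift (ι (c (expGL (s • S) * (z : GLN N) : GLN N))).1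
            (ι (c (expGL (s • S) * (z : GLN N) : GLN N))).2) := by
      intro S hS
      have h1 : Continuous fun s : ℝ => (⟨_, hmem S hS s⟩ : G) :=
        ((continuous_expGL.comp (continuous_id.smul continuous_const)).mul
          continuous_const).subtype_mk _
      exact (h1.tendsto' 0 z (Subtype.ext (by simp))).eventually hev
    have hcomp : ∀ (S : Mat N) (w : V), S ∈ g → (∀ s : ℝ, ∃ p ∈ P,
        expGL (s • S) * (z : GLN N) = expGL ((ι (s • w)).1 : Mat N) * p ∧
          Ad p H = H - piI • ((ι (s • w)).2 : Mat N)) → D (S * ((z : GLN N) : Mat N)) = w := by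
      intro S w hS h
      have h1 : HasDerivAt (fun s : ℝ => s • w) w 0 := by
        simpa using (hasDerivAt_id (0 : ℝ)).smul_const w
      refine ((key S).congr_of_eventuallyEq ?_).unique h1
      filter_upwards [hev' S hS] with s hs
      exact hinj _ _ ((hF.mk_eq_mk_orbitLift_iff.2 (h s)).symm.trans hs)
    have hD1 := hcomp ((ι v).1 : Mat N) (ι.symm ((ι v).1, 0)) (ι v).1.2.1 fun s =>
      ⟨z, hzP, by simp [← map_smul], by simp [← map_smul, hzH]⟩
    have hD2 := hcomp ((ι v).2 : Mat N) (ι.symm (0, (ι v).2)) (ι v).2.2.1 fun s => by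
      have hm : s • ((ι v).2 : Mat N) ∈ gradedPiece g piI H 1 := (s • (ι v).2).2
      refine ⟨expGL (s • ((ι v).2 : Mat N)) * (z : GLN N),
        P.mul_mem (hF.exp_pos_mem_P hm) hzP, by simp [← map_smul], ?_⟩
      rw [Ad_mul, hzH, hF.Ad_exp_pos_H hm]
      simp [← map_smul]
    set S := ((ι v).1 : Mat N) + ((ι v).2 : Mat N) with hSdef
    have hS : S ∈ g := g.add_mem (ι v).1.2.1 (ι v).2.2.1
    refine ⟨Ad (z : GLN N)⁻¹ S, hF.groupG.Ad_mem (G.inv_mem z.2) hS,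
      fun s => c (expGL (s • S) * (z : GLN N) : GLN N), ?_, ?_⟩
    · have h1 := key S
      rw [hSdef, add_mul, map_add, hD1, hD2, ← map_add, Prod.mk_add_mk, add_zero, zero_add,
        Prod.mk.eta, ι.symm_apply_apply] at h1
      exact h1
    · filter_upwards [hev' S hS] with s hs a ha
      rw [← hs]
      congr 1
      apply Subtype.ext
      rw [ha, ← Ad_smul_real, expGL_Ad]
      group

end IsSymmetricFlag

end SymFlag

namespace SymFlag

variable {N : ℕ}

/-! ### Covectors of the flag manifold and the adjoint orbit -/

namespace IsSymmetricFlag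

variable {G U P : Subgroup (GLN N)} {g : LieSubalgebra ℂ (Mat N)}
  {u : LieSubalgebra ℝ (Mat N)} {H : Mat N} {R : GLN N}

theorem finrank_realPiece (hF : IsSymmetricFlag G U P g u H R) :
    Module.finrank ℝ (realPiece g H 1) = Module.finrank ℝ (realPiece g H (-1)) := by
  let e : realPiece g H 1 ≃ₗ[ℝ] realPiece g H (-1) :=
    { toFun := fun X => ⟨hstar R (X : Mat N), hF.hstar_mem_gradedPiece X.2⟩
      invFun := fun X => ⟨hstar R (X : Mat N), by
        have h := hF.hstar_mem_gradedPiece X.2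
        rwa [neg_neg] at h⟩
      map_add' := fun X Y => Subtype.ext (hstar_add R _ _)
      map_smul' := fun s X => Subtype.ext (hstar_smul_real R _ _)
      left_inv := fun X => Subtype.ext (hstar_hstar R _)
      right_inv := fun X => Subtype.ext (hstar_hstar R _) }
  exact e.finrank_eq

/-- The real part of the trace form identifies the nilradical with the dual of the opposite
nilradical. -/
theorem exists_dual (hF : IsSymmetricFlag G U P g u H R) {V : Type*} [NormedAddCommGroup V]
    [NormedSpace ℝ V] (ι : V ≃L[ℝ] realPiece g H (-1)) :
    ∃ κ : (V →L[ℝ] ℝ) ≃L[ℝ] realPiece g H 1,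
      ∀ ξ v, (((κ ξ : Mat N) * (ι v : Mat N)).trace).re = ξ v := by
  have : FiniteDimensional ℝ V := ι.symm.toLinearEquiv.finiteDimensional
  let T : realPiece g H 1 →ₗ[ℝ] V →L[ℝ] ℝ :=
    { toFun := fun X => LinearMap.toContinuousLinearMap
        { toFun := fun v => (((X : Mat N) * (ι v : Mat N)).trace).re
          map_add' := fun v w => by simp [mul_add]
          map_smul' := fun s v => by simp }
      map_add' := fun X Y => by ext v; simp [add_mul]
      map_smul' := fun s X => by ext v; simp }
  have hT : ∀ X v, T X v = (((X : Mat N) * (ι v : Mat N)).trace).re := fun X v => rfl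
  have hinj : Function.Injective T := by
    rw [injective_iff_map_eq_zero]
    intro X hX
    apply Subtype.ext
    refine hF.eq_zero_of_trace X.2 fun Y hY => ?_
    have h := congrArg (fun f : V →L[ℝ] ℝ => f (ι.symm ⟨Y, hY⟩)) hX
    simpa [hT] using h
  have hdim : Module.finrank ℝ (realPiece g H 1) = Module.finrank ℝ (V →L[ℝ] ℝ) := by
    rw [hF.finrank_realPiece, ← ι.toLinearEquiv.finrank_eq,
      ← (LinearMap.toContinuousLinearMap (𝕜 := ℝ) (E := V) (F' := ℝ)).finrank_eq]
    exact Subspace.dual_finrank_eq.symm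
  let e := LinearEquiv.ofInjectiveOfFinrankEq T hinj hdim
  refine ⟨e.symm.toContinuousLinearEquiv, fun ξ v => ?_⟩
  rw [← hT]
  exact congrArg (fun f : V →L[ℝ] ℝ => f v) (e.apply_symm_apply ξ)

variable {V : Type*} [NormedAddCommGroup V] [NormedSpace ℝ V]

/-- The class of `b exp(κ ξ)` in the adjoint orbit of `H`, for the covector `ξ` at `x`. Here `b` is
the representative of `x` at which the chart around `x` is centered. -/
noncomputable def cotangentMap (hF : IsSymmetricFlag G U P g u H R)
    (κ : (V →L[ℝ] ℝ) ≃L[ℝ] realPiece g H 1) (x : U ⧸ P.subgroupOf U) (ξ : V →L[ℝ] ℝ) :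
    G ⧸ centralizerIn G H :=
  QuotientGroup.mk (Subgroup.inclusion hF.groupU.le x.out *
    ⟨expGL (κ ξ : Mat N), hF.exp_mem_G (κ ξ).2.1⟩)

/-- Two elements of `G` are in the same class if and only if they move `H` to the same point. -/
theorem mk_eq_mk_iff {x y : G} :
    (QuotientGroup.mk x : G ⧸ centralizerIn G H) = QuotientGroup.mk y ↔
      Ad (x : GLN N) H = Ad (y : GLN N) H := by
  rw [QuotientGroup.eq]
  change Ad ((x⁻¹ * y : G) : GLN N) H = H ↔ _
  rw [Subgroup.coe_mul, Subgroup.coe_inv, Ad_mul]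
  constructor
  · intro h
    conv_lhs => rw [← h]
    rw [Ad_Ad_inv]
  · intro h
    rw [← h, Ad_inv_Ad]

theorem cotangentMap_eq_mk_iff (hF : IsSymmetricFlag G U P g u H R)
    (κ : (V →L[ℝ] ℝ) ≃L[ℝ] realPiece g H 1) {x : U ⧸ P.subgroupOf U} {ξ : V →L[ℝ] ℝ} {c : G} :
    hF.cotangentMap κ x ξ = QuotientGroup.mk c ↔
      Ad (c : GLN N) H = Ad (x.out : GLN N) (H - piI • (κ ξ : Mat N)) := by
  rw [cotangentMap, mk_eq_mk_iff, Subgroup.coe_mul, Ad_mul, eq_comm]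
  change _ = Ad _ (Ad (expGL (κ ξ : Mat N)) H) ↔ _
  rw [hF.Ad_exp_pos_H (κ ξ).2]
  rfl

theorem inv_mul_mem_P (hF : IsSymmetricFlag G U P g u H R)
    (κ : (V →L[ℝ] ℝ) ≃L[ℝ] realPiece g H 1) {x : U ⧸ P.subgroupOf U} {ξ : V →L[ℝ] ℝ} {c : G}
    (h : hF.cotangentMap κ x ξ = QuotientGroup.mk c) : (x.out : GLN N)⁻¹ * c ∈ P := by
  rw [hF.cotangentMap_eq_mk_iff] at h
  rw [hF.mem_P_iff, Ad_mul, h, Ad_inv_Ad, sub_sub_cancel_left]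
  exact ⟨G.mul_mem (G.inv_mem (hF.groupU.le x.out.2)) c.2,
    Submodule.neg_mem _ (Submodule.smul_mem _ _ (κ ξ).2)⟩

theorem out_inv_mul_mem {x : U ⧸ P.subgroupOf U} {a : U} (h : x = QuotientGroup.mk a) :
    (x.out : GLN N)⁻¹ * a ∈ P := by
  have h1 : (QuotientGroup.mk x.out : U ⧸ P.subgroupOf U) = QuotientGroup.mk a := by
    rw [QuotientGroup.out_eq', h]
  rw [QuotientGroup.eq, Subgroup.mem_subgroupOf] at h1
  exact h1

theorem cotangentMap_injective (hF : IsSymmetricFlag G U P g u H R)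
    (κ : (V →L[ℝ] ℝ) ≃L[ℝ] realPiece g H 1) {x y : U ⧸ P.subgroupOf U} {ξ η : V →L[ℝ] ℝ}
    (h : hF.cotangentMap κ x ξ = hF.cotangentMap κ y η) : x = y ∧ ξ = η := by
  obtain ⟨c, hc⟩ := QuotientGroup.mk_surjective (hF.cotangentMap κ x ξ)
  have h1 := hF.inv_mul_mem_P κ hc.symm
  have h2 := hF.inv_mul_mem_P κ (h.symm.trans hc.symm)
  have hxy : x = y := by
    rw [← QuotientGroup.out_eq' x, ← QuotientGroup.out_eq' y, QuotientGroup.eq,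
      Subgroup.mem_subgroupOf]
    have e : ((x.out⁻¹ * y.out : U) : GLN N) =
        ((x.out : GLN N)⁻¹ * c) * ((y.out : GLN N)⁻¹ * c)⁻¹ := by push_cast; group
    rw [e]
    exact P.mul_mem h1 (P.inv_mem h2)
  subst hxy
  refine ⟨rfl, ?_⟩
  have h3 := (hF.cotangentMap_eq_mk_iff κ).1 hc.symm
  rw [(hF.cotangentMap_eq_mk_iff κ).1 (h.symm.trans hc.symm)] at h3
  have h4 := Ad_injective _ h3
  rw [sub_right_inj] at h4
  exact (κ.injective (Subtype.ext (smul_right_injective _ piI_ne_zero h4))).symm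

theorem cotangentMap_surjective (hF : IsSymmetricFlag G U P g u H R)
    (κ : (V →L[ℝ] ℝ) ≃L[ℝ] realPiece g H 1) (y : G ⧸ centralizerIn G H) :
    ∃ x ξ, hF.cotangentMap κ x ξ = y := by
  obtain ⟨c, rfl⟩ := QuotientGroup.mk_surjective y
  obtain ⟨a, ha⟩ := hF.exists_flag c
  let x : U ⧸ P.subgroupOf U := QuotientGroup.mk a
  have h1 : (x.out : GLN N)⁻¹ * c ∈ P := by
    have e : (x.out : GLN N)⁻¹ * c = ((x.out : GLN N)⁻¹ * a) * ((a : GLN N)⁻¹ * c) := by group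
    rw [e]
    exact P.mul_mem (out_inv_mul_mem rfl) ha
  obtain ⟨X, hX, z, hz, hzH, h2⟩ := hF.exists_eq_exp_mul (hF.P_le h1) (hF.Ad_H_sub_mem h1)
  refine ⟨x, κ.symm ⟨X, hX⟩, ?_⟩
  rw [hF.cotangentMap_eq_mk_iff, κ.apply_symm_apply]
  have e : (c : GLN N) = (x.out : GLN N) * (expGL X * z) := by rw [← h2]; group
  rw [e, Ad_mul, Ad_mul, hzH, hF.Ad_exp_pos_H hX]

/-- Equivariance of `cotangentMap`, in terms of the element `z` of the isotropy group that compares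
the representatives of `x` and `y = a x`. -/
theorem smul_cotangentMap (hF : IsSymmetricFlag G U P g u H R)
    (κ : (V →L[ℝ] ℝ) ≃L[ℝ] realPiece g H 1) {x y : U ⧸ P.subgroupOf U} {ξ η : V →L[ℝ] ℝ}
    {a : U} {z : GLN N} (hz : Ad z H = H) (hy : (a : GLN N) * (x.out : GLN N) * z = y.out)
    (h : Ad z (κ η : Mat N) = κ ξ) :
    hF.cotangentMap κ y η = Subgroup.inclusion hF.groupU.le a • hF.cotangentMap κ x ξ := by
  obtain ⟨c, hc⟩ := QuotientGroup.mk_surjective (hF.cotangentMap κ x ξ)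
  have h1 := (hF.cotangentMap_eq_mk_iff κ).1 hc.symm
  rw [← hc, MulAction.Quotient.smul_mk, smul_eq_mul, hF.cotangentMap_eq_mk_iff, ← hy, Ad_mul _ z,
    Ad_sub, Ad_smul, hz, h, Subgroup.coe_mul, Ad_mul, h1, ← Ad_mul]
  rfl

/-! ### Changes of charts -/

theorem projNeg_Ad_mul_exp (hF : IsSymmetricFlag G U P g u H R) {z : GLN N} {X W : Mat N}
    (hz : z ∈ G) (hzH : Ad z H = H) (hX : X ∈ gradedPiece g piI H 1)
    (hW : W ∈ gradedPiece g piI H (-1)) : projNeg H (Ad (z * expGL X) W) = Ad z W := by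
  have h1 := lie_mem_gradedPiece hX hW
  have h2 := lie_mem_gradedPiece hX h1
  have e : Ad (expGL X) W = W + ⁅X, W⁆ + (2⁻¹ : ℂ) • ⁅X, ⁅X, W⁆⁆ := by
    rw [hF.Ad_exp_pos hX hW.1]
    congr 1
    rw [← Complex.coe_smul]
    norm_num
  rw [Ad_mul, e, Ad_add, Ad_add, Ad_smul]
  simp only [map_add, map_smul, projNeg_of_mem (Ad_mem_gradedPiece hF.groupG hz hzH hW),
    projNeg_of_mem (Ad_mem_gradedPiece hF.groupG hz hzH h1),
    projNeg_of_mem (Ad_mem_gradedPiece hF.groupG hz hzH h2)]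
  push_cast
  module

/-- The differential at `p P` of the projection to the flag manifold, in the chart centered at `b`:
the direction `W` is moved by `Ad p` and projected to the opposite nilradical. -/
theorem hasDerivAt_chart (hF : IsSymmetricFlag G U P g u H R) (ι : V ≃L[ℝ] realPiece g H (-1))
    {p : GLN N} (hp : p ∈ P) {b : U} {f : ℝ → G} {W : Mat N} (hW : W ∈ g)
    (hf : ∀ t, (f t : GLN N) = b * p * expGL (t • W)) {Y : realPiece g H (-1)}
    (hY : projNeg H (Ad p W) = Y) :
    HasDerivAt (fun t => (hF.isSlice_flag ι).chart b (hF.flagProj (f t))) (ι.symm Y) 0 := by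
  have hpW := hF.groupG.Ad_mem (hF.P_le hp) hW
  obtain ⟨c, hc, hev⟩ := hF.exists_coord (Submodule.zero_mem _) hp
  simp only [expGL_zero, one_mul] at hc hev
  have h1 := hF.hasDerivAt_coord hp (hc.differentiableAt (by simp)) hev hpW
  have h2 := ι.symm.hasFDerivAt.comp_hasDerivAt (0 : ℝ) h1
  have h3 : (⟨projNeg H (Ad p W), hF.projNeg_mem hpW⟩ : realPiece g H (-1)) = Y := Subtype.ext hY
  rw [h3] at h2
  refine HasDerivAt.congr_of_eventuallyEq h2 ?_
  have hpG : ∃ Y ∈ gradedPiece g piI H (-1), ∃ q ∈ P, p = expGL Y * q :=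
    ⟨0, Submodule.zero_mem _, p, hp, by simp⟩
  have ht : Tendsto (fun s : ℝ => expGL (s • Ad p W) * p) (𝓝 0) (𝓝 p) :=
    ((continuous_expGL.comp (continuous_id.smul continuous_const)).mul
      continuous_const).tendsto' _ _ (by simp)
  filter_upwards [(expGL_mul_coe_tendsto (Ad p W) p).eventually hev,
    ht.eventually (hF.eventually_eq_exp_neg_mul hpG)] with s hs hs'
  obtain ⟨Z, hZ, q, hq, hxq⟩ := hs' (G.mul_mem ((hF.groupG.lie _).1 hpW s) (hF.P_le hp))
  have h4 := hs ⟨Z, hZ⟩ q hq (by rw [hxq])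
  have h5 : hF.flagProj (f s) = (hF.isSlice_flag ι).param b (ι.symm ⟨Z, hZ⟩) := by
    rw [IsSlice.param_eq, ι.apply_symm_apply, hF.flagProj_eq_flagProj]
    have e : (f s : GLN N) = b * (expGL Z * q) := by
      rw [hf, ← hxq, ← Ad_smul_real, expGL_Ad]
      group
    rw [e]
    simpa [flagLift, mul_assoc] using P.inv_mem hq
  change (hF.isSlice_flag ι).chart b (hF.flagProj (f s)) =
    ι.symm (c (expGL (s • Ad p W) * p : GLN N))
  rw [h5, IsSlice.chart_param, h4]

/-- The chosen representative in `U` of the point `b exp(Y) P`. -/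
theorem out_param (hF : IsSymmetricFlag G U P g u H R) (ι : V ≃L[ℝ] realPiece g H (-1))
    {X : realPiece g H (-1) → realPiece g H 1}
    (hX : ∀ (Y : realPiece g H (-1)) (p : GLN N), p ∈ P → expGL (Y : Mat N) * p ∈ U →
      ∃ z ∈ G, Ad z H = H ∧ p = expGL (X Y : Mat N) * z) (b : U) (v : V) :
    ∃ z ∈ G, Ad z H = H ∧ (((hF.isSlice_flag ι).param b v).out : GLN N) =
      b * expGL (ι v : Mat N) * expGL (X (ι v) : Mat N) * z := by
  set x := (hF.isSlice_flag ι).param b v with hx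
  have h1 : hF.flagProj (Subgroup.inclusion hF.groupU.le b * hF.flagLift (ι v)) =
      QuotientGroup.mk x.out := by
    rw [QuotientGroup.out_eq', hx, IsSlice.param_eq]
  rw [hF.flagProj_eq_iff] at h1
  have h2 := P.inv_mem h1
  obtain ⟨z, hz, hzH, h3⟩ := hX (ι v) _ h2 (by
    have e : expGL (ι v : Mat N) * ((x.out : GLN N)⁻¹ *
        ((Subgroup.inclusion hF.groupU.le b * hF.flagLift (ι v) : G) : GLN N))⁻¹ =
        ((b⁻¹ * x.out : U) : GLN N) := by
      simp [flagLift, mul_assoc]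
    rw [e]
    exact (b⁻¹ * x.out).2)
  refine ⟨z, hz, hzH, ?_⟩
  rw [mul_assoc, ← h3]
  simp [flagLift, mul_assoc]

/-- The differential of a change of charts at the center of the second chart is the adjoint action
of an element of the isotropy group. -/
theorem hasDerivAt_chart_param (hF : IsSymmetricFlag G U P g u H R)
    (ι : V ≃L[ℝ] realPiece g H (-1)) {X : realPiece g H 1} {b : U} {v w : V} {z : GLN N}
    (hz : z ∈ G) (hzH : Ad z H = H) {b' : U}
    (hb' : (b' : GLN N) = b * expGL (ι v : Mat N) * expGL (X : Mat N) * z) {W : realPiece g H (-1)}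
    (hW : Ad z⁻¹ (ι w : Mat N) = W) :
    HasDerivAt (fun t : ℝ => (hF.isSlice_flag ι).chart b'
      ((hF.isSlice_flag ι).param b (v + t • w))) (ι.symm W) 0 := by
  have hz' := G.inv_mem hz
  have hzH' := Ad_inv_of_Ad_eq hzH
  have hX' : -(X : Mat N) ∈ gradedPiece g piI H 1 := Submodule.neg_mem _ X.2
  have hp : z⁻¹ * expGL (-(X : Mat N)) ∈ P :=
    P.mul_mem (hF.mem_P_of_centralizer hz' hzH') (hF.exp_pos_mem_P hX')
  simp only [IsSlice.param_eq]
  refine hF.hasDerivAt_chart ι hp (ι w).2.1 (fun t => ?_)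
    ((hF.projNeg_Ad_mul_exp hz' hzH' hX' (ι w).2).trans hW)
  have h1 : expGL (ι (v + t • w) : Mat N) = expGL (ι v : Mat N) * expGL (t • (ι w : Mat N)) := by
    rw [map_add, map_smul, Submodule.coe_add, Submodule.coe_smul]
    exact hF.expGL_add_of_neg (ι v).2 (t • ι w).2
  rw [Subgroup.coe_mul]
  change (b : GLN N) * expGL (ι (v + t • w) : Mat N) = _
  rw [h1, hb', expGL_neg]
  group

/-- In the charts, `cotangentMap` is `(Y, η) ↦ (Y, X + κ η)`, where `X` depends on `Y` only. -/
theorem cotangentMap_eq_param (hF : IsSymmetricFlag G U P g u H R)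
    (ι : V ≃L[ℝ] realPiece g H (-1)) {V' : Type*} [NormedAddCommGroup V'] [NormedSpace ℝ V']
    (ι' : V' ≃L[ℝ] realPiece g H (-1) × realPiece g H 1) (κ : (V →L[ℝ] ℝ) ≃L[ℝ] realPiece g H 1)
    {X : realPiece g H 1} {b : U} {v : V} {z : GLN N} (hzH : Ad z H = H) {x : U ⧸ P.subgroupOf U}
    (hx : (x.out : GLN N) = b * expGL (ι v : Mat N) * expGL (X : Mat N) * z) {ξ η : V →L[ℝ] ℝ}
    (h : Ad z (κ ξ : Mat N) = κ η) :
    hF.cotangentMap κ x ξ =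
      (hF.isSlice_orbit ι').param (Subgroup.inclusion hF.groupU.le b) (ι'.symm (ι v, X + κ η)) := by
  rw [IsSlice.param_eq, hF.cotangentMap_eq_mk_iff, hx, Ad_mul _ z, Ad_sub, Ad_smul, hzH, h,
    ι'.apply_symm_apply, ← hF.Ad_exp_pos_H (κ η).2, ← Ad_mul, mul_assoc _ (expGL (X : Mat N)),
    ← hF.expGL_add_of_pos X.2 (κ η).2, mul_assoc]
  rfl

/-- The identification of covectors with the nilradical is equivariant under the isotropy group,
because the trace form is invariant. -/
theorem dual_Ad (hF : IsSymmetricFlag G U P g u H R) {ι : V ≃L[ℝ] realPiece g H (-1)}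
    {κ : (V →L[ℝ] ℝ) ≃L[ℝ] realPiece g H 1}
    (hκ : ∀ ξ v, (((κ ξ : Mat N) * (ι v : Mat N)).trace).re = ξ v) {z : GLN N} (hz : z ∈ G)
    (hzH : Ad z H = H) {ξ η : V →L[ℝ] ℝ}
    (h : ∀ w w' : V, (ι w' : Mat N) = Ad z⁻¹ (ι w : Mat N) → η w = ξ w') :
    Ad z (κ ξ : Mat N) = κ η := by
  have hm := Ad_mem_gradedPiece hF.groupG hz hzH (κ ξ).2
  rw [← sub_eq_zero]
  refine hF.eq_zero_of_trace (Submodule.sub_mem _ hm (κ η).2) fun Y hY => ?_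
  have hY' := Ad_mem_gradedPiece hF.groupG (G.inv_mem hz) (Ad_inv_of_Ad_eq hzH) hY
  have h1 := h (ι.symm ⟨Y, hY⟩) (ι.symm ⟨_, hY'⟩) (by simp)
  rw [← hκ, ← hκ, ι.apply_symm_apply, ι.apply_symm_apply] at h1
  change ((_ * Y).trace).re = ((_ * Ad z⁻¹ Y).trace).re at h1
  rw [← trace_Ad_mul_Ad z (κ ξ : Mat N), Ad_Ad_inv] at h1
  rw [sub_mul, Matrix.trace_sub, Complex.sub_re, h1, sub_self]

end IsSymmetricFlag

end SymFlag

namespace SymFlag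

variable {N : ℕ}

/-! ### The cotangent bundle -/

/-- In the trivialization around `x₀`, a covector is composed with the inverse of the
trivialization of the tangent bundle. -/
theorem cotangent_trivializationAt_apply {V M : Type*} [NormedAddCommGroup V] [NormedSpace ℝ V]
    [TopologicalSpace M] [ChartedSpace V M] [IsManifold 𝓘(ℝ, V) ∞ M] (x₀ x : M)
    (ξ : CotangentSpace V x) (w : V) :
    (trivializationAt (V →L[ℝ] ℝ) (fun x : M => CotangentSpace V x) x₀ ⟨x, ξ⟩).2 w =
      ξ ((trivializationAt V (TangentSpace 𝓘(ℝ, V)) x₀).symmL ℝ x w) := by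
  rw [hom_trivializationAt_apply]
  simp [ContinuousLinearMap.inCoordinates]

namespace IsSymmetricFlag

variable {G U P : Subgroup (GLN N)} {g : LieSubalgebra ℂ (Mat N)}
  {u : LieSubalgebra ℝ (Mat N)} {H : Mat N} {R : GLN N}
  {V : Type*} [NormedAddCommGroup V] [NormedSpace ℝ V]

/-- The trivialization of the tangent bundle around `x₀`, at a point `x` of the chart around `x₀`,
is the adjoint action of the element `z` that compares the slice at `x₀` with the representative of
`x`. -/
theorem symmL_apply (hF : IsSymmetricFlag G U P g u H R) (ι : V ≃L[ℝ] realPiece g H (-1))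
    {x₀ x : U ⧸ P.subgroupOf U} {X : realPiece g H 1} {v w w' : V} {z : GLN N} (hz : z ∈ G)
    (hzH : Ad z H = H) (hx : x = (hF.isSlice_flag ι).param x₀.out v)
    (hxz : (x.out : GLN N) = x₀.out * expGL (ι v : Mat N) * expGL (X : Mat N) * z)
    (hw : (ι w' : Mat N) = Ad z⁻¹ (ι w : Mat N)) :
    letI := (hF.isSlice_flag ι).chartedSpace
    haveI := (hF.isSlice_flag ι).isManifold
    @Eq V ((trivializationAt V (TangentSpace 𝓘(ℝ, V)) x₀).symmL ℝ x w) w' := by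
  let _ := (hF.isSlice_flag ι).chartedSpace
  have hman := (hF.isSlice_flag ι).isManifold
  have hsrc : x ∈ (chartAt V x₀).source := by
    change x ∈ ((hF.isSlice_flag ι).chart x₀.out).source
    rw [IsSlice.chart_source, hx]
    exact ⟨v, rfl⟩
  have hchart : (hF.isSlice_flag ι).chart x₀.out x = v := by rw [hx, IsSlice.chart_param]
  have h1 := TangentBundle.symmL_trivializationAt_eq_core (I := 𝓘(ℝ, V)) hsrc
  have h2 : HasFDerivAt (fun v => (hF.isSlice_flag ι).chart x.out
      ((hF.isSlice_flag ι).param x₀.out v)) (tangentCoordChange 𝓘(ℝ, V) x₀ x x) v := by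
    have h3 := hasFDerivWithinAt_tangentCoordChange (I := 𝓘(ℝ, V)) (x := x₀) (y := x) (z := x)
      ⟨by simpa [extChartAt] using hsrc, mem_extChartAt_source x⟩
    have e1 : extChartAt 𝓘(ℝ, V) x ∘ (extChartAt 𝓘(ℝ, V) x₀).symm =
        fun v => (hF.isSlice_flag ι).chart x.out ((hF.isSlice_flag ι).param x₀.out v) := by
      funext v
      simp only [Function.comp_apply, extChartAt, mfld_simps]
      exact congrArg _ ((hF.isSlice_flag ι).chart_symm_apply _ _)
    have e2 : extChartAt 𝓘(ℝ, V) x₀ x = v := by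
      simp only [extChartAt, mfld_simps]
      exact hchart
    rw [e1, e2, modelWithCornersSelf_coe, Set.range_id, hasFDerivWithinAt_univ] at h3
    exact h3
  have h3 := hF.hasDerivAt_chart_param ι hz hzH hxz (w := w) hw.symm
  have h4 : HasDerivAt (fun t : ℝ => v + t • w) w 0 := by
    simpa using ((hasDerivAt_id (0 : ℝ)).smul_const w).const_add v
  have h5 : HasFDerivAt (fun v => (hF.isSlice_flag ι).chart x.out
      ((hF.isSlice_flag ι).param x₀.out v)) (tangentCoordChange 𝓘(ℝ, V) x₀ x x)
      (v + (0 : ℝ) • w) := by rwa [zero_smul, add_zero]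
  have h6 := h5.comp_hasDerivAt (0 : ℝ) h4
  replace h6 := h6.unique h3
  rw [ι.symm_apply_apply] at h6
  exact (congrArg (fun T : V →L[ℝ] V => T w) h1).trans h6

theorem smul_param (hF : IsSymmetricFlag G U P g u H R) (ι : V ≃L[ℝ] realPiece g H (-1)) (a b : U)
    (v : V) : a • (hF.isSlice_flag ι).param b v = (hF.isSlice_flag ι).param (a * b) v :=
  smul_smul a b _

/-- In the charts centered at two points, the action of an element of `U` is linear near the first
point, and its differential is given by the adjoint action of an element of the isotropy group. -/
theorem mfderiv_smul_apply (hF : IsSymmetricFlag G U P g u H R) (ι : V ≃L[ℝ] realPiece g H (-1))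
    {a : U} {x y : U ⧸ P.subgroupOf U} (hxy : a • y = x) {w w' : V} {z : GLN N}
    (hz : z ∈ G) (hzH : Ad z H = H) (hyz : (a : GLN N) * y.out = x.out * z)
    (hw : (ι w' : Mat N) = Ad z (ι w : Mat N)) :
    letI := (hF.isSlice_flag ι).chartedSpace
    @Eq V (mfderiv 𝓘(ℝ, V) 𝓘(ℝ, V) (fun y : U ⧸ P.subgroupOf U => a • y) y w) w' := by
  let _ := (hF.isSlice_flag ι).chartedSpace
  have hman := (hF.isSlice_flag ι).isManifold
  have hy0 : y = (hF.isSlice_flag ι).param y.out 0 := by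
    rw [IsSlice.param_zero, QuotientGroup.out_eq']
  have hy1 : (hF.isSlice_flag ι).chart y.out y = 0 := by
    conv_lhs => arg 2; rw [hy0]
    exact IsSlice.chart_param _ _ _
  have hrange : ∀ᶠ y' in 𝓝 y, y' ∈ Set.range ((hF.isSlice_flag ι).param y.out) :=
    ((hF.isSlice_flag ι).isOpenEmbedding_param y.out).isOpen_range.mem_nhds ⟨0, hy0.symm⟩
  have hmd : MDifferentiableAt 𝓘(ℝ, V) 𝓘(ℝ, V) (fun y : U ⧸ P.subgroupOf U => a • y) y := by
    have h1 : ContMDiffAt 𝓘(ℝ, V) 𝓘(ℝ, V) ∞ ((hF.isSlice_flag ι).param (a * y.out) ∘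
        (hF.isSlice_flag ι).chart y.out) y :=
      (((hF.isSlice_flag ι).contMDiff_param (a * y.out)).contMDiffAt).comp y
        (((hF.isSlice_flag ι).contMDiffOn_chart y.out).contMDiffAt hrange)
    refine (h1.congr_of_eventuallyEq ?_).mdifferentiableAt (by simp)
    filter_upwards [hrange] with y' hy'
    rw [Function.comp_apply, ← smul_param, IsSlice.param_chart _ hy']
  have hder : mfderiv 𝓘(ℝ, V) 𝓘(ℝ, V) (fun y : U ⧸ P.subgroupOf U => a • y) y =
      fderiv ℝ (fun v => (hF.isSlice_flag ι).chart x.out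
        ((hF.isSlice_flag ι).param (a * y.out) v)) 0 := by
    rw [hmd.mfderiv]
    have e1 : writtenInExtChartAt 𝓘(ℝ, V) 𝓘(ℝ, V) y (fun y : U ⧸ P.subgroupOf U => a • y) =
        fun v => (hF.isSlice_flag ι).chart x.out
          ((hF.isSlice_flag ι).param (a * y.out) v) := by
      funext v
      simp only [writtenInExtChartAt, extChartAt, mfld_simps]
      change (hF.isSlice_flag ι).chart (a • y).out
        (a • ((hF.isSlice_flag ι).chart y.out).symm v) = _
      rw [IsSlice.chart_symm_apply, smul_param, hxy]
    have e2 : extChartAt 𝓘(ℝ, V) y y = 0 := by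
      simp only [extChartAt, mfld_simps]
      exact hy1
    rw [e1, e2, modelWithCornersSelf_coe, Set.range_id, fderivWithin_univ]
  have hdiff : DifferentiableAt ℝ (fun v => (hF.isSlice_flag ι).chart x.out
      ((hF.isSlice_flag ι).param (a * y.out) v)) 0 := by
    have h1 := ((hF.isSlice_flag ι).contMDiffOn_chart x.out).contMDiffAt
      (x := (hF.isSlice_flag ι).param (a * y.out) 0)
      (((hF.isSlice_flag ι).isOpenEmbedding_param x.out).isOpen_range.mem_nhds ⟨0, by
        rw [← smul_param, ← hy0, hxy, IsSlice.param_zero, QuotientGroup.out_eq']⟩)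
    have h2 := h1.comp (0 : V) ((hF.isSlice_flag ι).contMDiff_param (a * y.out)).contMDiffAt
    exact (contMDiffAt_iff_contDiffAt.1 h2).differentiableAt (by simp)
  have h1 : HasDerivAt (fun t : ℝ => (hF.isSlice_flag ι).chart x.out
      ((hF.isSlice_flag ι).param (a * y.out) (t • w))) (ι.symm (ι w')) 0 := by
    simp only [IsSlice.param_eq]
    refine hF.hasDerivAt_chart ι (hF.mem_P_of_centralizer hz hzH) (ι w).2.1 (fun t => ?_) ?_
    · rw [← hyz]
      simp [flagLift]
    · rw [hw, projNeg_of_mem (Ad_mem_gradedPiece hF.groupG hz hzH (ι w).2)]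
      push_cast
      module
  have h2 : HasDerivAt (fun t : ℝ => t • w) w 0 := by
    simpa using (hasDerivAt_id (0 : ℝ)).smul_const w
  have h3 := hdiff.hasFDerivAt
  rw [← zero_smul ℝ w] at h3
  have h4 := h3.comp_hasDerivAt (0 : ℝ) h2
  replace h4 := h4.unique h1
  rw [ι.symm_apply_apply, zero_smul] at h4
  exact (congrArg (fun T : V →L[ℝ] V => T w) hder).trans h4

/-- The map `cotangentMap` is a diffeomorphism with the required properties. -/
theorem exists_isCotangentRealization (hF : IsSymmetricFlag G U P g u H R) {V' : Type*}
    [NormedAddCommGroup V'] [NormedSpace ℝ V'] (ι : V ≃L[ℝ] realPiece g H (-1))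
    (ι' : V' ≃L[ℝ] realPiece g H (-1) × realPiece g H 1) :
    letI := (hF.isSlice_flag ι).chartedSpace
    letI := (hF.isSlice_orbit ι').chartedSpace
    haveI := (hF.isSlice_flag ι).isManifold
    ∃ Φ : CotangentBundle V (U ⧸ P.subgroupOf U) ≃ G ⧸ centralizerIn G H,
      IsCotangentRealization hF.groupU.le P H V V' Φ := by
  let _ := (hF.isSlice_flag ι).chartedSpace
  let _ := (hF.isSlice_orbit ι').chartedSpace
  have hman := (hF.isSlice_flag ι).isManifold
  obtain ⟨κ, hκ⟩ := hF.exists_dual ι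
  obtain ⟨X, hXs, -, hXU⟩ := hF.exists_radial
  let φ : CotangentBundle V (U ⧸ P.subgroupOf U) → G ⧸ centralizerIn G H :=
    fun p => hF.cotangentMap κ p.proj p.snd
  have hφ : Function.Bijective φ := by
    constructor
    · rintro ⟨x, ξ⟩ ⟨y, η⟩ h
      obtain ⟨h1, h2⟩ := hF.cotangentMap_injective κ h
      subst h1
      exact congrArg _ h2
    · intro y
      obtain ⟨x, ξ, h⟩ := hF.cotangentMap_surjective κ y
      exact ⟨⟨x, ξ⟩, h⟩
  -- the map in the charts
  let T := fun x₀ : U ⧸ P.subgroupOf U =>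
    trivializationAt (V →L[ℝ] ℝ) (fun x : U ⧸ P.subgroupOf U => CotangentSpace V x) x₀
  have hloc : ∀ (x₀ : U ⧸ P.subgroupOf U) (v : V) (p : CotangentBundle V (U ⧸ P.subgroupOf U)),
      p.proj = (hF.isSlice_flag ι).param x₀.out v →
      φ p = (hF.isSlice_orbit ι').param (Subgroup.inclusion hF.groupU.le x₀.out)
        (ι'.symm (ι v, X (ι v) + κ (T x₀ p).2)) := by
    rintro x₀ v ⟨x, ξ⟩ hp
    obtain ⟨z, hz, hzH, h1⟩ := hF.out_param ι hXU x₀.out v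
    change x = _ at hp
    rw [← hp] at h1
    refine hF.cotangentMap_eq_param ι ι' κ hzH h1 (hF.dual_Ad hκ hz hzH fun w w' hw => ?_)
    have h2 := hF.symmL_apply ι hz hzH hp h1 hw
    have h3 := cotangent_trivializationAt_apply x₀ x ξ w
    exact h3.trans (congrArg (show V →L[ℝ] ℝ from ξ) h2)
  let Φ : CotangentBundle V (U ⧸ P.subgroupOf U) ≃ G ⧸ centralizerIn G H :=
    Equiv.ofBijective φ hφ
  have hsource : ∀ (x₀ x : U ⧸ P.subgroupOf U),
      x ∈ Set.range ((hF.isSlice_flag ι).param x₀.out) → x ∈ (T x₀).baseSet := by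
    intro x₀ x hx
    refine ⟨?_, trivial⟩
    change x ∈ ((hF.isSlice_flag ι).chart x₀.out).source
    rwa [IsSlice.chart_source]
  have hX' : ContDiff ℝ ∞ fun v => X (ι v) := hXs.comp ι.contDiff
  refine ⟨Φ, ?_, ?_, ?_, ?_⟩
  · intro p₀
    set x₀ := p₀.proj with hx₀
    have hx₀r : x₀ ∈ Set.range ((hF.isSlice_flag ι).param x₀.out) :=
      ⟨0, by rw [IsSlice.param_zero, QuotientGroup.out_eq']⟩
    have hopen := ((hF.isSlice_flag ι).isOpenEmbedding_param x₀.out).isOpen_range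
    have hpr : ContMDiffAt (𝓘(ℝ, V).prod 𝓘(ℝ, V →L[ℝ] ℝ)) 𝓘(ℝ, V) ∞
        (fun p : CotangentBundle V (U ⧸ P.subgroupOf U) => p.proj) p₀ :=
      Bundle.contMDiffAt_proj (fun x : U ⧸ P.subgroupOf U => CotangentSpace V x)
    have h1 : ContMDiffAt (𝓘(ℝ, V).prod 𝓘(ℝ, V →L[ℝ] ℝ)) 𝓘(ℝ, V) ∞
        (fun p : CotangentBundle V (U ⧸ P.subgroupOf U) =>
          (hF.isSlice_flag ι).chart x₀.out p.proj) p₀ :=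
      (((hF.isSlice_flag ι).contMDiffOn_chart x₀.out).contMDiffAt (hopen.mem_nhds hx₀r)).comp p₀ hpr
    have h2 : ContMDiffAt (𝓘(ℝ, V).prod 𝓘(ℝ, V →L[ℝ] ℝ)) 𝓘(ℝ, V →L[ℝ] ℝ) ∞
        (fun p : CotangentBundle V (U ⧸ P.subgroupOf U) => (T x₀ p).2) p₀ := by
      have h3 := (Bundle.Trivialization.contMDiffOn (IB := 𝓘(ℝ, V)) (n := ∞) (T x₀)).contMDiffAt
        ((T x₀).open_source.mem_nhds ((T x₀).mem_source.2 (hsource _ _ hx₀r)))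
      exact contMDiffAt_snd.comp p₀ h3
    have hA : ContDiff ℝ ∞ fun q : V × (V →L[ℝ] ℝ) => ι'.symm (ι q.1, X (ι q.1) + κ q.2) :=
      ι'.symm.contDiff.comp ((ι.contDiff.comp contDiff_fst).prodMk
        ((hX'.comp contDiff_fst).add (κ.contDiff.comp contDiff_snd)))
    have h3 := (((hF.isSlice_orbit ι').contMDiff_param
      (Subgroup.inclusion hF.groupU.le x₀.out)).contMDiffAt).comp p₀
        (hA.contMDiff.contMDiffAt.comp p₀ (h1.prodMk_space h2))
    refine h3.congr_of_eventuallyEq ?_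
    filter_upwards [hpr.continuousAt.eventually (hopen.mem_nhds hx₀r)] with p hp
    exact hloc x₀ _ p ((hF.isSlice_flag ι).param_chart hp).symm
  · intro y₀
    set x₀ := (Φ.symm y₀).proj with hx₀
    set b := Subgroup.inclusion hF.groupU.le x₀.out with hb
    have hopen := ((hF.isSlice_orbit ι').isOpenEmbedding_param b).isOpen_range
    have hy₀ : y₀ ∈ Set.range ((hF.isSlice_orbit ι').param b) := by
      have h1 := hloc x₀ 0 (Φ.symm y₀)
        (by rw [IsSlice.param_zero, QuotientGroup.out_eq', hx₀])
      have h2 : φ (Φ.symm y₀) = y₀ := Φ.apply_symm_apply y₀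
      rw [h2] at h1
      exact ⟨_, h1.symm⟩
    let A : V' → V × (V →L[ℝ] ℝ) := fun v' =>
      (ι.symm (ι' v').1, κ.symm ((ι' v').2 - X (ι' v').1))
    have hA : ContDiff ℝ ∞ A :=
      (ι.symm.contDiff.comp (contDiff_fst.comp ι'.contDiff)).prodMk
        (κ.symm.contDiff.comp ((contDiff_snd.comp ι'.contDiff).sub
          (hXs.comp (contDiff_fst.comp ι'.contDiff))))
    have h1 : ContMDiffAt 𝓘(ℝ, V') 𝓘(ℝ, V × (V →L[ℝ] ℝ)) ∞
        (fun y => A ((hF.isSlice_orbit ι').chart b y)) y₀ :=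
      hA.contMDiff.contMDiffAt.comp y₀
        (((hF.isSlice_orbit ι').contMDiffOn_chart b).contMDiffAt (hopen.mem_nhds hy₀))
    have h2 : ContMDiffAt 𝓘(ℝ, V') (𝓘(ℝ, V).prod 𝓘(ℝ, V →L[ℝ] ℝ)) ∞
        (fun y => ((hF.isSlice_flag ι).param x₀.out (A ((hF.isSlice_orbit ι').chart b y)).1,
          (A ((hF.isSlice_orbit ι').chart b y)).2)) y₀ := by
      refine ContMDiffAt.prodMk ?_ ?_
      · exact (((hF.isSlice_flag ι).contMDiff_param x₀.out).contMDiffAt).comp y₀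
          (contDiff_fst.contMDiff.contMDiffAt.comp y₀ h1)
      · exact contDiff_snd.contMDiff.contMDiffAt.comp y₀ h1
    have htarget : ∀ (v : V) (η : V →L[ℝ] ℝ),
        ((hF.isSlice_flag ι).param x₀.out v, η) ∈ (T x₀).target := fun v η =>
      (T x₀).mem_target.2 (hsource _ _ ⟨v, rfl⟩)
    have h3 := ((Bundle.Trivialization.contMDiffOn_symm (IB := 𝓘(ℝ, V)) (n := ∞) (T x₀)).contMDiffAt
      ((T x₀).open_target.mem_nhds (htarget _ _))).comp y₀ h2
    refine h3.congr_of_eventuallyEq ?_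
    filter_upwards [hopen.mem_nhds hy₀] with y hy
    rw [Equiv.symm_apply_eq]
    set v' := (hF.isSlice_orbit ι').chart b y with hv'
    set q := (T x₀).toOpenPartialHomeomorph.symm
      ((hF.isSlice_flag ι).param x₀.out (A v').1, (A v').2) with hq
    have h4 : q.proj = (hF.isSlice_flag ι).param x₀.out (A v').1 :=
      (T x₀).proj_symm_apply (htarget _ _)
    have h5 : (T x₀ q).2 = (A v').2 := by
      have := (T x₀).apply_symm_apply (htarget (A v').1 (A v').2)
      exact congrArg Prod.snd this
    change y = φ q
    rw [hloc x₀ _ q h4, h5]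
    simp only [A, ContinuousLinearEquiv.apply_symm_apply, add_sub_cancel, Prod.mk.eta,
      ContinuousLinearEquiv.symm_apply_apply]
    exact ((hF.isSlice_orbit ι').param_chart hy).symm
  · rintro a ⟨x, ξ⟩
    set y := a • x with hy
    have hz' : (y.out⁻¹ * (a * x.out) : U) ∈ P.subgroupOf U := by
      rw [← QuotientGroup.eq, QuotientGroup.out_eq', hy, ← smul_eq_mul,
        ← MulAction.Quotient.smul_mk, QuotientGroup.out_eq']
    have hzU := (P.subgroupOf U).inv_mem hz'
    set z : U := (y.out⁻¹ * (a * x.out))⁻¹ with hzdef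
    have hzH : Ad (z : GLN N) H = H := (hF.mem_P_iff_of_mem_U z.2).1 hzU
    have hzG := hF.groupU.le z.2
    have hyz : (a : GLN N) * (x.out : GLN N) * (z : GLN N) = y.out := by
      rw [hzdef]; push_cast; group
    have hxy : a⁻¹ • y = x := by rw [hy, inv_smul_smul]
    refine hF.smul_cotangentMap κ hzH hyz ?_
    refine hF.dual_Ad hκ hzG hzH fun w w' hw => ?_
    have hw' : (ι w : Mat N) = Ad (z : GLN N) (ι w' : Mat N) := by rw [hw, Ad_Ad_inv]
    have h1 := hF.mfderiv_smul_apply ι hxy hzG hzH (by rw [← hyz]; simp [mul_assoc]) hw'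
    exact (congrArg (show V →L[ℝ] ℝ from ξ) h1).symm
  · intro a
    let x : U ⧸ P.subgroupOf U := QuotientGroup.mk a
    let ℓ : (V →L[ℝ] ℝ) →ₗ[ℝ] Mat N :=
      { toFun := fun ξ => -(piI • Ad (x.out : GLN N) (κ ξ : Mat N))
        map_add' := fun ξ η => by
          rw [map_add, Submodule.coe_add, Ad_add, smul_add, neg_add]
        map_smul' := fun s ξ => by
          rw [map_smul, Submodule.coe_smul, Ad_smul_real, smul_comm, ← smul_neg]; rfl }
    refine ⟨ℓ, fun ξ c hc => ?_⟩
    have hxa : (x.out : GLN N)⁻¹ * a ∈ P := out_inv_mul_mem rfl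
    have h1 := hF.inv_mul_mem_P κ (x := x) (ξ := ξ) hc
    have h2 := (hF.cotangentMap_eq_mk_iff κ (x := x) (ξ := ξ)).1 hc
    constructor
    · have e : (a : GLN N)⁻¹ * c = ((x.out : GLN N)⁻¹ * a)⁻¹ * ((x.out : GLN N)⁻¹ * c) := by group
      rw [e]
      exact P.mul_mem (P.inv_mem hxa) h1
    · have h3 : Ad ((x.out⁻¹ * a : U) : GLN N) H = H :=
        (hF.mem_P_iff_of_mem_U (x.out⁻¹ * a).2).1 hxa
      have h4 : Ad (a : GLN N) H = Ad (x.out : GLN N) H := by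
        conv_rhs => rw [← h3]
        rw [← Ad_mul]
        simp
      rw [h2, h4, Ad_sub, Ad_smul, sub_eq_add_neg]
      rfl

end IsSymmetricFlag

end SymFlag

namespace SymFlag

variable {N : ℕ}

/-! ### The symmetric spaces and Lie algebras of a symmetric flag -/

theorem exists_lieEquiv_Ad {S : Type*} [CommRing S] [LieAlgebra S (Mat N)]
    (k : LieSubalgebra S (Mat N)) (e : GLN N) (hsmul : ∀ (s : S) X, Ad e (s • X) = s • Ad e X)
    (hmem : ∀ X ∈ k, Ad e X ∈ k) (hinv : ∀ X ∈ k, Ad e (Ad e X) = X) :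
    ∃ σ : k ≃ₗ⁅S⁆ k, ∀ X : k, (σ X : Mat N) = Ad e X := by
  refine ⟨{ toFun := fun X => ⟨Ad e X, hmem _ X.2⟩
            map_add' := fun X Y => Subtype.ext (Ad_add e _ _)
            map_smul' := fun s X => Subtype.ext (hsmul s _)
            map_lie' := fun {X Y} => Subtype.ext (Ad_lie e _ _)
            invFun := fun X => ⟨Ad e X, hmem _ X.2⟩
            left_inv := fun X => Subtype.ext (hinv _ X.2)
            right_inv := fun X => Subtype.ext (hinv _ X.2) }, fun X => rfl⟩

namespace IsSymmetricFlag

variable {G U P : Subgroup (GLN N)} {g : LieSubalgebra ℂ (Mat N)}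
  {u : LieSubalgebra ℝ (Mat N)} {H : Mat N} {R : GLN N}

theorem subgroupOf_eq (hF : IsSymmetricFlag G U P g u H R) :
    P.subgroupOf U = centralizerIn U H :=
  Subgroup.ext fun a => hF.mem_P_iff_of_mem_U a.2

theorem exp_H_mem (hF : IsSymmetricFlag G U P g u H R) : expGL H ∈ U :=
  hF.groupU.lie.exp_mem (X := H) hF.mem_u

theorem isSymmetricSpace_U (hF : IsSymmetricFlag G U P g u H R) :
    IsSymmetricSpace (P.subgroupOf U) (MulAut.conj (⟨expGL H, hF.exp_H_mem⟩ : U)) := by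
  rw [hF.subgroupOf_eq]
  exact hF.isSymmetricSpace hF.groupU.compact.isClosed hF.groupU.connected hF.groupU.lie
    (fun X hX => hF.groupU.mem_of_mem hX) hF.groupU.le _ rfl

theorem isSymmetricSpace_G (hF : IsSymmetricFlag G U P g u H R) :
    IsSymmetricSpace (centralizerIn G H)
      (MulAut.conj (Subgroup.inclusion hF.groupU.le (⟨expGL H, hF.exp_H_mem⟩ : U))) :=
  hF.isSymmetricSpace hF.groupG.closed hF.groupG.connected hF.groupG.lie (fun _ hX => hX) le_rfl _
    rfl

theorem conj_exp_H_eq_iff {K : Subgroup (GLN N)} {e : K} (he : (e : GLN N) = expGL H) (a : K) :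
    MulAut.conj e a = a ↔ expGL H * a * (expGL H)⁻¹ = (a : GLN N) := by
  rw [Subtype.ext_iff]
  simp [he]

theorem mem_iff_of_full (hF : IsSymmetricFlag G U P g u H R) {τ : U ≃* U}
    (hτ : ∀ a : U, (τ a : GLN N) = expGL H * a * (expGL H)⁻¹)
    (hfull : ∀ a : U, a ∈ P.subgroupOf U ↔ τ a = a) :
    (∀ a : U, a ∈ P.subgroupOf U ↔ MulAut.conj (⟨expGL H, hF.exp_H_mem⟩ : U) a = a) ∧
    (∀ c : G, c ∈ centralizerIn G H ↔
      MulAut.conj (Subgroup.inclusion hF.groupU.le (⟨expGL H, hF.exp_H_mem⟩ : U)) c = c) := by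
  have h1 : ∀ a : U, a ∈ P.subgroupOf U ↔ MulAut.conj (⟨expGL H, hF.exp_H_mem⟩ : U) a = a := by
    intro a
    rw [hfull, conj_exp_H_eq_iff (H := H) rfl, Subtype.ext_iff, hτ]
  refine ⟨h1, fun c => ⟨hF.isSymmetricSpace_G.le_fixed c, fun h => ?_⟩⟩
  rw [conj_exp_H_eq_iff (H := H) rfl] at h
  refine hF.centralizer_of_fixed (fun a ha hfix => ?_) c.2 h
  have h2 := (h1 ⟨a, ha⟩).2 ((conj_exp_H_eq_iff (H := H) rfl _).2 hfix)
  exact (hF.mem_P_iff_of_mem_U ha).1 h2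

/-- The slices give the smooth structures, with Euclidean spaces as models. -/
theorem exists_manifolds (hF : IsSymmetricFlag G U P g u H R) :
    ∃ (d m : ℕ)
      (_ : ChartedSpace (EuclideanSpace ℝ (Fin d)) (U ⧸ P.subgroupOf U))
      (_ : IsManifold 𝓘(ℝ, EuclideanSpace ℝ (Fin d)) ∞ (U ⧸ P.subgroupOf U))
      (_ : ChartedSpace (EuclideanSpace ℝ (Fin m)) (G ⧸ centralizerIn G H))
      (Φ : CotangentBundle (EuclideanSpace ℝ (Fin d)) (U ⧸ P.subgroupOf U) ≃
        G ⧸ centralizerIn G H),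
      IsHomogeneousManifold hF.groupU.lie (P.subgroupOf U) (EuclideanSpace ℝ (Fin d)) ∧
      IsHomogeneousManifold hF.groupG.lie (centralizerIn G H) (EuclideanSpace ℝ (Fin m)) ∧
      IsCotangentRealization hF.groupU.le P H (EuclideanSpace ℝ (Fin d))
        (EuclideanSpace ℝ (Fin m)) Φ := by
  let ι : EuclideanSpace ℝ (Fin (Module.finrank ℝ (realPiece g H (-1)))) ≃L[ℝ]
      realPiece g H (-1) := ContinuousLinearEquiv.ofFinrankEq (by simp)
  let ι' : EuclideanSpace ℝ (Fin (Module.finrank ℝ (realPiece g H (-1) × realPiece g H 1))) ≃L[ℝ]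
      realPiece g H (-1) × realPiece g H 1 := ContinuousLinearEquiv.ofFinrankEq (by simp)
  obtain ⟨Φ, hΦ⟩ := hF.exists_isCotangentRealization ι ι'
  exact ⟨_, _, (hF.isSlice_flag ι).chartedSpace, (hF.isSlice_flag ι).isManifold,
    (hF.isSlice_orbit ι').chartedSpace, Φ,
    (hF.isSlice_flag ι).isHomogeneousManifold hF.groupU.lie,
    (hF.isSlice_orbit ι').isHomogeneousManifold hF.groupG.lie, hΦ⟩

theorem exists_isSymmetricLieAlgebra_u (hF : IsSymmetricFlag G U P g u H R) :
    ∃ (uΘ : LieSubalgebra ℝ u) (σu : u ≃ₗ⁅ℝ⁆ u),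
      (∀ X : u, X ∈ uΘ ↔ ∀ s : ℝ,
        expGL (s • (X : Mat N)) ∈ (P.subgroupOf U).map U.subtype) ∧
      (∀ X : u, (σu X : Mat N) = Ad (expGL H) X) ∧ IsSymmetricLieAlgebra uΘ σu := by
  obtain ⟨σ, hσ⟩ := exists_lieEquiv_Ad u (expGL H) (Ad_smul_real _)
    (fun X hX => hF.groupU.lie.Ad_mem hF.exp_H_mem (X := X) hX)
    (fun X hX => hF.Ad_exp_H_Ad_exp_H (hF.groupU.mem_of_mem hX))
  have hmem : ∀ X : u, X ∈ lieCentralizer ℝ (⟨H, hF.mem_u⟩ : u) ↔ ⁅H, (X : Mat N)⁆ = 0 := by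
    intro X
    change (⁅(⟨H, hF.mem_u⟩ : u), X⁆ : u) = 0 ↔ _
    rw [Subtype.ext_iff]
    rfl
  refine ⟨lieCentralizer ℝ (⟨H, hF.mem_u⟩ : u), σ, fun X => ?_, hσ, fun X => ?_, fun X => ?_⟩
  · have hXU : ∀ s : ℝ, expGL (s • (X : Mat N)) ∈ U := (hF.groupU.lie X).1 X.2
    have h1 : ∀ s : ℝ, expGL (s • (X : Mat N)) ∈ (P.subgroupOf U).map U.subtype ↔
        Ad (expGL (s • (X : Mat N))) H = H := by
      intro s
      rw [Subgroup.subgroupOf_map_subtype, Subgroup.mem_inf, hF.mem_P_iff_of_mem_U (hXU s),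
        and_iff_left (hXU s)]
    simp only [h1, hmem]
    constructor
    · intro h s
      refine Ad_expGL_of_lie_eq_zero ?_
      rw [smul_lie, ← lie_skew, h, neg_zero, smul_zero]
    · intro h
      rw [← lie_skew, lie_eq_zero_of_Ad_expGL h, neg_zero]
  · apply Subtype.ext
    rw [hσ, hσ, hF.Ad_exp_H_Ad_exp_H (hF.groupU.mem_of_mem X.2)]
  · rw [hmem, Subtype.ext_iff, hσ, hF.Ad_exp_H_eq_iff (hF.groupU.mem_of_mem X.2)]

theorem exists_isSymmetricLieAlgebra_g (hF : IsSymmetricFlag G U P g u H R) (Hg : g)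
    (hHg : (Hg : Mat N) = H) :
    ∃ σg : g ≃ₗ⁅ℂ⁆ g,
      (∀ X : g, (σg X : Mat N) = Ad (expGL H) X) ∧
      IsSymmetricLieAlgebra (lieCentralizer ℂ Hg) σg := by
  obtain ⟨σ, hσ⟩ := exists_lieEquiv_Ad g (expGL H) (Ad_smul _)
    (fun X hX => hF.groupG.Ad_mem (hF.exp_mem_G hF.mem_g) hX)
    (fun X hX => hF.Ad_exp_H_Ad_exp_H hX)
  refine ⟨σ, hσ, fun X => ?_, fun X => ?_⟩
  · apply Subtype.ext
    rw [hσ, hσ, hF.Ad_exp_H_Ad_exp_H X.2]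
  · rw [Subtype.ext_iff, hσ, hF.Ad_exp_H_eq_iff X.2]
    change (⁅Hg, X⁆ : g) = 0 ↔ _
    rw [Subtype.ext_iff, ← hHg]
    rfl

end IsSymmetricFlag

end SymFlag

end

theorem theoremA {N : ℕ}
    -- the connected complex semisimple group `G` and its Lie algebra
    (G : Subgroup (SymFlag.GLN N)) (g : LieSubalgebra ℂ (SymFlag.Mat N))
    [LieAlgebra.IsSemisimple ℂ g] (hG : SymFlag.IsConnectedComplexGroup G g)
    -- its compact real form `U`
    (U : Subgroup (SymFlag.GLN N)) (u : LieSubalgebra ℝ (SymFlag.Mat N))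
    (hU : SymFlag.IsCompactRealForm G g U u)
    -- the fixed Cartan subalgebras `t` of `u` and `h = t + i t` of `g`
    (t : LieSubalgebra ℝ u) [t.IsCartanSubalgebra]
    (h : LieSubalgebra ℂ g) [h.IsCartanSubalgebra] (hth : SymFlag.IsComplexificationOf h t)
    -- the simple roots, and the set `Θ` of simple roots that defines the flag manifold
    (b : (LieAlgebra.IsKilling.rootSystem h).Base) (Θ : Finset h.root) (hΘ : Θ ⊆ b.support)
    -- `U / U_Θ` is a symmetric flag space
    (τ : U ≃* U) (hτ : SymFlag.IsSymmetricSpace (SymFlag.isotropy G U b Θ) τ) :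
    ∃ (H : h) (gΘ : U),
      -- `H` lies in the Cartan subalgebra `t` of `u` and is characteristic for `Θ`
      (∃ A ∈ t, (A : SymFlag.Mat N) = ((H : g) : SymFlag.Mat N)) ∧
      (∀ α ∈ b.support, α ∈ Θ ↔ (α : LieModule.Weight ℂ h g) H = 0) ∧
      -- `gΘ = exp H`, and `σ` is the conjugation by `gΘ`
      (gΘ : SymFlag.GLN N) = SymFlag.expGL ((H : g) : SymFlag.Mat N) ∧
      -- `U_Θ` is the centralizer of `H` in `U`, and `(U, U_Θ, σ)` is a symmetric space
      SymFlag.isotropy G U b Θ = SymFlag.centralizerIn U ((H : g) : SymFlag.Mat N) ∧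
      SymFlag.IsSymmetricSpace (SymFlag.isotropy G U b Θ) (MulAut.conj gΘ) ∧
      -- `(G, Z_G(H), σ)` is a symmetric space
      SymFlag.IsSymmetricSpace (SymFlag.centralizerIn G ((H : g) : SymFlag.Mat N))
        (MulAut.conj (Subgroup.inclusion hU.le gΘ)) ∧
      -- the isotropy groups are the whole fixed-point groups of `σ`
      ((∀ a : U, a ∈ SymFlag.isotropy G U b Θ ↔ τ a = a) →
        (∀ a : U, a ∈ SymFlag.isotropy G U b Θ ↔ MulAut.conj gΘ a = a) ∧
        (∀ c : G, c ∈ SymFlag.centralizerIn G ((H : g) : SymFlag.Mat N) ↔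
          MulAut.conj (Subgroup.inclusion hU.le gΘ) c = c)) ∧
      -- the cotangent bundle of `U / U_Θ` is `G / Z_G(H)`
      (∃ (d m : ℕ)
        (_ : ChartedSpace (EuclideanSpace ℝ (Fin d)) (U ⧸ SymFlag.isotropy G U b Θ))
        (_ : IsManifold 𝓘(ℝ, EuclideanSpace ℝ (Fin d)) ∞ (U ⧸ SymFlag.isotropy G U b Θ))
        (_ : ChartedSpace (EuclideanSpace ℝ (Fin m))
          (G ⧸ SymFlag.centralizerIn G ((H : g) : SymFlag.Mat N)))
        (Φ : SymFlag.CotangentBundle (EuclideanSpace ℝ (Fin d))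
            (U ⧸ SymFlag.isotropy G U b Θ) ≃
          G ⧸ SymFlag.centralizerIn G ((H : g) : SymFlag.Mat N)),
        SymFlag.IsHomogeneousManifold hU.lie (SymFlag.isotropy G U b Θ)
          (EuclideanSpace ℝ (Fin d)) ∧
        SymFlag.IsHomogeneousManifold hG.lie
          (SymFlag.centralizerIn G ((H : g) : SymFlag.Mat N)) (EuclideanSpace ℝ (Fin m)) ∧
        SymFlag.IsCotangentRealization hU.le (SymFlag.parabolicSubgroup G b Θ)
          ((H : g) : SymFlag.Mat N) (EuclideanSpace ℝ (Fin d)) (EuclideanSpace ℝ (Fin m)) Φ) ∧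
      -- `(u, u_Θ, Ad(exp H))` is a symmetric Lie algebra, `u_Θ` being the Lie algebra of `U_Θ`
      (∃ (uΘ : LieSubalgebra ℝ u) (σu : u ≃ₗ⁅ℝ⁆ u),
        (∀ X : u, X ∈ uΘ ↔ ∀ s : ℝ,
          SymFlag.expGL (s • (X : SymFlag.Mat N)) ∈
            (SymFlag.isotropy G U b Θ).map U.subtype) ∧
        (∀ X : u, (σu X : SymFlag.Mat N) = SymFlag.Ad (gΘ : SymFlag.GLN N) X) ∧
        SymFlag.IsSymmetricLieAlgebra uΘ σu) ∧
      -- `(g, z_g(H), Ad(exp H))` is a symmetric Lie algebra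
      (∃ σg : g ≃ₗ⁅ℂ⁆ g,
        (∀ X : g, (σg X : SymFlag.Mat N) = SymFlag.Ad (gΘ : SymFlag.GLN N) X) ∧
        SymFlag.IsSymmetricLieAlgebra (SymFlag.lieCentralizer ℂ (H : g)) σg) := by
  obtain ⟨H, R, hHt, hHΘ, hF, hτH⟩ := SymFlag.exists_isSymmetricFlag hG hU hth hΘ hτ
  exact ⟨H, ⟨SymFlag.expGL ((H : g) : SymFlag.Mat N), hF.exp_H_mem⟩, hHt, hHΘ, rfl,
    hF.subgroupOf_eq, hF.isSymmetricSpace_U, hF.isSymmetricSpace_G,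
    fun hfull => hF.mem_iff_of_full hτH hfull, hF.exists_manifolds,
    hF.exists_isSymmetricLieAlgebra_u, hF.exists_isSymmetricLieAlgebra_g (H : g) rfl⟩
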